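/- Let $k$ be a field and let $D$ be a finite-dimensional division algebra over $k$. For a finite-dimensional $k$-algebra $A$, the dual $A^*=\mathrm{Hom}_k(A,k)$ is a coalgebra whose comultiplication is dual to the multiplication of $A$. If $M$ is a finite-dimensional $A$-bimodule (with $k$ acting centrally), then $M^*$ is an $A^*$-bicomodule whose left coaction $M^*\to A^*\otimes M^*$ and right coaction $M^*\to M^*\otimes A^*$ are dual to the actions $A\otimes M\to M$ and $M\otimes A\to M$. For a coalgebra $C$ and a $C$-bicomodule $P$ with coactions $\rho^l,\rho^r$, the cotensor coalgebra is $T_C(P)=C\oplus\bigoplus_{n\ge 1}P^{\Box_C n}$, where $P^{\Box_C n}=P\Box_C\cdots\Box_C P$ ($n$ factors). Its comultiplication is $\Delta_C$ on $C$, is $\rho^l+\rho^r$ on $P$, and for $n\geq 2$ is given by $$\Delta(p_1\Box\cdots\Box p_n)=\sum (p_1)_{-1}\otimes\big((p_1)_0\Box\cdots\Box p_n\big)+\sum_{i=1}^{n-1}(p_1\Box\cdots\Box p_i)\otimes(p_{i+1}\Box\cdots\Box p_n)+\sum\big(p_1\Box\cdots\Box (p_n)_0\big)\otimes (p_n)_1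 .$$ Its counit is $\varepsilon_C$ on $C$ and $0$ on the other summands. A right coideal of a coalgebra $C$ is a subspace $N$ with $\Delta(N)\subseteq N\otimes C$. A coalgebra $C$ is a chain coalgebra if its right coideals are linearly ordered by inclusion. It is a chain coalgebra of type $D$ if, moreover, $(C_0)^*\cong D$ as $k$-algebras, where $C_0$ is the coradical of $C$ (the sum of the simple right coideals, which is a subcoalgebra) and $(C_0)^*$ carries the convolution product $(f*g)(x)=\sum f(x_1)g(x_2)$. Theorem. (1) For every $D$-bimodule $M$ (with $k$ acting centrally) such that $M\cong D$ as $k$-vector spaces, the cotensor coalgebra $T_{D^*}(M^*)$ is a chain coalgebra of type $D$. (2) If $D$ is separable over $k$ (that is, the multiplication map $D\otimes_k D\to D$ is split as a map of $D$-bimodules), then for every chain coalgebra $C$ of type $D$ there are a $D$-bimodule $M$ (with $k$ acting centrally) such that $M\cong D$ as $k$-vector spaces and an injective coalgebra homomorphism $C\to T_{D^*}(M^*)$. -/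

import Mathlib

open scoped TensorProduct DirectSum

noncomputable section

namespace ChainCoalg

open TensorProduct LinearMap

section Factor

section

variable {k : Type*} [Field k] {A B Z : Type*} [AddCommMonoid A] [Module k A] [AddCommMonoid B]
  [Module k B] [AddCommMonoid Z] [Module k Z]

/-- The factorization of a linear map through an injective one whose range contains its range. -/
def factor (j : A →ₗ[k] B) (hj : Function.Injective j) (f : Z →ₗ[k] B)
    (h : ∀ z, f z ∈ range j) : Z →ₗ[k] A :=
  (LinearEquiv.ofInjective j hj).symm.toLinearMap ∘ₗ f.codRestrict (range j) h

theorem factor_apply (j : A →ₗ[k] B) (hj : Function.Injective j) (f : Z →ₗ[k] B)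
    (h : ∀ z, f z ∈ range j) (z : Z) : j (factor j hj f h z) = f z := by
  have := LinearEquiv.apply_symm_apply (LinearEquiv.ofInjective j hj) (f.codRestrict (range j) h z)
  exact congrArg Subtype.val this

end

variable {k : Type*} [Field k]
variable {A B Z V X Y : Type*} [AddCommGroup A] [Module k A] [AddCommGroup B] [Module k B]
  [AddCommGroup Z] [Module k Z] [AddCommGroup V] [Module k V] [AddCommGroup X] [Module k X]
  [AddCommGroup Y] [Module k Y]

theorem lTensor_subtype_injective (V : Type*) [AddCommGroup V] [Module k V] (p : Submodule k X) :
    Function.Injective (p.subtype.lTensor V) :=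
  Module.Flat.lTensor_preserves_injective_linearMap _ p.injective_subtype

theorem rTensor_subtype_injective (V : Type*) [AddCommGroup V] [Module k V] (p : Submodule k X) :
    Function.Injective (p.subtype.rTensor V) :=
  Module.Flat.rTensor_preserves_injective_linearMap _ p.injective_subtype

theorem mem_range_lTensor (f g : X →ₗ[k] Y) (z : V ⊗[k] X)
    (h : f.lTensor V z = g.lTensor V z) :
    z ∈ range ((eqLocus f g).subtype.lTensor V) := by
  have h2 : z ∈ eqLocus (AlgebraTensorModule.lTensor k V f) (AlgebraTensorModule.lTensor k V g) := h
  rw [Module.Flat.eqLocus_lTensor_eq] at h2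
  exact h2

theorem comm_rTensor (f : X →ₗ[k] Y) (z : X ⊗[k] V) :
    TensorProduct.comm k Y V (f.rTensor V z) = f.lTensor V (TensorProduct.comm k X V z) := by
  induction z with
  | zero => simp
  | add x y hx hy => simp only [map_add, hx, hy]
  | tmul x y => simp

theorem mem_range_rTensor (f g : X →ₗ[k] Y) (z : X ⊗[k] V)
    (h : f.rTensor V z = g.rTensor V z) :
    z ∈ range ((eqLocus f g).subtype.rTensor V) := by
  have h2 : f.lTensor V (TensorProduct.comm k X V z) =
      g.lTensor V (TensorProduct.comm k X V z) := by
    rw [← comm_rTensor, ← comm_rTensor, h]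
  obtain ⟨y, hy⟩ := mem_range_lTensor f g _ h2
  refine ⟨(TensorProduct.comm k _ _).symm y, ?_⟩
  apply (TensorProduct.comm k X V).injective
  rw [← hy, comm_rTensor, LinearEquiv.apply_symm_apply]

variable {E W : Type*} [AddCommGroup E] [Module k E] [AddCommGroup W] [Module k W]

theorem nat1 (h : E →ₗ[k] W) (z : (A ⊗[k] B) ⊗[k] E) :
    (h.lTensor B).lTensor A (TensorProduct.assoc k A B E z) =
      TensorProduct.assoc k A B W (h.lTensor (A ⊗[k] B) z) := by
  have : (h.lTensor B).lTensor A ∘ₗ (TensorProduct.assoc k A B E).toLinearMap =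
      (TensorProduct.assoc k A B W).toLinearMap ∘ₗ (h.lTensor (A ⊗[k] B)) := by
    ext; simp
  exact LinearMap.congr_fun this z

theorem nat2 (h : B →ₗ[k] W) (z : (A ⊗[k] B) ⊗[k] E) :
    (h.rTensor E).lTensor A (TensorProduct.assoc k A B E z) =
      TensorProduct.assoc k A W E ((h.lTensor A).rTensor E z) := by
  have : (h.rTensor E).lTensor A ∘ₗ (TensorProduct.assoc k A B E).toLinearMap =
      (TensorProduct.assoc k A W E).toLinearMap ∘ₗ ((h.lTensor A).rTensor E) := by
    ext; simp
  exact LinearMap.congr_fun this z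

theorem nat3 (h : A →ₗ[k] W) (z : (A ⊗[k] B) ⊗[k] E) :
    h.rTensor (B ⊗[k] E) (TensorProduct.assoc k A B E z) =
      TensorProduct.assoc k W B E ((h.rTensor B).rTensor E z) := by
  have : h.rTensor (B ⊗[k] E) ∘ₗ (TensorProduct.assoc k A B E).toLinearMap =
      (TensorProduct.assoc k W B E).toLinearMap ∘ₗ ((h.rTensor B).rTensor E) := by
    ext; simp
  exact LinearMap.congr_fun this z

theorem interchange (f : A →ₗ[k] B) (g : E →ₗ[k] W) (z : A ⊗[k] E) :
    g.lTensor B (f.rTensor E z) = f.rTensor W (g.lTensor A z) := by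
  have : g.lTensor B ∘ₗ f.rTensor E = f.rTensor W ∘ₗ g.lTensor A := by
    ext; simp
  exact LinearMap.congr_fun this z

theorem pent (z : ((A ⊗[k] B) ⊗[k] E) ⊗[k] W) :
    TensorProduct.assoc k A B (E ⊗[k] W) (TensorProduct.assoc k (A ⊗[k] B) E W z) =
      (TensorProduct.assoc k B E W).toLinearMap.lTensor A (TensorProduct.assoc k A (B ⊗[k] E) W
        ((TensorProduct.assoc k A B E).toLinearMap.rTensor W z)) := by
  have : (TensorProduct.assoc k A B (E ⊗[k] W)).toLinearMap ∘ₗ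
      (TensorProduct.assoc k (A ⊗[k] B) E W).toLinearMap =
      (TensorProduct.assoc k B E W).toLinearMap.lTensor A ∘ₗ
        (TensorProduct.assoc k A (B ⊗[k] E) W).toLinearMap ∘ₗ
        (TensorProduct.assoc k A B E).toLinearMap.rTensor W := by
    ext; simp
  exact LinearMap.congr_fun this z

variable {A' B' E' : Type*} [AddCommGroup A'] [Module k A'] [AddCommGroup B'] [Module k B']
  [AddCommGroup E'] [Module k E']

theorem rTensor_map (h : B →ₗ[k] B') (f : A →ₗ[k] B) (g : E →ₗ[k] W) (z : A ⊗[k] E) :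
    h.rTensor W (TensorProduct.map f g z) = TensorProduct.map (h ∘ₗ f) g z := by
  rw [← LinearMap.comp_apply, LinearMap.rTensor_comp_map]

theorem lTensor_map (h : W →ₗ[k] B') (f : A →ₗ[k] B) (g : E →ₗ[k] W) (z : A ⊗[k] E) :
    h.lTensor B (TensorProduct.map f g z) = TensorProduct.map f (h ∘ₗ g) z := by
  rw [← LinearMap.comp_apply, LinearMap.lTensor_comp_map]

theorem map_comp_right (f : A →ₗ[k] B) (h : W →ₗ[k] B') (g : E →ₗ[k] W) (z : A ⊗[k] E) :
    TensorProduct.map f (h ∘ₗ g) z = TensorProduct.map f h (g.lTensor A z) := by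
  rw [← LinearMap.comp_apply, LinearMap.map_comp_lTensor]

theorem map_comp_left (h : W →ₗ[k] B') (g : E →ₗ[k] W) (f : A →ₗ[k] B) (z : E ⊗[k] A) :
    TensorProduct.map (h ∘ₗ g) f z = TensorProduct.map h f (g.rTensor A z) := by
  rw [← LinearMap.comp_apply, LinearMap.map_comp_rTensor]

theorem map_map_assoc (f : A →ₗ[k] A') (g : B →ₗ[k] B') (h : E →ₗ[k] E')
    (z : (A ⊗[k] B) ⊗[k] E) :
    TensorProduct.assoc k A' B' E' (TensorProduct.map (TensorProduct.map f g) h z) =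
      TensorProduct.map f (TensorProduct.map g h) (TensorProduct.assoc k A B E z) :=
  (LinearMap.congr_fun (TensorProduct.map_map_comp_assoc_eq f g h) z).symm

theorem map_rTensor_assoc (f : A →ₗ[k] A') (g : B →ₗ[k] B') (z : (A ⊗[k] B) ⊗[k] E) :
    TensorProduct.assoc k A' B' E ((TensorProduct.map f g).rTensor E z) =
      TensorProduct.map f (g.rTensor E) (TensorProduct.assoc k A B E z) :=
  map_map_assoc f g LinearMap.id z

theorem map_sum_right {ι : Type*} (s : Finset ι) (f : A →ₗ[k] B) (g : ι → E →ₗ[k] W)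
    (z : A ⊗[k] E) :
    TensorProduct.map f (∑ i ∈ s, g i) z = ∑ i ∈ s, TensorProduct.map f (g i) z := by
  rw [← TensorProduct.mapBilinear_apply, map_sum, LinearMap.sum_apply]
  rfl

theorem map_eq_lTensor_rTensor (f : A →ₗ[k] B) (g : E →ₗ[k] W) (z : A ⊗[k] E) :
    TensorProduct.map f g z = g.lTensor B (f.rTensor E z) := by
  rw [← LinearMap.comp_apply, LinearMap.lTensor_comp_rTensor]

theorem map_eq_rTensor_lTensor (f : A →ₗ[k] B) (g : E →ₗ[k] W) (z : A ⊗[k] E) :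
    TensorProduct.map f g z = f.rTensor W (g.lTensor A z) := by
  rw [← LinearMap.comp_apply, LinearMap.rTensor_comp_lTensor]

end Factor

section Comodules

/-- Bicomodules over a coalgebra `C`: a left coaction `coactL` and a right coaction `coactR`, both
coassociative and counital, which commute with each other. -/
class Bicomodule (k C M : Type*) [Field k] [AddCommGroup C] [Module k C] [Coalgebra k C]
    [AddCommGroup M] [Module k M] where
  coactL : M →ₗ[k] C ⊗[k] M
  coactR : M →ₗ[k] M ⊗[k] C
  coassocL : ∀ m, TensorProduct.assoc k C C M (Coalgebra.comul.rTensor M (coactL m)) =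
    coactL.lTensor C (coactL m)
  counitL : ∀ m, Coalgebra.counit.rTensor M (coactL m) = (1 : k) ⊗ₜ[k] m
  coassocR : ∀ m, TensorProduct.assoc k M C C (coactR.rTensor C (coactR m)) =
    Coalgebra.comul.lTensor M (coactR m)
  counitR : ∀ m, Coalgebra.counit.lTensor M (coactR m) = m ⊗ₜ[k] (1 : k)
  coact_comm : ∀ m, TensorProduct.assoc k C M C (coactL.rTensor C (coactR m)) =
    coactR.lTensor C (coactL m)

open Bicomodule

universe u v w

/-- Left `C`-comodules, bundled. -/
structure LeftComod (k : Type u) (C : Type v) [Field k] [AddCommGroup C] [Module k C]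
    [Coalgebra k C] where
  carrier : Type w
  [addCommGroup : AddCommGroup carrier]
  [module : Module k carrier]
  coact : carrier →ₗ[k] C ⊗[k] carrier
  coassoc : ∀ x, TensorProduct.assoc k C C carrier (Coalgebra.comul.rTensor carrier (coact x)) =
    coact.lTensor C (coact x)
  counit : ∀ x, Coalgebra.counit.rTensor carrier (coact x) = (1 : k) ⊗ₜ[k] x

attribute [instance] LeftComod.addCommGroup LeftComod.module

variable (k : Type u) (C : Type v) (M : Type w) [Field k] [AddCommGroup C] [Module k C]
  [Coalgebra k C] [AddCommGroup M] [Module k M] [Bicomodule k C M]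

/-- The left comodule underlying a bicomodule. -/
abbrev Bicomodule.toLeftComod : LeftComod.{u, v, w} k C where
  carrier := M
  coact := coactL
  coassoc := coassocL
  counit := counitL

variable {k C}

/-- The cotensor product `M □ X ⊆ M ⊗ X` of a bicomodule `M` and a left comodule `X`: the
equalizer of the two maps `id ⊗ ρ` and `ρ ⊗ id` from `M ⊗ X` to `M ⊗ C ⊗ X`. -/
abbrev cotensor (X : LeftComod.{u, v, w} k C) : Submodule k (M ⊗[k] X.carrier) :=
  eqLocus (X.coact.lTensor M)
    ((TensorProduct.assoc k M C X.carrier).toLinearMap ∘ₗ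
      (coactR : M →ₗ[k] M ⊗[k] C).rTensor X.carrier)

theorem cotensor_coact_mem (X : LeftComod.{u, v, w} k C) (z : cotensor M X) :
    ((TensorProduct.assoc k C M X.carrier).toLinearMap ∘ₗ
      (coactL : M →ₗ[k] C ⊗[k] M).rTensor X.carrier ∘ₗ (cotensor M X).subtype) z ∈
      range ((cotensor M X).subtype.lTensor C) := by
  apply mem_range_lTensor
  have hz : X.coact.lTensor M z.1 = TensorProduct.assoc k M C X.carrier
    ((coactR : M →ₗ[k] M ⊗[k] C).rTensor X.carrier z.1) := z.2
  have hc : (coactR : M →ₗ[k] M ⊗[k] C).lTensor C ∘ₗ coactL =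
      (TensorProduct.assoc k C M C).toLinearMap ∘ₗ (coactL : M →ₗ[k] C ⊗[k] M).rTensor C ∘ₗ
        coactR := by
    ext m; exact (coact_comm m).symm
  simp only [LinearMap.comp_apply, LinearEquiv.coe_coe, Submodule.subtype_apply,
    lTensor_comp_apply]
  rw [nat1, interchange, hz, nat3, nat2, pent, ← rTensor_comp_apply, ← rTensor_comp_apply,
    ← rTensor_comp_apply, hc]
  rfl

/-- The left coaction of `M □ X`, given by the left coaction of `M`. -/
def cotensorCoact (X : LeftComod.{u, v, w} k C) : cotensor M X →ₗ[k] C ⊗[k] cotensor M X :=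
  factor ((cotensor M X).subtype.lTensor C) (lTensor_subtype_injective C _)
    ((TensorProduct.assoc k C M X.carrier).toLinearMap ∘ₗ
      (coactL : M →ₗ[k] C ⊗[k] M).rTensor X.carrier ∘ₗ (cotensor M X).subtype)
    (cotensor_coact_mem M X)

theorem cotensorCoact_apply (X : LeftComod.{u, v, w} k C) (z : cotensor M X) :
    (cotensor M X).subtype.lTensor C (cotensorCoact M X z) =
      TensorProduct.assoc k C M X.carrier
        ((coactL : M →ₗ[k] C ⊗[k] M).rTensor X.carrier z.1) :=
  factor_apply _ _ _ _ z

theorem cotensorCoact_comp (X : LeftComod.{u, v, w} k C) :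
    (cotensor M X).subtype.lTensor C ∘ₗ cotensorCoact M X =
      (TensorProduct.assoc k C M X.carrier).toLinearMap ∘ₗ
        (coactL : M →ₗ[k] C ⊗[k] M).rTensor X.carrier ∘ₗ (cotensor M X).subtype :=
  LinearMap.ext fun z => cotensorCoact_apply M X z

/-- The cotensor product `M □ X` as a left comodule. -/
abbrev cotensorComod (X : LeftComod.{u, v, w} k C) : LeftComod.{u, v, w} k C where
  carrier := cotensor M X
  coact := cotensorCoact M X
  coassoc z := by
    have hc : (TensorProduct.assoc k C C M).toLinearMap ∘ₗ
        (Coalgebra.comul (R := k) (A := C)).rTensor M ∘ₗ coactL =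
        (coactL : M →ₗ[k] C ⊗[k] M).lTensor C ∘ₗ coactL := by
      ext m; exact coassocL m
    have hinj : Function.Injective (((cotensor M X).subtype.lTensor C).lTensor C) :=
      Module.Flat.lTensor_preserves_injective_linearMap _ (lTensor_subtype_injective C _)
    apply hinj
    rw [nat1, interchange, cotensorCoact_apply, ← lTensor_comp_apply, cotensorCoact_comp,
      lTensor_comp_apply, lTensor_comp_apply, cotensorCoact_apply, nat2, nat3, pent,
      ← rTensor_comp_apply, ← rTensor_comp_apply, ← rTensor_comp_apply, LinearMap.comp_assoc, hc]
  counit z := by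
    have hc : (Coalgebra.counit (R := k) (A := C)).rTensor M ∘ₗ coactL =
        TensorProduct.mk k k M 1 := by
      ext m; exact counitL m
    apply lTensor_subtype_injective k (cotensor M X)
    rw [interchange, cotensorCoact_apply, nat3, ← rTensor_comp_apply, hc]
    simp only [lTensor_tmul, Submodule.subtype_apply]
    generalize z.1 = y
    induction y with
    | zero => simp
    | add a b ha hb => simp only [map_add, ha, hb, tmul_add]
    | tmul a b => simp

/-- Left colinearity of a map `X → Y ⊗ V`, where `C` coacts on `Y ⊗ V` through `Y`. -/
def IsColinear {X Y : LeftComod.{u, v, w} k C} {V : Type*} [AddCommGroup V] [Module k V]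
    (f : X.carrier →ₗ[k] Y.carrier ⊗[k] V) : Prop :=
  ∀ x, TensorProduct.assoc k C Y.carrier V (Y.coact.rTensor V (f x)) = f.lTensor C (X.coact x)

section CotensorMap

variable {X Y : LeftComod.{u, v, w} k C} {V : Type*} [AddCommGroup V] [Module k V]
  (f : X.carrier →ₗ[k] Y.carrier ⊗[k] V) (hf : IsColinear f)

/-- The restriction of `id ⊗ f : M ⊗ X → M ⊗ Y ⊗ V` to `M □ X`. -/
def cotensorMapAux : cotensor M X →ₗ[k] (M ⊗[k] Y.carrier) ⊗[k] V :=
  (TensorProduct.assoc k M Y.carrier V).symm.toLinearMap ∘ₗ f.lTensor M ∘ₗ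
    (cotensor M X).subtype

theorem cotensorMap_mem (hf : IsColinear f) (z : cotensor M X) :
    cotensorMapAux M f z ∈ range ((cotensor M Y).subtype.rTensor V) := by
  apply mem_range_rTensor
  have hz : X.coact.lTensor M z.1 = TensorProduct.assoc k M C X.carrier
    ((coactR : M →ₗ[k] M ⊗[k] C).rTensor X.carrier z.1) := z.2
  have hc : (TensorProduct.assoc k C Y.carrier V).toLinearMap ∘ₗ Y.coact.rTensor V ∘ₗ f =
      f.lTensor C ∘ₗ X.coact := LinearMap.ext hf
  apply (TensorProduct.assoc k M (C ⊗[k] Y.carrier) V).injective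
  apply ((TensorProduct.assoc k C Y.carrier V).lTensor M).injective
  change (TensorProduct.assoc k C Y.carrier V).toLinearMap.lTensor M _ =
    (TensorProduct.assoc k C Y.carrier V).toLinearMap.lTensor M _
  simp only [cotensorMapAux, LinearMap.comp_apply, LinearEquiv.coe_coe,
    Submodule.subtype_apply, rTensor_comp_apply]
  rw [← nat2, ← pent, ← nat3, LinearEquiv.apply_symm_apply, ← lTensor_comp_apply,
    ← lTensor_comp_apply, ← interchange, LinearMap.comp_assoc, hc, lTensor_comp_apply, hz, nat1]

/-- The map `M □ X → (M □ Y) ⊗ V` obtained by restricting `id ⊗ f` for a left colinear map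
`f : X → Y ⊗ V`. -/
def cotensorMap : cotensor M X →ₗ[k] cotensor M Y ⊗[k] V :=
  factor ((cotensor M Y).subtype.rTensor V) (rTensor_subtype_injective V _)
    (cotensorMapAux M f) (cotensorMap_mem M f hf)

theorem cotensorMap_apply (z : cotensor M X) :
    TensorProduct.assoc k M Y.carrier V
      ((cotensor M Y).subtype.rTensor V (cotensorMap M f hf z)) = f.lTensor M z.1 := by
  rw [cotensorMap, factor_apply]
  simp [cotensorMapAux]

theorem cotensorMap_comp :
    (TensorProduct.assoc k M Y.carrier V).toLinearMap ∘ₗ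
      (cotensor M Y).subtype.rTensor V ∘ₗ cotensorMap M f hf =
      f.lTensor M ∘ₗ (cotensor M X).subtype :=
  LinearMap.ext fun z => cotensorMap_apply M f hf z

theorem cotensorMap_isColinear :
    IsColinear (X := cotensorComod M X) (Y := cotensorComod M Y) (cotensorMap M f hf) := by
  intro z
  have hinj : Function.Injective (((TensorProduct.assoc k M Y.carrier V).toLinearMap ∘ₗ
      (cotensor M Y).subtype.rTensor V).lTensor C) :=
    Module.Flat.lTensor_preserves_injective_linearMap _
      (by
        rw [LinearMap.coe_comp]
        exact (LinearEquiv.injective _).comp (rTensor_subtype_injective V _))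
  apply hinj
  change ((TensorProduct.assoc k M Y.carrier V).toLinearMap ∘ₗ
      (cotensor M Y).subtype.rTensor V).lTensor C
      (TensorProduct.assoc k C (cotensor M Y) V ((cotensorCoact M Y).rTensor V
        (cotensorMap M f hf z))) = ((TensorProduct.assoc k M Y.carrier V).toLinearMap ∘ₗ
      (cotensor M Y).subtype.rTensor V).lTensor C
      ((cotensorMap M f hf).lTensor C (cotensorCoact M X z))
  rw [← lTensor_comp_apply C _ (cotensorMap M f hf), LinearMap.comp_assoc, cotensorMap_comp,
    lTensor_comp_apply, lTensor_comp_apply, nat2, ← rTensor_comp_apply, cotensorCoact_comp,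
    cotensorCoact_apply, rTensor_comp_apply, ← pent, nat1, interchange, ← cotensorMap_apply M f hf,
    nat3, rTensor_comp_apply]

variable (g : X.carrier →ₗ[k] V)

theorem inclusion_isColinear :
    IsColinear (X := cotensorComod M X) (Y := Bicomodule.toLeftComod k C M)
      (g.lTensor M ∘ₗ (cotensor M X).subtype) := by
  intro z
  change TensorProduct.assoc k C M V ((coactL : M →ₗ[k] C ⊗[k] M).rTensor V (g.lTensor M z.1)) =
    (g.lTensor M ∘ₗ (cotensor M X).subtype).lTensor C (cotensorCoact M X z)
  rw [lTensor_comp_apply, cotensorCoact_apply, nat1, interchange]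

variable (h : C →ₗ[k] V)

theorem coactR_isColinear :
    IsColinear (X := Bicomodule.toLeftComod k C M) (Y := Bicomodule.toLeftComod k C M)
      (h.lTensor M ∘ₗ coactR) := by
  intro m
  change TensorProduct.assoc k C M V ((coactL : M →ₗ[k] C ⊗[k] M).rTensor V
    (h.lTensor M (coactR m))) = (h.lTensor M ∘ₗ coactR).lTensor C (coactL m)
  rw [lTensor_comp_apply, ← coact_comm, nat1, interchange]

end CotensorMap

section Splitting

variable {M}
variable {W U V' : Type*} {X Y Z : LeftComod.{u, v, w} k C} {V : Type*} [AddCommGroup V]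
  [Module k V] [AddCommGroup U] [Module k U] [AddCommGroup V'] [Module k V']

theorem split_aux_coactR (h : C →ₗ[k] V) (d : V →ₗ[k] V ⊗[k] V)
    (hd : d ∘ₗ h = TensorProduct.map h h ∘ₗ Coalgebra.comul) (m : M) :
    d.lTensor M (h.lTensor M (coactR m)) = TensorProduct.assoc k M V V
      ((h.lTensor M ∘ₗ coactR).rTensor V (h.lTensor M (coactR m))) := by
  rw [← lTensor_comp_apply, hd, lTensor_comp_apply, ← coassocR, rTensor_comp_apply, ← interchange]
  generalize (coactR : M →ₗ[k] M ⊗[k] C).rTensor C (coactR m) = y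
  have : (TensorProduct.map h h).lTensor M ∘ₗ (TensorProduct.assoc k M C C).toLinearMap =
      (TensorProduct.assoc k M V V).toLinearMap ∘ₗ (h.lTensor M).rTensor V ∘ₗ
        h.lTensor (M ⊗[k] C) := by
    ext; simp
  exact LinearMap.congr_fun this y

theorem split_aux_incl_coactR (h : C →ₗ[k] V) (g : X.carrier →ₗ[k] V) (z : cotensor M X) :
    TensorProduct.assoc k M V V
      ((h.lTensor M ∘ₗ (coactR : M →ₗ[k] M ⊗[k] C)).rTensor V (g.lTensor M z.1)) =
      (TensorProduct.map h g ∘ₗ X.coact).lTensor M z.1 := by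
  have hz : X.coact.lTensor M z.1 = TensorProduct.assoc k M C X.carrier
    ((coactR : M →ₗ[k] M ⊗[k] C).rTensor X.carrier z.1) := z.2
  rw [lTensor_comp_apply, hz, rTensor_comp_apply, ← interchange]
  generalize (coactR : M →ₗ[k] M ⊗[k] C).rTensor X.carrier z.1 = y
  have : (TensorProduct.map h g).lTensor M ∘ₗ (TensorProduct.assoc k M C X.carrier).toLinearMap =
      (TensorProduct.assoc k M V V).toLinearMap ∘ₗ (h.lTensor M).rTensor V ∘ₗ
        g.lTensor (M ⊗[k] C) := by
    ext; simp
  exact (LinearMap.congr_fun this y).symm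

theorem split_aux_incl (f : X.carrier →ₗ[k] Y.carrier ⊗[k] V) (hf : IsColinear f)
    (g : Y.carrier →ₗ[k] U) (z : cotensor M X) :
    TensorProduct.assoc k M U V
      ((g.lTensor M ∘ₗ (cotensor M Y).subtype).rTensor V (cotensorMap M f hf z)) =
      (g.rTensor V ∘ₗ f).lTensor M z.1 := by
  rw [rTensor_comp_apply, ← nat2, cotensorMap_apply, lTensor_comp_apply]

theorem split_aux_injective (Y : LeftComod.{u, v, w} k C) (V : Type*) [AddCommGroup V]
    [Module k V] {y y' : cotensor M Y ⊗[k] V}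
    (h : TensorProduct.assoc k M Y.carrier V ((cotensor M Y).subtype.rTensor V y) =
      TensorProduct.assoc k M Y.carrier V ((cotensor M Y).subtype.rTensor V y')) : y = y' :=
  rTensor_subtype_injective V _ ((LinearEquiv.injective _) h)

theorem split_aux_map (f : X.carrier →ₗ[k] Y.carrier ⊗[k] V) (hf : IsColinear f)
    (d : V →ₗ[k] V') (z : cotensor M X) :
    TensorProduct.assoc k M Y.carrier V' ((cotensor M Y).subtype.rTensor V'
      (d.lTensor (cotensor M Y) (cotensorMap M f hf z))) =
      (d.lTensor Y.carrier ∘ₗ f).lTensor M z.1 := by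
  rw [← interchange, ← nat1, cotensorMap_apply, lTensor_comp_apply]

theorem split_aux_map_map (f : X.carrier →ₗ[k] Y.carrier ⊗[k] V) (hf : IsColinear f)
    (e : Y.carrier →ₗ[k] Z.carrier ⊗[k] U) (he : IsColinear e) (z : cotensor M X) :
    TensorProduct.assoc k M Z.carrier (U ⊗[k] V) ((cotensor M Z).subtype.rTensor (U ⊗[k] V)
      (TensorProduct.assoc k (cotensor M Z) U V
        ((cotensorMap M e he).rTensor V (cotensorMap M f hf z)))) =
      ((TensorProduct.assoc k Z.carrier U V).toLinearMap ∘ₗ e.rTensor V ∘ₗ f).lTensor M z.1 := by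
  rw [nat3, pent, ← rTensor_comp_apply, ← rTensor_comp_apply, LinearMap.comp_assoc,
    cotensorMap_comp, rTensor_comp_apply,
    ← nat2, cotensorMap_apply, lTensor_comp_apply, lTensor_comp_apply]

theorem cotensorMap_zero (h0 : IsColinear (0 : X.carrier →ₗ[k] Y.carrier ⊗[k] V)) :
    cotensorMap M (0 : X.carrier →ₗ[k] Y.carrier ⊗[k] V) h0 = 0 := by
  ext1 z
  apply split_aux_injective
  rw [cotensorMap_apply]
  simp

end Splitting

variable (k C)

/-- The iterated cotensor product `M □ ⋯ □ M` with `n + 1` factors, `M □ (M □ (⋯ □ M))`,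
as a left comodule. -/
def cotensorPow : ℕ → LeftComod.{u, v, w} k C
  | 0 => Bicomodule.toLeftComod k C M
  | n + 1 => cotensorComod M (cotensorPow n)

/-- The underlying space `C ⊕ M ⊕ (M □ M) ⊕ ⋯` of the cotensor coalgebra `T_C(M)`. -/
def CotensorCoalgebra : Type (max v w) := C × ⨁ n, (cotensorPow k C M n).carrier

instance : AddCommGroup (CotensorCoalgebra k C M) :=
  inferInstanceAs (AddCommGroup (C × ⨁ n, (cotensorPow k C M n).carrier))

instance : Module k (CotensorCoalgebra k C M) :=
  inferInstanceAs (Module k (C × ⨁ n, (cotensorPow k C M n).carrier))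

namespace CotensorCoalgebra

/-- The inclusion of `C`. -/
def ofC : C →ₗ[k] CotensorCoalgebra k C M := LinearMap.inl k C _

/-- The inclusion of the cotensor power with `n + 1` factors. -/
def ofPow (n : ℕ) : (cotensorPow k C M n).carrier →ₗ[k] CotensorCoalgebra k C M :=
  LinearMap.inr k C _ ∘ₗ DirectSum.lof k ℕ (fun n => (cotensorPow k C M n).carrier) n

/-- The linear map out of the cotensor coalgebra with given restrictions to its summands. -/
def desc {V : Type*} [AddCommGroup V] [Module k V] (f : C →ₗ[k] V)
    (g : ∀ n, (cotensorPow k C M n).carrier →ₗ[k] V) : CotensorCoalgebra k C M →ₗ[k] V :=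
  LinearMap.coprod f (DirectSum.toModule k ℕ V g)

/-- The part of the comultiplication on `M □ ⋯ □ M` (`n + 1` factors) whose left tensor factor
lies in `M □ ⋯ □ M` (`i + 1` factors): it maps `m₀ □ ⋯ □ mₙ` to
`(m₀ □ ⋯ □ mᵢ) ⊗ (mᵢ₊₁ □ ⋯ □ mₙ)` if `i < n`, to
`∑ (m₀ □ ⋯ □ (mₙ)₀) ⊗ (mₙ)₁`, where `∑ (mₙ)₀ ⊗ (mₙ)₁ ∈ M ⊗ C` is the right coaction on `mₙ`,
if `i = n`, and to `0` if `i > n`. -/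
def splitAux : (n i : ℕ) →
    {f : (cotensorPow k C M n).carrier →ₗ[k]
      (cotensorPow k C M i).carrier ⊗[k] CotensorCoalgebra k C M // IsColinear f}
  | 0, 0 => ⟨(ofC k C M).lTensor M ∘ₗ (coactR : M →ₗ[k] M ⊗[k] C),
      coactR_isColinear M (ofC k C M)⟩
  | 0, _ + 1 => ⟨0, fun x => by simp⟩
  | n + 1, 0 => ⟨(ofPow k C M n).lTensor M ∘ₗ (cotensor M (cotensorPow k C M n)).subtype,
      inclusion_isColinear M _⟩
  | n + 1, i + 1 => ⟨cotensorMap M (splitAux n i).1 (splitAux n i).2,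
      cotensorMap_isColinear M _ _⟩

/-- The map underlying `splitAux`. -/
def split (n i : ℕ) : (cotensorPow k C M n).carrier →ₗ[k]
    (cotensorPow k C M i).carrier ⊗[k] CotensorCoalgebra k C M := (splitAux k C M n i).1

instance : CoalgebraStruct k (CotensorCoalgebra k C M) where
  comul := desc k C M
    (TensorProduct.map (ofC k C M) (ofC k C M) ∘ₗ Coalgebra.comul)
    (fun n => TensorProduct.map (ofC k C M) (ofPow k C M n) ∘ₗ (cotensorPow k C M n).coact +
      ∑ i ∈ Finset.range (n + 1), (ofPow k C M i).rTensor _ ∘ₗ split k C M n i)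
  counit := desc k C M Coalgebra.counit (fun _ => 0)

end CotensorCoalgebra

namespace CotensorCoalgebra

variable {k C M}

theorem desc_ofC {V : Type*} [AddCommGroup V] [Module k V] (f : C →ₗ[k] V)
    (g : ∀ n, (cotensorPow k C M n).carrier →ₗ[k] V) (c : C) :
    desc k C M f g (ofC k C M c) = f c :=
  LinearMap.congr_fun (LinearMap.coprod_inl f (DirectSum.toModule k ℕ V g)) c

theorem desc_ofPow {V : Type*} [AddCommGroup V] [Module k V] (f : C →ₗ[k] V)
    (g : ∀ n, (cotensorPow k C M n).carrier →ₗ[k] V) (n : ℕ)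
    (x : (cotensorPow k C M n).carrier) :
    desc k C M f g (ofPow k C M n x) = g n x :=
  (LinearMap.congr_fun (LinearMap.coprod_inr f (DirectSum.toModule k ℕ V g)) _).trans
    (DirectSum.toModule_lof (φ := g) k n x)

theorem comul_ofC (c : C) : Coalgebra.comul (R := k) (ofC k C M c) =
    TensorProduct.map (ofC k C M) (ofC k C M) (Coalgebra.comul (R := k) c) :=
  desc_ofC _ _ c

theorem comul_ofPow (n : ℕ) (x : (cotensorPow k C M n).carrier) :
    Coalgebra.comul (R := k) (ofPow k C M n x) =
    TensorProduct.map (ofC k C M) (ofPow k C M n) ((cotensorPow k C M n).coact x) +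
      ∑ i ∈ Finset.range (n + 1), (ofPow k C M i).rTensor _ (split k C M n i x) := by
  refine (desc_ofPow _ _ n x).trans ?_
  simp [LinearMap.sum_apply]

theorem counit_ofC (c : C) :
    Coalgebra.counit (R := k) (ofC k C M c) = Coalgebra.counit (R := k) c :=
  desc_ofC _ _ c

theorem counit_ofPow (n : ℕ) (x : (cotensorPow k C M n).carrier) :
    Coalgebra.counit (R := k) (ofPow k C M n x) = 0 :=
  desc_ofPow _ _ n x

theorem hom_ext {V : Type*} [AddCommGroup V] [Module k V] {f g : CotensorCoalgebra k C M →ₗ[k] V}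
    (h0 : ∀ c, f (ofC k C M c) = g (ofC k C M c))
    (h1 : ∀ n x, f (ofPow k C M n x) = g (ofPow k C M n x)) : f = g := by
  apply LinearMap.prod_ext
  · exact LinearMap.ext h0
  · apply DirectSum.linearMap_ext
    intro n
    exact LinearMap.ext (h1 n)

theorem split_zero_zero (m : M) :
    split k C M 0 0 m = (ofC k C M).lTensor M (coactR (k := k) (C := C) m) := rfl

theorem split_succ_zero (n : ℕ) (z : cotensor M (cotensorPow k C M n)) :
    split k C M (n + 1) 0 z = (ofPow k C M n).lTensor M z.1 := rfl

/-- The comultiplication on `M` is the sum of the left and the right coaction. -/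
theorem comul_ofPow_zero (m : M) :
    let ι : M →ₗ[k] CotensorCoalgebra k C M := ofPow k C M 0
    Coalgebra.comul (R := k) (ι m) =
      TensorProduct.map (ofC k C M) ι ((coactL : M →ₗ[k] C ⊗[k] M) m) +
        TensorProduct.map ι (ofC k C M) ((coactR : M →ₗ[k] M ⊗[k] C) m) := by
  intro ι
  refine (comul_ofPow 0 m).trans ?_
  rw [Finset.sum_range_one]
  congr 1
  exact (map_eq_rTensor_lTensor ι (ofC k C M) ((coactR : M →ₗ[k] M ⊗[k] C) m)).symm

theorem split_zero_succ (i : ℕ) : split k C M 0 (i + 1) = 0 := rfl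

theorem split_colinear (n i : ℕ) : IsColinear (split k C M n i) := (splitAux k C M n i).2

theorem split_eq_zero : ∀ {n i : ℕ}, n < i → split k C M n i = 0
  | 0, _ + 1, _ => rfl
  | n + 1, i + 1, h => by
    have h1 := split_eq_zero (n := n) (i := i) (by omega)
    have h2 : ∀ (f : _ →ₗ[k] _) (hf : IsColinear f), f = 0 →
        cotensorMap (X := cotensorPow k C M n) (Y := cotensorPow k C M i)
          (V := CotensorCoalgebra k C M) M f hf = 0 := by
      rintro f hf rfl
      exact cotensorMap_zero hf
    exact h2 _ (split_colinear n i) h1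

theorem split_split : ∀ (n i : ℕ) (x : (cotensorPow k C M n).carrier),
    (Coalgebra.comul (R := k) (A := CotensorCoalgebra k C M)).lTensor _ (split k C M n i x) =
      ∑ l ∈ Finset.range (n + 1), TensorProduct.assoc k _ _ _
        ((split k C M l i).rTensor _ (split k C M n l x))
  | 0, 0, x => by
    rw [Finset.sum_range_one]
    exact split_aux_coactR (M := M) (ofC k C M) Coalgebra.comul (LinearMap.ext comul_ofC) x
  | 0, i + 1, x => by
    simp [split_zero_succ]
  | n + 1, 0, x => by
    rw [Finset.sum_range_succ']
    have h0 := split_aux_incl_coactR (ofC k C M) (ofPow k C M n) x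
    have h1 := fun l => split_aux_incl (split k C M n l) (split_colinear n l) (ofPow k C M l) x
    have h2 : (Coalgebra.comul (R := k)) ∘ₗ ofPow k C M n = ∑ l ∈ Finset.range (n + 1),
        (ofPow k C M l).rTensor _ ∘ₗ (split k C M n l) +
        TensorProduct.map (ofC k C M) (ofPow k C M n) ∘ₗ (cotensorPow k C M n).coact := by
      ext1 y
      simp [comul_ofPow, add_comm, LinearMap.sum_apply]
    have h3 : (Coalgebra.comul (R := k)).lTensor M ((ofPow k C M n).lTensor M x.1) =
        ∑ l ∈ Finset.range (n + 1),
          ((ofPow k C M l).rTensor _ ∘ₗ (split k C M n l)).lTensor M x.1 +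
        (TensorProduct.map (ofC k C M) (ofPow k C M n) ∘ₗ
          (cotensorPow k C M n).coact).lTensor M x.1 := by
      rw [← lTensor_comp_apply, h2, lTensor_add, LinearMap.add_apply]
      congr 1
      rw [← coe_lTensorHom, map_sum, LinearMap.sum_apply]
    refine h3.trans ?_
    exact congrArg₂ _ (Finset.sum_congr rfl fun l _ => (h1 l).symm) h0.symm
  | n + 1, i + 1, x => by
    rw [Finset.sum_range_succ', split_zero_succ, LinearMap.rTensor_zero, LinearMap.zero_apply,
      map_zero, add_zero]
    apply split_aux_injective (cotensorPow k C M i)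
    have h0 := split_aux_map (split k C M n i) (split_colinear n i)
      (Coalgebra.comul (R := k) (A := CotensorCoalgebra k C M)) x
    refine h0.trans ?_
    have h1 := fun l => split_aux_map_map (split k C M n l) (split_colinear n l)
      (split k C M l i) (split_colinear l i) x
    have h2 : (Coalgebra.comul (R := k) (A := CotensorCoalgebra k C M)).lTensor _ ∘ₗ
        split k C M n i = ∑ l ∈ Finset.range (n + 1),
          (TensorProduct.assoc k _ _ _).toLinearMap ∘ₗ (split k C M l i).rTensor _ ∘ₗ
            split k C M n l := by
      ext1 y
      simp [split_split n i y, LinearMap.sum_apply]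
    have h3 : ∀ y : M ⊗[k] (cotensorPow k C M n).carrier,
        ((Coalgebra.comul (R := k) (A := CotensorCoalgebra k C M)).lTensor _ ∘ₗ
          split k C M n i).lTensor M y = ∑ l ∈ Finset.range (n + 1),
          ((TensorProduct.assoc k _ _ _).toLinearMap ∘ₗ (split k C M l i).rTensor _ ∘ₗ
            split k C M n l).lTensor M y := by
      intro y
      rw [h2, ← coe_lTensorHom, map_sum, LinearMap.sum_apply]
    refine (h3 x.1).trans (Eq.trans ?_ (map_sum ((TensorProduct.assoc k M _ _).toLinearMap ∘ₗ
      (cotensor M (cotensorPow k C M i)).subtype.rTensor (CotensorCoalgebra k C M ⊗[k]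
        CotensorCoalgebra k C M)) _ _).symm)
    exact Finset.sum_congr rfl fun l _ => (h1 l).symm

theorem split_counit_self : ∀ (n : ℕ) (x : (cotensorPow k C M n).carrier),
    (Coalgebra.counit (R := k) (A := CotensorCoalgebra k C M)).lTensor _ (split k C M n n x) =
      x ⊗ₜ[k] (1 : k)
  | 0, x => by
    have h : (Coalgebra.counit (R := k) (A := CotensorCoalgebra k C M)) ∘ₗ ofC k C M =
      Coalgebra.counit := LinearMap.ext counit_ofC
    have h1 : (Coalgebra.counit (R := k) (A := CotensorCoalgebra k C M)).lTensor M
        ((ofC k C M).lTensor M (coactR (x : M))) = (x : M) ⊗ₜ[k] (1 : k) := by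
      rw [← lTensor_comp_apply, h]
      exact counitR (M := M) x
    exact h1
  | n + 1, x => by
    apply split_aux_injective (cotensorPow k C M n)
    have h0 := split_aux_map (split k C M n n) (split_colinear n n)
      (Coalgebra.counit (R := k) (A := CotensorCoalgebra k C M)) x
    refine h0.trans ?_
    have h2 : (Coalgebra.counit (R := k) (A := CotensorCoalgebra k C M)).lTensor _ ∘ₗ
        split k C M n n = (TensorProduct.mk k (cotensorPow k C M n).carrier k).flip 1 :=
      LinearMap.ext (split_counit_self n)
    rw [h2]
    have h3 : ∀ y : M ⊗[k] (cotensorPow k C M n).carrier,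
        ((TensorProduct.mk k (cotensorPow k C M n).carrier k).flip 1).lTensor M y =
        TensorProduct.assoc k M (cotensorPow k C M n).carrier k (y ⊗ₜ 1) := by
      intro y
      induction y with
      | zero => simp
      | add a b ha hb => simp only [map_add, ha, hb, add_tmul]
      | tmul a b => simp
    rw [h3]
    rfl

theorem split_counit_lt : ∀ (n i : ℕ) (_ : i < n) (x : (cotensorPow k C M n).carrier),
    (Coalgebra.counit (R := k) (A := CotensorCoalgebra k C M)).lTensor _ (split k C M n i x) = 0
  | n + 1, 0, _, x => by
    have h : (Coalgebra.counit (R := k) (A := CotensorCoalgebra k C M)) ∘ₗ ofPow k C M n = 0 :=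
      LinearMap.ext (counit_ofPow n)
    have h1 : (Coalgebra.counit (R := k) (A := CotensorCoalgebra k C M)).lTensor M
        ((ofPow k C M n).lTensor M x.1) = 0 := by
      rw [← lTensor_comp_apply, h]
      simp
    exact h1
  | n + 1, i + 1, h, x => by
    apply split_aux_injective (cotensorPow k C M i)
    have h0 := split_aux_map (split k C M n i) (split_colinear n i)
      (Coalgebra.counit (R := k) (A := CotensorCoalgebra k C M)) x
    refine h0.trans ?_
    have h2 : (Coalgebra.counit (R := k) (A := CotensorCoalgebra k C M)).lTensor _ ∘ₗ
        split k C M n i = 0 :=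
      LinearMap.ext (split_counit_lt n i (by omega))
    rw [h2]
    refine Eq.trans (by simp) (map_zero ((TensorProduct.assoc k M _ _).toLinearMap ∘ₗ
      (cotensor M (cotensorPow k C M i)).subtype.rTensor k)).symm

theorem sum_split_of_le {V : Type*} [AddCommGroup V] [Module k V] {n N : ℕ} (h : n ≤ N)
    (F : ∀ i, (cotensorPow k C M i).carrier ⊗[k] CotensorCoalgebra k C M →ₗ[k] V)
    (x : (cotensorPow k C M n).carrier) :
    ∑ i ∈ Finset.range (n + 1), F i (split k C M n i x) =
      ∑ i ∈ Finset.range (N + 1), F i (split k C M n i x) := by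
  apply Finset.sum_subset
  · intro i hi
    simp only [Finset.mem_range] at hi ⊢
    omega
  · intro i _ hi
    simp only [Finset.mem_range, not_lt] at hi
    rw [split_eq_zero (by omega), LinearMap.zero_apply, map_zero]

theorem comul_comp_ofPow {i n : ℕ} (h : i ≤ n) :
    Coalgebra.comul (R := k) ∘ₗ ofPow k C M i =
      TensorProduct.map (ofC k C M) (ofPow k C M i) ∘ₗ (cotensorPow k C M i).coact +
      ∑ j ∈ Finset.range (n + 1), (ofPow k C M j).rTensor _ ∘ₗ split k C M i j := by
  ext1 x
  rw [LinearMap.comp_apply, comul_ofPow, sum_split_of_le h (fun j => (ofPow k C M j).rTensor _)]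
  simp [LinearMap.sum_apply]

theorem coassoc_ofC (c : C) :
    TensorProduct.assoc k _ _ _ ((Coalgebra.comul (R := k)).rTensor (CotensorCoalgebra k C M)
      (Coalgebra.comul (R := k) (ofC k C M c))) =
    (Coalgebra.comul (R := k)).lTensor (CotensorCoalgebra k C M)
      (Coalgebra.comul (R := k) (ofC k C M c)) := by
  have hc : Coalgebra.comul (R := k) ∘ₗ ofC k C M =
    TensorProduct.map (ofC k C M) (ofC k C M) ∘ₗ Coalgebra.comul := LinearMap.ext comul_ofC
  rw [comul_ofC, rTensor_map, lTensor_map, hc, map_comp_right, map_comp_left,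
    ← Coalgebra.coassoc_apply]
  rw [map_map_assoc]

theorem coassoc_ofPow (n : ℕ) (x : (cotensorPow k C M n).carrier) :
    TensorProduct.assoc k _ _ _ ((Coalgebra.comul (R := k)).rTensor (CotensorCoalgebra k C M)
      (Coalgebra.comul (R := k) (ofPow k C M n x))) =
    (Coalgebra.comul (R := k)).lTensor (CotensorCoalgebra k C M)
      (Coalgebra.comul (R := k) (ofPow k C M n x)) := by
  have hc : Coalgebra.comul (R := k) ∘ₗ ofC k C M =
    TensorProduct.map (ofC k C M) (ofC k C M) ∘ₗ Coalgebra.comul := LinearMap.ext comul_ofC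
  have hL : ∀ i ∈ Finset.range (n + 1), TensorProduct.assoc k _ _ _
      ((Coalgebra.comul (R := k)).rTensor (CotensorCoalgebra k C M)
        ((ofPow k C M i).rTensor _ (split k C M n i x))) =
      TensorProduct.map (ofC k C M) ((ofPow k C M i).rTensor _ ∘ₗ split k C M n i)
        ((cotensorPow k C M n).coact x) +
      ∑ j ∈ Finset.range (n + 1), (ofPow k C M j).rTensor _ (TensorProduct.assoc k _ _ _
        ((split k C M i j).rTensor _ (split k C M n i x))) := by
    intro i hi
    rw [← rTensor_comp_apply, comul_comp_ofPow (n := n) (by simpa [Nat.lt_succ_iff] using hi),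
      rTensor_add, LinearMap.add_apply, map_add, ← coe_rTensorHom, map_sum, LinearMap.sum_apply,
      map_sum]
    simp only [coe_rTensorHom]
    congr 1
    · have := split_colinear n i x
      rw [map_comp_right (f := ofC k C M), ← this, rTensor_comp_apply, map_rTensor_assoc]
    · refine Finset.sum_congr rfl fun j _ => ?_
      rw [nat3, ← rTensor_comp_apply]
  have hR : ∀ j ∈ Finset.range (n + 1),
      (Coalgebra.comul (R := k)).lTensor (CotensorCoalgebra k C M)
        ((ofPow k C M j).rTensor _ (split k C M n j x)) =
      ∑ l ∈ Finset.range (n + 1), (ofPow k C M j).rTensor _ (TensorProduct.assoc k _ _ _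
        ((split k C M l j).rTensor _ (split k C M n l x))) := by
    intro j _
    rw [interchange, split_split, map_sum]
  rw [comul_ofPow]
  simp only [map_add, map_sum]
  rw [Finset.sum_congr rfl hL, Finset.sum_congr rfl hR, Finset.sum_add_distrib, Finset.sum_comm,
    ← add_assoc]
  congr 1
  rw [rTensor_map, lTensor_map, hc, comul_comp_ofPow le_rfl, map_add_right, LinearMap.add_apply,
    map_sum_right]
  congr 1
  rw [map_comp_left, map_map_assoc, (cotensorPow k C M n).coassoc, map_comp_right]

/-- The cotensor coalgebra. -/
instance : Coalgebra k (CotensorCoalgebra k C M) where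
  coassoc := hom_ext coassoc_ofC coassoc_ofPow
  rTensor_counit_comp_comul := by
    apply hom_ext
    · intro c
      have hc : Coalgebra.counit (R := k) ∘ₗ ofC k C M = Coalgebra.counit := LinearMap.ext counit_ofC
      rw [LinearMap.comp_apply, comul_ofC, rTensor_map, hc, map_eq_lTensor_rTensor,
        Coalgebra.rTensor_counit_comul]
      simp
    · intro n x
      have hc : Coalgebra.counit (R := k) ∘ₗ ofC k C M = Coalgebra.counit := LinearMap.ext counit_ofC
      have hp : ∀ i, Coalgebra.counit (R := k) ∘ₗ ofPow k C M i = 0 :=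
        fun i => LinearMap.ext (counit_ofPow i)
      rw [LinearMap.comp_apply, comul_ofPow, map_add, map_sum, rTensor_map, hc,
        map_eq_lTensor_rTensor, (cotensorPow k C M n).counit]
      rw [Finset.sum_eq_zero]
      · simp
      · intro i _
        rw [← rTensor_comp_apply, hp]
        simp
  lTensor_counit_comp_comul := by
    apply hom_ext
    · intro c
      have hc : Coalgebra.counit (R := k) ∘ₗ ofC k C M = Coalgebra.counit := LinearMap.ext counit_ofC
      rw [LinearMap.comp_apply, comul_ofC, lTensor_map, hc, map_eq_rTensor_lTensor,
        Coalgebra.lTensor_counit_comul]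
      simp
    · intro n x
      have hp : ∀ i, Coalgebra.counit (R := k) ∘ₗ ofPow k C M i = 0 :=
        fun i => LinearMap.ext (counit_ofPow i)
      rw [LinearMap.comp_apply, comul_ofPow, map_add, map_sum, lTensor_map, hp, map_zero_right,
        LinearMap.zero_apply, zero_add, Finset.sum_eq_single n]
      · rw [interchange, split_counit_self]
        simp
      · intro i hi hne
        have hlt : i < n := by
          simp only [Finset.mem_range] at hi
          omega
        rw [interchange, split_counit_lt n i hlt, map_zero]
      · simp

end CotensorCoalgebra

end Comodules

section Dual

open Module

variable {k : Type*} [Field k]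
section

variable {A B E : Type*} [AddCommGroup A] [Module k A] [AddCommGroup B] [Module k B]
  [AddCommGroup E] [Module k E]

/-- The evaluation of an element of `A* ⊗ (B* ⊗ E*)` as a functional on `A ⊗ (B ⊗ E)`. -/
def dualDistrib₃ : Dual k A ⊗[k] (Dual k B ⊗[k] Dual k E) →ₗ[k] Dual k (A ⊗[k] (B ⊗[k] E)) :=
  dualDistrib k A (B ⊗[k] E) ∘ₗ (dualDistrib k B E).lTensor (Dual k A)

theorem dualDistrib₃_assoc (u : Dual k A ⊗[k] Dual k B) (g : Dual k E) (a : A) (b : B) (e : E) :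
    dualDistrib₃ (TensorProduct.assoc k _ _ _ (u ⊗ₜ[k] g)) (a ⊗ₜ[k] (b ⊗ₜ[k] e)) =
      dualDistrib k A B u (a ⊗ₜ b) * g e := by
  induction u with
  | zero =>
    simp only [zero_tmul, LinearEquiv.map_zero, LinearMap.map_zero, LinearMap.zero_apply, zero_mul]
  | add x y hx hy => simp only [add_tmul, LinearEquiv.map_add, LinearMap.map_add, LinearMap.add_apply, hx, hy, add_mul]
  | tmul x y => simp [dualDistrib₃, mul_assoc]

theorem dualDistrib₃_tmul (u : Dual k B ⊗[k] Dual k E) (g : Dual k A) (a : A) (b : B) (e : E) :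
    dualDistrib₃ (g ⊗ₜ[k] u) (a ⊗ₜ[k] (b ⊗ₜ[k] e)) = g a * dualDistrib k B E u (b ⊗ₜ e) := by
  simp [dualDistrib₃]

end

variable {A B E X Y L : Type*} [AddCommGroup A] [Module k A] [FiniteDimensional k A]
  [AddCommGroup B] [Module k B] [FiniteDimensional k B]
  [AddCommGroup E] [Module k E] [FiniteDimensional k E]
  [AddCommGroup X] [Module k X] [FiniteDimensional k X]
  [AddCommGroup Y] [Module k Y] [FiniteDimensional k Y]
  [AddCommGroup L] [Module k L]

/-- The map `L* → (A ⊗ B)* = A* ⊗ B*` dual to a map `A ⊗ B → L`, for finite-dimensional `A`, `B`. -/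
def codual (μ : A ⊗[k] B →ₗ[k] L) : Dual k L →ₗ[k] Dual k A ⊗[k] Dual k B :=
  (dualDistribEquiv k A B).symm.toLinearMap ∘ₗ μ.dualMap

theorem dualDistrib_codual (μ : A ⊗[k] B →ₗ[k] L) (f : Dual k L) :
    dualDistrib k A B (codual μ f) = f ∘ₗ μ :=
  (dualDistribEquiv k A B).apply_symm_apply (μ.dualMap f)

theorem dualDistrib_injective : Function.Injective (dualDistrib k A B) :=
  (dualDistribEquiv k A B).injective

theorem dualDistrib₃_injective : Function.Injective (dualDistrib₃ (k := k) (A := A) (B := B)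
    (E := E)) := by
  rw [dualDistrib₃, LinearMap.coe_comp]
  exact dualDistrib_injective.comp
    (Module.Flat.lTensor_preserves_injective_linearMap _ dualDistrib_injective)

theorem codual_assoc (μ : A ⊗[k] B →ₗ[k] X) (ν : X ⊗[k] E →ₗ[k] L) (μ' : B ⊗[k] E →ₗ[k] Y)
    (ν' : A ⊗[k] Y →ₗ[k] L)
    (h : ∀ a b e, ν (μ (a ⊗ₜ b) ⊗ₜ e) = ν' (a ⊗ₜ μ' (b ⊗ₜ e))) (f : Dual k L) :
    TensorProduct.assoc k _ _ _ ((codual μ).rTensor (Dual k E) (codual ν f)) =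
      (codual μ').lTensor (Dual k A) (codual ν' f) := by
  have h1 : ∀ (w : Dual k X ⊗[k] Dual k E) (a : A) (b : B) (e : E),
      dualDistrib₃ (TensorProduct.assoc k _ _ _ ((codual μ).rTensor (Dual k E) w))
        (a ⊗ₜ[k] (b ⊗ₜ[k] e)) = dualDistrib k X E w (μ (a ⊗ₜ b) ⊗ₜ e) := by
    intro w a b e
    induction w with
    | zero => simp only [LinearEquiv.map_zero, LinearMap.map_zero, LinearMap.zero_apply]
    | add x y hx hy => simp only [LinearEquiv.map_add, LinearMap.map_add, LinearMap.add_apply, hx, hy]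
    | tmul x y => rw [rTensor_tmul, dualDistrib₃_assoc, dualDistrib_codual]; simp
  have h2 : ∀ (w : Dual k A ⊗[k] Dual k Y) (a : A) (b : B) (e : E),
      dualDistrib₃ ((codual μ').lTensor (Dual k A) w)
        (a ⊗ₜ[k] (b ⊗ₜ[k] e)) = dualDistrib k A Y w (a ⊗ₜ μ' (b ⊗ₜ e)) := by
    intro w a b e
    induction w with
    | zero => simp
    | add x y hx hy => simp only [LinearMap.map_add, LinearMap.add_apply, hx, hy]
    | tmul x y => rw [lTensor_tmul, dualDistrib₃_tmul, dualDistrib_codual]; simp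
  apply dualDistrib₃_injective
  apply TensorProduct.ext
  ext a b e
  simp only [TensorProduct.mk_apply,
    AlgebraTensorModule.curry_apply, LinearMap.restrictScalars_self, TensorProduct.curry_apply,
    LinearMap.compr₂ₛₗ_apply]
  rw [h1, h2, dualDistrib_codual, dualDistrib_codual, LinearMap.comp_apply, LinearMap.comp_apply, h]

theorem codual_counit_left (μ : A ⊗[k] B →ₗ[k] B) (a : A) (h : ∀ b, μ (a ⊗ₜ b) = b)
    (f : Dual k B) :
    (Dual.eval k A a).rTensor (Dual k B) (codual μ f) = (1 : k) ⊗ₜ[k] f := by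
  have h1 : ∀ (w : Dual k A ⊗[k] Dual k B) (b : B),
      TensorProduct.lid k (Dual k B) ((Dual.eval k A a).rTensor (Dual k B) w) b =
        dualDistrib k A B w (a ⊗ₜ b) := by
    intro w b
    induction w with
    | zero => simp
    | add x y hx hy => simp only [LinearEquiv.map_add, LinearMap.map_add, LinearMap.add_apply, hx, hy]
    | tmul x y => simp
  apply (TensorProduct.lid k (Dual k B)).injective
  ext b
  rw [h1, dualDistrib_codual, LinearMap.comp_apply, h]
  simp

theorem codual_counit_right (μ : B ⊗[k] A →ₗ[k] B) (a : A) (h : ∀ b, μ (b ⊗ₜ a) = b)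
    (f : Dual k B) :
    (Dual.eval k A a).lTensor (Dual k B) (codual μ f) = f ⊗ₜ[k] (1 : k) := by
  have h1 : ∀ (w : Dual k B ⊗[k] Dual k A) (b : B),
      TensorProduct.rid k (Dual k B) ((Dual.eval k A a).lTensor (Dual k B) w) b =
        dualDistrib k B A w (b ⊗ₜ a) := by
    intro w b
    induction w with
    | zero => simp
    | add x y hx hy => simp only [LinearEquiv.map_add, LinearMap.map_add, LinearMap.add_apply, hx, hy]
    | tmul x y => simp [mul_comm]
  apply (TensorProduct.rid k (Dual k B)).injective
  ext b
  rw [h1, dualDistrib_codual, LinearMap.comp_apply, h]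
  simp

section Actions

variable (k) (D M : Type*) [Ring D] [Algebra k D] [AddCommGroup M] [Module k M]

/-- The left action `D ⊗ M → M`. -/
def leftAct [Module D M] [IsScalarTower k D M] : D ⊗[k] M →ₗ[k] M :=
  TensorProduct.lift (Algebra.lsmul k k M).toLinearMap

/-- The right action `M ⊗ D → M`. -/
def rightAct [Module Dᵐᵒᵖ M] [IsScalarTower k Dᵐᵒᵖ M] : M ⊗[k] D →ₗ[k] M :=
  TensorProduct.lift ((Algebra.lsmul k k M).toLinearMap ∘ₗ
    (MulOpposite.opLinearEquiv k : D ≃ₗ[k] Dᵐᵒᵖ).toLinearMap).flip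

@[simp] theorem leftAct_tmul [Module D M] [IsScalarTower k D M] (d : D) (m : M) :
    leftAct k D M (d ⊗ₜ m) = d • m := rfl

@[simp] theorem rightAct_tmul [Module Dᵐᵒᵖ M] [IsScalarTower k Dᵐᵒᵖ M] (m : M) (d : D) :
    rightAct k D M (m ⊗ₜ d) = MulOpposite.op d • m := rfl

end Actions

section Algebra

variable (k) (D M : Type*) [Ring D] [Algebra k D] [FiniteDimensional k D]

/-- The coalgebra `D*` dual to a finite-dimensional algebra `D`: the comultiplication is dual to
the multiplication of `D` and the counit is evaluation at `1`. -/
instance dualCoalgebra : Coalgebra k (Dual k D) where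
  comul := codual (LinearMap.mul' k D)
  counit := Dual.eval k D 1
  coassoc := LinearMap.ext fun f => codual_assoc _ _ _ _ (by simp [mul_assoc]) f
  rTensor_counit_comp_comul := LinearMap.ext fun f => codual_counit_left _ 1 (by simp) f
  lTensor_counit_comp_comul := LinearMap.ext fun f => codual_counit_right _ 1 (by simp) f

variable [AddCommGroup M] [Module k M] [FiniteDimensional k M] [Module D M] [Module Dᵐᵒᵖ M]
  [IsScalarTower k D M] [IsScalarTower k Dᵐᵒᵖ M] [SMulCommClass D Dᵐᵒᵖ M]

/-- The `D*`-bicomodule `M*` dual to a finite-dimensional `D`-bimodule `M`: the left coaction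
`M* → D* ⊗ M*` is dual to the left action `D ⊗ M → M`, and the right coaction `M* → M* ⊗ D*` is
dual to the right action `M ⊗ D → M`. -/
instance dualBicomodule : Bicomodule k (Dual k D) (Dual k M) where
  coactL := codual (leftAct k D M)
  coactR := codual (rightAct k D M)
  coassocL := codual_assoc _ _ _ _ (by simp [mul_smul])
  counitL := codual_counit_left _ 1 (by simp)
  coassocR := codual_assoc _ _ _ _ (by simp [mul_smul])
  counitR := codual_counit_right _ 1 (by simp)
  coact_comm := codual_assoc _ _ _ _ (by simp [smul_comm])

end Algebra

end Dual

section Chain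

theorem map_subtype_injective {k C : Type*} [Field k] [AddCommGroup C] [Module k C]
    (N : Submodule k C) :
    Function.Injective (TensorProduct.map N.subtype N.subtype) := by
  rw [← LinearMap.rTensor_comp_lTensor, LinearMap.coe_comp]
  exact (rTensor_subtype_injective C N).comp (lTensor_subtype_injective N N)

variable (k C : Type*) [Field k] [AddCommGroup C] [Module k C] [Coalgebra k C]

variable {k C} in
/-- Right coideals of `C`, that is, right subcomodules of `C`: subspaces `N` with
`Δ(N) ⊆ N ⊗ C`. -/
def IsRightCoideal (N : Submodule k C) : Prop :=
  ∀ x ∈ N, Coalgebra.comul (R := k) x ∈ range (N.subtype.rTensor C)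

/-- A (right) chain coalgebra: its right coideals are linearly ordered by inclusion. -/
def IsChainCoalgebra : Prop :=
  ∀ N N' : Submodule k C, IsRightCoideal N → IsRightCoideal N' → N ≤ N' ∨ N' ≤ N

variable {k C} in
/-- Simple right coideals: the nonzero right coideals which contain no right coideals other than
`0` and themselves. -/
def IsSimpleRightCoideal (N : Submodule k C) : Prop :=
  IsRightCoideal N ∧ N ≠ ⊥ ∧ ∀ N' ≤ N, IsRightCoideal N' → N' = ⊥ ∨ N' = N

/-- The coradical `C₀`, the socle of `C` as a right comodule: the sum of all simple right
coideals. -/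
def coradical : Submodule k C := sSup {N | IsSimpleRightCoideal N}

variable {k C}

theorem isRightCoideal_sSup {S : Set (Submodule k C)} (h : ∀ N ∈ S, IsRightCoideal N) :
    IsRightCoideal (sSup S) := by
  intro x hx
  have : sSup S ≤ (range ((sSup S).subtype.rTensor C)).comap (Coalgebra.comul (R := k)) := by
    apply sSup_le
    intro N hN y hy
    obtain ⟨z, hz⟩ := h N hN y hy
    refine ⟨(Submodule.inclusion (le_sSup hN)).rTensor C z, ?_⟩
    rw [← rTensor_comp_apply, ← hz]
    rfl
  exact this hx

theorem mem_range_rTensor_iff {X V : Type*} [AddCommGroup X] [Module k X] [AddCommGroup V]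
    [Module k V] (p : Submodule k X) (z : X ⊗[k] V) :
    z ∈ range (p.subtype.rTensor V) ↔
      ∀ g : V →ₗ[k] k, TensorProduct.rid k X (g.lTensor X z) ∈ p := by
  constructor
  · rintro ⟨y, rfl⟩ g
    induction y with
    | zero => simp
    | add a b ha hb => simp only [map_add]; exact p.add_mem ha hb
    | tmul a b => simpa using p.smul_mem _ a.2
  · intro h
    let b := Module.Free.chooseBasis k V
    rw [← (TensorProduct.equivFinsuppOfBasisRight b).symm_apply_apply z,
      TensorProduct.equivFinsuppOfBasisRight_symm_apply]
    refine Submodule.sum_mem _ fun i _ => ?_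
    refine ⟨⟨_, h (b.coord i)⟩ ⊗ₜ b i, ?_⟩
    simp [TensorProduct.equivFinsuppOfBasisRight_apply]

theorem mem_range_lTensor_of {X V : Type*} [AddCommGroup X] [Module k X] [AddCommGroup V]
    [Module k V] (p : Submodule k X) (z : V ⊗[k] X)
    (h : ∀ g : V →ₗ[k] k, TensorProduct.lid k X (g.rTensor X z) ∈ p) :
    z ∈ range (p.subtype.lTensor V) := by
  let b := Module.Free.chooseBasis k V
  rw [← (TensorProduct.equivFinsuppOfBasisLeft b).symm_apply_apply z,
    TensorProduct.equivFinsuppOfBasisLeft_symm_apply]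
  refine Submodule.sum_mem _ fun i _ => ?_
  refine ⟨b i ⊗ₜ ⟨_, h (b.coord i)⟩, ?_⟩
  simp [TensorProduct.equivFinsuppOfBasisLeft_apply]

/-- The map `c ↦ ∑ g(c₁) c₂`. -/
def rightHit (g : C →ₗ[k] k) : C →ₗ[k] C :=
  (TensorProduct.lid k C).toLinearMap ∘ₗ g.rTensor C ∘ₗ Coalgebra.comul

theorem comul_rightHit (g : C →ₗ[k] k) (c : C) :
    Coalgebra.comul (R := k) (rightHit g c) =
      (rightHit g).rTensor C (Coalgebra.comul (R := k) c) := by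
  have h1 : Coalgebra.comul (R := k) ∘ₗ (TensorProduct.lid k C).toLinearMap ∘ₗ g.rTensor C =
      (TensorProduct.lid k (C ⊗[k] C)).toLinearMap ∘ₗ g.rTensor (C ⊗[k] C) ∘ₗ
        (Coalgebra.comul (R := k)).lTensor C := by
    ext; simp
  have h2 : (TensorProduct.lid k (C ⊗[k] C)).toLinearMap ∘ₗ g.rTensor (C ⊗[k] C) ∘ₗ
      (TensorProduct.assoc k C C C).toLinearMap =
      ((TensorProduct.lid k C).toLinearMap ∘ₗ g.rTensor C).rTensor C := by
    ext; simp [smul_tmul']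
  have h3 := LinearMap.congr_fun h1 (Coalgebra.comul (R := k) c)
  simp only [LinearMap.comp_apply, LinearEquiv.coe_coe] at h3
  have h4 := LinearMap.congr_fun h2
    ((Coalgebra.comul (R := k)).rTensor C (Coalgebra.comul (R := k) c))
  simp only [LinearMap.comp_apply, LinearEquiv.coe_coe] at h4
  simp only [rightHit, LinearMap.comp_apply, LinearEquiv.coe_coe]
  rw [h3, ← Coalgebra.coassoc_apply, h4, ← rTensor_comp_apply]
  rfl

theorem isRightCoideal_map (g : C →ₗ[k] k) {N : Submodule k C} (h : IsRightCoideal N) :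
    IsRightCoideal (N.map (rightHit g)) := by
  rintro _ ⟨y, hy, rfl⟩
  obtain ⟨z, hz⟩ := h y hy
  refine ⟨((rightHit g).submoduleMap N).rTensor C z, ?_⟩
  rw [comul_rightHit, ← hz, ← rTensor_comp_apply, ← rTensor_comp_apply]
  rfl

theorem isRightCoideal_comap (g : C →ₗ[k] k) {N N' : Submodule k C} (h : IsRightCoideal N)
    (h' : IsRightCoideal N') : IsRightCoideal (N ⊓ N'.comap (rightHit g)) := by
  intro x hx
  have h1 := h x hx.1
  have h2 := h' _ hx.2
  rw [mem_range_rTensor_iff] at h1 h2 ⊢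
  intro e
  refine ⟨h1 e, ?_⟩
  have h3 := h2 e
  rw [comul_rightHit, interchange] at h3
  have h4 : ∀ y : C ⊗[k] k, TensorProduct.rid k C ((rightHit g).rTensor k y) =
      rightHit g (TensorProduct.rid k C y) := by
    intro y
    have : (TensorProduct.rid k C).toLinearMap ∘ₗ (rightHit g).rTensor k =
        rightHit g ∘ₗ (TensorProduct.rid k C).toLinearMap := by
      ext; simp
    exact LinearMap.congr_fun this y
  rw [h4] at h3
  exact h3

theorem map_rightHit_simple (g : C →ₗ[k] k) {N : Submodule k C} (h : IsSimpleRightCoideal N) :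
    N.map (rightHit g) ≤ coradical k C := by
  by_cases h0 : N.map (rightHit g) = ⊥
  · rw [h0]; exact bot_le
  apply le_sSup
  refine ⟨isRightCoideal_map g h.1, h0, fun N' hN' hr => ?_⟩
  rcases h.2.2 _ inf_le_left (isRightCoideal_comap g h.1 hr) with hb | he
  · left
    rw [eq_bot_iff]
    intro x hx
    obtain ⟨y, hy, rfl⟩ := hN' hx
    have : y ∈ (⊥ : Submodule k C) := hb ▸ ⟨hy, hx⟩
    rw [Submodule.mem_bot] at this
    simp [this]
  · right
    apply le_antisymm hN'
    rintro _ ⟨y, hy, rfl⟩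
    rw [← he] at hy
    exact hy.2

theorem rightHit_mem_coradical (g : C →ₗ[k] k) {x : C} (hx : x ∈ coradical k C) :
    rightHit g x ∈ coradical k C := by
  have : coradical k C ≤ (coradical k C).comap (rightHit g) := by
    apply sSup_le
    intro N hN
    exact Submodule.map_le_iff_le_comap.1 (map_rightHit_simple g hN)
  exact this hx

/-- Subcoalgebras of `C`: subspaces `N` with `Δ(N) ⊆ N ⊗ N`. -/
def IsSubcoalgebra (N : Submodule k C) : Prop :=
  ∀ x ∈ N, Coalgebra.comul (R := k) x ∈ range (TensorProduct.map N.subtype N.subtype)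

theorem isRightCoideal_coradical : IsRightCoideal (coradical k C) :=
  isRightCoideal_sSup fun _ hN => hN.1

/-- The coradical is a subcoalgebra. -/
theorem isSubcoalgebra_coradical : IsSubcoalgebra (coradical k C) := by
  intro x hx
  obtain ⟨y, hy⟩ := isRightCoideal_coradical x hx
  have h1 : y ∈ range ((coradical k C).subtype.lTensor (coradical k C)) := by
    apply mem_range_lTensor_of
    intro g
    obtain ⟨g', hg'⟩ := g.exists_extend
    rw [← hg', rTensor_comp_apply]
    have h2 := rightHit_mem_coradical g' hx
    rw [rightHit, LinearMap.comp_apply, LinearMap.comp_apply, ← hy] at h2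
    exact h2
  obtain ⟨w, rfl⟩ := h1
  refine ⟨w, ?_⟩
  rw [map_eq_rTensor_lTensor]
  exact hy

/-- The comultiplication of a subcoalgebra. -/
def subComul {N : Submodule k C} (h : IsSubcoalgebra N) : N →ₗ[k] N ⊗[k] N :=
  factor (TensorProduct.map N.subtype N.subtype) (map_subtype_injective N)
    (Coalgebra.comul ∘ₗ N.subtype) (fun z => h z.1 z.2)

theorem subComul_apply {N : Submodule k C} (h : IsSubcoalgebra N) (x : N) :
    TensorProduct.map N.subtype N.subtype (subComul h x) = Coalgebra.comul (R := k) x.1 :=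
  factor_apply _ _ _ _ x

/-- A subcoalgebra as a coalgebra, with the restricted comultiplication and counit. -/
abbrev subCoalgebra {N : Submodule k C} (h : IsSubcoalgebra N) : Coalgebra k N where
  comul := subComul h
  counit := Coalgebra.counit ∘ₗ N.subtype
  coassoc := by
    have hc : TensorProduct.map N.subtype N.subtype ∘ₗ subComul h =
      Coalgebra.comul ∘ₗ N.subtype := LinearMap.ext (subComul_apply h)
    ext1 x
    have hinj : Function.Injective
        (TensorProduct.map N.subtype (TensorProduct.map N.subtype N.subtype)) := by
      rw [← LinearMap.rTensor_comp_lTensor, LinearMap.coe_comp]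
      exact (rTensor_subtype_injective (C ⊗[k] C) N).comp
        (Module.Flat.lTensor_preserves_injective_linearMap _ (map_subtype_injective N))
    apply hinj
    rw [LinearMap.comp_apply, LinearMap.comp_apply, LinearMap.comp_apply, LinearEquiv.coe_coe,
      ← map_map_assoc, ← map_comp_left, ← map_comp_right, hc, ← rTensor_map, ← lTensor_map,
      subComul_apply, Coalgebra.coassoc_apply]
  rTensor_counit_comp_comul := by
    ext1 x
    apply lTensor_subtype_injective k N
    rw [LinearMap.comp_apply, rTensor_comp_apply, interchange, interchange,
      ← map_eq_rTensor_lTensor, subComul_apply, Coalgebra.rTensor_counit_comul]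
    simp
  lTensor_counit_comp_comul := by
    ext1 x
    apply rTensor_subtype_injective k N
    rw [LinearMap.comp_apply, lTensor_comp_apply, ← interchange, ← interchange,
      ← map_eq_lTensor_rTensor, subComul_apply, Coalgebra.lTensor_counit_comul]
    simp

/-- The coradical as a coalgebra. -/
instance : Coalgebra k (coradical k C) := subCoalgebra isSubcoalgebra_coradical

variable (k C)

/-- A chain coalgebra of type `D`: a chain coalgebra `C` such that the algebra `(C₀)*` dual to the
coradical `C₀`, with the convolution product, is isomorphic to `D`. -/
def IsChainCoalgebraOfType (D : Type*) [Ring D] [Algebra k D] : Prop :=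
  IsChainCoalgebra k C ∧ Nonempty (WithConv (coradical k C →ₗ[k] k) ≃ₐ[k] D)

end Chain

/-- Separable algebras: the multiplication `D ⊗ D → D` is split by a map of `D`-bimodules; the
image `e` of `1` under such a splitting is an element with `μ(e) = 1` and `a e = e a` for all
`a ∈ D`. -/
def IsSeparableAlgebra (k D : Type*) [Field k] [Ring D] [Algebra k D] : Prop :=
  ∃ e : D ⊗[k] D, LinearMap.mul' k D e = 1 ∧
    ∀ a : D, (LinearMap.mulLeft k a).rTensor D e = (LinearMap.mulRight k a).lTensor D e

end ChainCoalg

end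

universe u v w t

noncomputable section

namespace ChainCoalg

open TensorProduct LinearMap WithConv

/-! ### The two actions of the dual algebra on a coalgebra. -/

section DualAlgebra

variable {k C : Type*} [Field k] [AddCommGroup C] [Module k C] [Coalgebra k C]

/-! Both halves are module theory over the dual algebra `C*` with convolution: a right coideal is a
submodule for the left action `leftHit`, and the operators `rightHit` are endomorphisms of this
module.

For (1), let `T` be the cotensor coalgebra, graded by the number of factors. A nonzero `m` in `M`
generates `M` as a right `D`-module, by dimension, and this makes contraction of the first factor of
`M* □ X` with `m` injective (`contractLeft_eval_injective`); so every homogeneous component has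
dimension at most `dim D`. On the other hand `D` embeds in `T*` by functionals of degree zero, which
preserve each component. As `D` is a division algebra, the orbit of a nonzero homogeneous element
has dimension `dim D`, so it is the whole component (`piece_le_of_mem`). Functionals of degree one
can be chosen to lower the degree of a given element by exactly one (`exists_leftHit_notMem`). Hence
a right coideal with an element of degree `n` contains everything of degree at most `n`
(`degFil_le_of_mem`). So right coideals are linearly ordered, and the coradical is `D*`, with dual
`D`.

For (2), let `J` be the annihilator of `C₀` in `C*`, so that `C*/J ≅ D`. The coradical filtration
exhausts `C`, so `C*` is complete for the filtration by annihilators of its terms. Separability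
enters twice. Contracting Hochschild 2-cocycles lifts `D` to an algebra map `s : D → C*`
(`exists_algHom_lift`). Averaging turns a generator of `J` modulo the annihilator of `C₁` into an
`m` with `s a * m = m * s (τ a)` exactly, for an endomorphism `τ` of `D` (`exists_generator`). A
single generator suffices because in a chain coalgebra nothing lies strictly between `C₀` and `C₁`
(`le_coradical_of_lt_coradFil_two`). The transposes of `s` and of `d ↦ m * s d` are a coalgebra map
`C → D*` and a bicolinear map `C → M*`, where `M` is `D` with left action twisted by `τ`. They
extend to a coalgebra map into the cotensor coalgebra (`liftCoalgHom`), which is injective because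
`s(D)` and `m` generate `C*` topologically (`eq_zero_of_generatorPow`). -/

theorem eq_of_forall_functional {V : Type*} [AddCommGroup V] [Module k V] {x y : V}
    (h : ∀ f : V →ₗ[k] k, f x = f y) : x = y := by
  rw [← sub_eq_zero, ← Module.forall_dual_apply_eq_zero_iff k]
  intro f
  rw [map_sub, h f, sub_self]

theorem exists_functional_of_notMem {V : Type*} [AddCommGroup V] [Module k V]
    {p : Submodule k V} {x : V} (hx : x ∉ p) :
    ∃ f : V →ₗ[k] k, f x ≠ 0 ∧ ∀ y ∈ p, f y = 0 := by
  obtain ⟨f, hf, h⟩ := p.exists_dual_map_eq_bot_of_notMem hx inferInstance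
  refine ⟨f, hf, fun y hy => ?_⟩
  have : f y ∈ p.map f := ⟨y, hy, rfl⟩
  rwa [h] at this

variable (k C) in
/-- The algebra dual to a coalgebra, with the convolution product. -/
abbrev DualAlgebra := WithConv (C →ₗ[k] k)

/-- The map `c ↦ ∑ c₁ g(c₂)`. -/
def leftHit (g : C →ₗ[k] k) : C →ₗ[k] C :=
  (TensorProduct.rid k C).toLinearMap ∘ₗ g.lTensor C ∘ₗ Coalgebra.comul

theorem mul_apply_leftHit (a b : DualAlgebra k C) (c : C) :
    (a * b) c = a (leftHit b.ofConv c) := by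
  rw [convMul_apply]
  simp only [leftHit, LinearMap.comp_apply, LinearEquiv.coe_coe]
  have : LinearMap.mul' k k ∘ₗ TensorProduct.map a.ofConv b.ofConv =
      a.ofConv ∘ₗ (TensorProduct.rid k C).toLinearMap ∘ₗ b.ofConv.lTensor C := by
    ext; simp [mul_comm]
  exact LinearMap.congr_fun this _

theorem mul_apply_rightHit (a b : DualAlgebra k C) (c : C) :
    (a * b) c = b (rightHit a.ofConv c) := by
  rw [convMul_apply]
  simp only [rightHit, LinearMap.comp_apply, LinearEquiv.coe_coe]
  have : LinearMap.mul' k k ∘ₗ TensorProduct.map a.ofConv b.ofConv =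
      b.ofConv ∘ₗ (TensorProduct.lid k C).toLinearMap ∘ₗ a.ofConv.rTensor C := by
    ext; simp
  exact LinearMap.congr_fun this _

/-- Functionals separate points, so the axioms of the two actions, here and in the next two lemmas,
are read off from associativity and unitality of convolution. -/
theorem leftHit_mul (a b : DualAlgebra k C) (c : C) :
    leftHit (a * b).ofConv c = leftHit a.ofConv (leftHit b.ofConv c) :=
  eq_of_forall_functional fun f => by
    have := mul_apply_leftHit (toConv f) (a * b) c
    rw [← mul_assoc, mul_apply_leftHit, mul_apply_leftHit] at this
    exact this.symm

theorem leftHit_rightHit (a b : DualAlgebra k C) (c : C) :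
    leftHit a.ofConv (rightHit b.ofConv c) = rightHit b.ofConv (leftHit a.ofConv c) :=
  eq_of_forall_functional fun f => by
    have := mul_apply_rightHit b (toConv f * a) c
    rw [← mul_assoc, mul_apply_leftHit, mul_apply_rightHit, mul_apply_leftHit] at this
    exact this.symm

theorem leftHit_one (c : C) : leftHit (1 : DualAlgebra k C).ofConv c = c :=
  eq_of_forall_functional (k := k) fun f => by
    have := mul_apply_leftHit (toConv f) 1 c
    rw [mul_one] at this
    exact this.symm

/-- Replaces a condition on tensors by stability under an action; right coideals are handled in this
form from here on. -/
theorem isRightCoideal_iff {N : Submodule k C} :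
    IsRightCoideal N ↔ ∀ x ∈ N, ∀ g : C →ₗ[k] k, leftHit g x ∈ N :=
  forall₂_congr fun _ _ => mem_range_rTensor_iff _ _

theorem leftHit_add (f g : C →ₗ[k] k) (c : C) :
    leftHit (f + g) c = leftHit f c + leftHit g c := by
  simp [leftHit, lTensor_add]

theorem leftHit_smul (r : k) (g : C →ₗ[k] k) (c : C) : leftHit (r • g) c = r • leftHit g c := by
  simp [leftHit, lTensor_smul]

/-- The right coideal generated by an element. -/
def cyclicCoideal (c : C) : Submodule k C :=
  range ({ toFun := fun g => leftHit g c
           map_add' := fun f g => leftHit_add f g c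
           map_smul' := fun r g => leftHit_smul r g c } : (C →ₗ[k] k) →ₗ[k] C)

theorem mem_cyclicCoideal {c x : C} : x ∈ cyclicCoideal (k := k) c ↔
    ∃ g : C →ₗ[k] k, leftHit g c = x := Iff.rfl

theorem self_mem_cyclicCoideal (c : C) : c ∈ cyclicCoideal (k := k) c :=
  ⟨_, leftHit_one (k := k) c⟩

theorem isRightCoideal_cyclicCoideal (c : C) : IsRightCoideal (cyclicCoideal (k := k) c) := by
  rw [isRightCoideal_iff]
  rintro _ ⟨g, rfl⟩ f
  exact ⟨(toConv f * toConv g).ofConv, leftHit_mul (toConv f) (toConv g) c⟩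

theorem cyclicCoideal_le {c : C} {N : Submodule k C} (h : IsRightCoideal N) (hc : c ∈ N) :
    cyclicCoideal c ≤ N := by
  rintro _ ⟨g, rfl⟩
  exact isRightCoideal_iff.1 h c hc g

theorem cyclicCoideal_rightHit (a : DualAlgebra k C) (c : C) :
    cyclicCoideal (rightHit a.ofConv c) = (cyclicCoideal c).map (rightHit a.ofConv) := by
  apply le_antisymm
  · exact cyclicCoideal_le (isRightCoideal_map _ (isRightCoideal_cyclicCoideal c))
      ⟨c, self_mem_cyclicCoideal c, rfl⟩
  · rintro _ ⟨_, ⟨g, rfl⟩, rfl⟩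
    exact ⟨g, leftHit_rightHit (toConv g) a c⟩

/-- Local finiteness: `Δ(c)` is a finite sum of pure tensors, and each `leftHit g c` lies in the
span of their left factors. -/
instance finiteDimensional_cyclicCoideal (c : C) :
    FiniteDimensional k (cyclicCoideal (k := k) c) := by
  have h : ∀ z : C ⊗[k] C, ∃ p : Submodule k C, FiniteDimensional k p ∧
      ∀ g : C →ₗ[k] k, TensorProduct.rid k C (g.lTensor C z) ∈ p := by
    intro z
    induction z with
    | zero => exact ⟨⊥, inferInstance, by simp⟩
    | add x y hx hy =>
      obtain ⟨p, _, hp⟩ := hx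
      obtain ⟨q, _, hq⟩ := hy
      refine ⟨p ⊔ q, inferInstance, fun g => ?_⟩
      rw [map_add, map_add]
      exact add_mem (Submodule.mem_sup_left (hp g)) (Submodule.mem_sup_right (hq g))
    | tmul x y =>
      refine ⟨k ∙ x, inferInstance, fun g => ?_⟩
      rw [lTensor_tmul, TensorProduct.rid_tmul]
      exact Submodule.smul_mem _ _ (Submodule.mem_span_singleton_self x)
  obtain ⟨p, _, hp⟩ := h (Coalgebra.comul (R := k) c)
  have hle : cyclicCoideal c ≤ p := by
    rintro _ ⟨g, rfl⟩
    exact hp g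
  exact Submodule.finiteDimensional_of_le hle

end DualAlgebra

/-! ### Annihilators of subspaces in the dual algebra. -/

section Perp

variable {k C : Type*} [Field k] [AddCommGroup C] [Module k C]

/-- The functionals which vanish on a subspace. -/
def perp (N : Submodule k C) : AddSubgroup (DualAlgebra k C) where
  carrier := {a | ∀ c ∈ N, a c = 0}
  add_mem' ha hb c hc := (congrArg₂ (· + ·) (ha c hc) (hb c hc)).trans (add_zero 0)
  zero_mem' _ _ := rfl
  neg_mem' ha c hc := (congrArg (- ·) (ha c hc)).trans neg_zero

theorem perp_anti {N N' : Submodule k C} (h : N ≤ N') : perp N' ≤ perp N :=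
  fun _ ha c hc => ha c (h hc)

theorem mem_iff_forall_perp {N : Submodule k C} {c : C} :
    c ∈ N ↔ ∀ a ∈ perp N, a c = 0 := by
  refine ⟨fun hc a ha => ha c hc, fun h => ?_⟩
  by_contra hc
  obtain ⟨f, hf, h'⟩ := exists_functional_of_notMem hc
  exact hf (h (toConv f) h')

end Perp

/-! ### The coradical filtration, and its behaviour in chain coalgebras. -/

section ChainStructure

variable {k C : Type*} [Field k] [AddCommGroup C] [Module k C] [Coalgebra k C]

/-- Two simple right coideals of a chain coalgebra are comparable, hence equal, so the sum has only
one term. -/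
theorem isSimpleRightCoideal_coradical (h : IsChainCoalgebra k C) (h0 : coradical k C ≠ ⊥) :
    IsSimpleRightCoideal (coradical k C) := by
  have hS : ∃ S : Submodule k C, IsSimpleRightCoideal S := by
    by_contra! hn
    apply h0
    rw [coradical, eq_bot_iff]
    exact sSup_le fun N hN => absurd hN (hn N)
  obtain ⟨S, hS⟩ := hS
  have : coradical k C = S := by
    apply le_antisymm
    · apply sSup_le
      intro N hN
      rcases h N S hN.1 hS.1 with h1 | h1
      · exact h1
      · rcases hN.2.2 S h1 hS.1 with h2 | h2
        · exact absurd h2 hS.2.1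
        · exact h2.ge
    · exact le_sSup hS
  rwa [this]

theorem coradical_le (h : IsChainCoalgebra k C) (h0 : coradical k C ≠ ⊥) {N : Submodule k C}
    (hN : IsRightCoideal N) (hN0 : N ≠ ⊥) : coradical k C ≤ N := by
  have hs := isSimpleRightCoideal_coradical h h0
  rcases h _ N hs.1 hN with h1 | h1
  · exact h1
  · rcases hs.2.2 N h1 hN with h2 | h2
    · exact absurd h2 hN0
    · exact h2.ge

theorem mul_mem_perp_right {N : Submodule k C} (hN : IsRightCoideal N) {a : DualAlgebra k C}
    (ha : a ∈ perp N) (b : DualAlgebra k C) : a * b ∈ perp N := fun c hc => by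
  rw [mul_apply_leftHit]
  exact ha _ (isRightCoideal_iff.1 hN c hc _)

/-- The annihilator of a right coideal is a right ideal, so `f (rightHit a c) = (a * f) c` vanishes
for every functional `f`. -/
theorem rightHit_eq_zero {N : Submodule k C} (hN : IsRightCoideal N) {a : DualAlgebra k C}
    (ha : a ∈ perp N) {c : C} (hc : c ∈ N) : rightHit a.ofConv c = 0 :=
  eq_of_forall_functional fun f => by
    have := mul_mem_perp_right hN ha (toConv f) c hc
    rw [mul_apply_rightHit] at this
    rw [map_zero]
    exact this

/-- Together with `mul_mem_perp_right` this makes the annihilator of the coradical a two-sided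
ideal, because the coradical is stable under `rightHit` as well. -/
theorem mul_mem_perp_coradical (a : DualAlgebra k C) {b : DualAlgebra k C}
    (hb : b ∈ perp (coradical k C)) : a * b ∈ perp (coradical k C) := fun c hc => by
  rw [mul_apply_rightHit]
  exact hb _ (rightHit_mem_coradical _ hc)

variable (k C) in
/-- The coradical filtration `0 ⊆ C₀ ⊆ C₁ ⊆ ⋯`. -/
def coradFil : ℕ → Submodule k C
  | 0 => ⊥
  | n + 1 => ⨅ a : perp (coradical k C), (coradFil n).comap (rightHit a.1.ofConv)

theorem mem_coradFil_succ {n : ℕ} {c : C} : c ∈ coradFil k C (n + 1) ↔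
    ∀ a ∈ perp (coradical k C), rightHit a.ofConv c ∈ coradFil k C n := by
  simp [coradFil, Submodule.mem_iInf]

theorem mem_coradFil_zero {c : C} : c ∈ coradFil k C 0 ↔ c = 0 := Iff.rfl

/-- Fixes the indexing: `coradFil k C n` is the term usually called `C_{n-1}`. -/
theorem coradFil_one : coradFil k C 1 = coradical k C := by
  ext c
  rw [mem_coradFil_succ]
  refine ⟨fun h => ?_, fun h a ha => rightHit_eq_zero isRightCoideal_coradical ha h⟩
  rw [mem_iff_forall_perp]
  intro a ha
  have := mul_apply_rightHit a 1 c
  rwa [mul_one, mem_coradFil_zero.1 (h a ha), map_zero] at this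

theorem isRightCoideal_coradFil : ∀ n, IsRightCoideal (coradFil k C n)
  | 0 => isRightCoideal_iff.2 fun x hx g => by
    rw [mem_coradFil_zero.1 hx, map_zero]
    exact zero_mem _
  | n + 1 => isRightCoideal_iff.2 fun x hx g => mem_coradFil_succ.2 fun a ha => by
    have := leftHit_rightHit (toConv g) a x
    rw [← this]
    exact isRightCoideal_iff.1 (isRightCoideal_coradFil n) _ (mem_coradFil_succ.1 hx a ha) g

theorem coradFil_mono : Monotone (coradFil k C) := by
  refine monotone_nat_of_le_succ fun n => ?_
  induction n with
  | zero => exact bot_le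
  | succ n ih => exact fun c hc => mem_coradFil_succ.2 fun a ha => ih (mem_coradFil_succ.1 hc a ha)

/-- The filtration is left-right symmetric: in degree one because the annihilator of `C₀` is
two-sided, and in higher degrees because left and right hits commute. -/
theorem mem_coradFil_succ_iff_leftHit {n : ℕ} {c : C} : c ∈ coradFil k C (n + 1) ↔
    ∀ a ∈ perp (coradical k C), leftHit a.ofConv c ∈ coradFil k C n := by
  induction n generalizing c with
  | zero =>
    rw [coradFil_one]
    refine ⟨fun h a ha => ?_, fun h => ?_⟩
    · rw [mem_coradFil_zero]
      refine eq_of_forall_functional (k := k) fun f => ?_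
      have := mul_mem_perp_coradical (toConv f) ha c h
      rw [mul_apply_leftHit] at this
      rw [map_zero]
      exact this
    · rw [mem_iff_forall_perp]
      intro a ha
      have := mul_apply_leftHit (1 : DualAlgebra k C) a c
      rwa [one_mul, mem_coradFil_zero.1 (h a ha), map_zero] at this
  | succ n ih =>
    refine ⟨fun h a ha => mem_coradFil_succ.2 fun b hb => ?_,
      fun h => mem_coradFil_succ.2 fun a ha => ih.2 fun b hb => ?_⟩
    · rw [← leftHit_rightHit]
      exact ih.1 (mem_coradFil_succ.1 h b hb) a ha
    · rw [leftHit_rightHit]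
      exact mem_coradFil_succ.1 (h b hb) a ha

/-- The induction peels off left hits, which commute with `rightHit a`; this is why the left-handed
description of the filtration is needed. -/
theorem rightHit_mem_coradFil {m n : ℕ} {c : C} (hc : c ∈ coradFil k C (m + n))
    {a : DualAlgebra k C} (ha : a ∈ perp (coradFil k C m)) :
    rightHit a.ofConv c ∈ coradFil k C n := by
  induction n generalizing c with
  | zero => exact rightHit_eq_zero (isRightCoideal_coradFil m) ha hc
  | succ n ih =>
    rw [mem_coradFil_succ_iff_leftHit]
    intro b hb
    rw [leftHit_rightHit]
    exact ih (mem_coradFil_succ_iff_leftHit.1 hc b hb)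

theorem mul_mem_perp_coradFil {m n : ℕ} {a b : DualAlgebra k C}
    (ha : a ∈ perp (coradFil k C m)) (hb : b ∈ perp (coradFil k C n)) :
    a * b ∈ perp (coradFil k C (m + n)) := fun c hc => by
  rw [mul_apply_rightHit]
  exact hb _ (rightHit_mem_coradFil hc ha)

theorem mem_perp_coradFil_zero (a : DualAlgebra k C) : a ∈ perp (coradFil k C 0) := by
  intro c hc
  rw [mem_coradFil_zero.1 hc, map_zero]

theorem mul_mem_perp_left {n : ℕ} (a : DualAlgebra k C) {b : DualAlgebra k C}
    (hb : b ∈ perp (coradFil k C n)) : a * b ∈ perp (coradFil k C n) := by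
  have := mul_mem_perp_coradFil (mem_perp_coradFil_zero a) hb
  rwa [zero_add] at this

theorem mul_mem_perp {n : ℕ} {a : DualAlgebra k C} (ha : a ∈ perp (coradFil k C n))
    (b : DualAlgebra k C) : a * b ∈ perp (coradFil k C n) :=
  mul_mem_perp_right (isRightCoideal_coradFil n) ha b

/-- The coradical filtration of a chain coalgebra is exhaustive. -/
theorem mem_coradFil_of_finrank_le (h : IsChainCoalgebra k C) (h0 : coradical k C ≠ ⊥) (d : ℕ)
    (c : C) (hd : Module.finrank k (cyclicCoideal (k := k) c) ≤ d) : c ∈ coradFil k C d := by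
  induction d generalizing c with
  | zero =>
    have h1 : cyclicCoideal c = ⊥ := Submodule.finrank_eq_zero.1 (Nat.le_zero.1 hd)
    have h2 := self_mem_cyclicCoideal (k := k) c
    rwa [h1] at h2
  | succ d ih =>
    by_cases hc : c = 0
    · rw [hc]; exact zero_mem _
    have hle : coradical k C ≤ cyclicCoideal c := by
      refine coradical_le h h0 (isRightCoideal_cyclicCoideal c) fun hb => hc ?_
      have h2 := self_mem_cyclicCoideal (k := k) c
      rwa [hb] at h2
    obtain ⟨x, hx, hx0⟩ := Submodule.exists_mem_ne_zero_of_ne_bot h0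
    -- The right hit by `a` maps the coideal of `c` onto that of `rightHit a c` and kills the
    -- nonzero subspace `C₀` of it, so the dimension drops.
    refine mem_coradFil_succ.2 fun a ha => ih _ ?_
    rw [cyclicCoideal_rightHit]
    have h1 := LinearMap.finrank_range_add_finrank_ker
      ((rightHit a.ofConv).domRestrict (cyclicCoideal c))
    have h2 : 0 < Module.finrank k (ker ((rightHit a.ofConv).domRestrict (cyclicCoideal c))) := by
      rw [Module.finrank_pos_iff_exists_ne_zero]
      refine ⟨⟨⟨x, hle hx⟩, ?_⟩, fun hn => hx0 ?_⟩
      · exact rightHit_eq_zero isRightCoideal_coradical ha hx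
      · exact congrArg (fun z => z.1.1) hn
    rw [LinearMap.range_domRestrict] at h1
    omega

theorem exists_mem_coradFil (h : IsChainCoalgebra k C) (h0 : coradical k C ≠ ⊥) (c : C) :
    ∃ n, c ∈ coradFil k C n :=
  ⟨_, mem_coradFil_of_finrank_le h h0 _ c le_rfl⟩

/-- In a chain coalgebra, there is no right coideal strictly between `C₀` and `C₁`. -/
theorem le_coradical_of_lt_coradFil_two (h : IsChainCoalgebra k C) (h0 : coradical k C ≠ ⊥)
    {N : Submodule k C} (hN : IsRightCoideal N) (hlt : N < coradFil k C 2) :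
    N ≤ coradical k C := by
  intro y hy
  rw [← coradFil_one, mem_coradFil_succ]
  intro a ha
  by_contra hne
  obtain ⟨c, hc, hcN⟩ := SetLike.exists_of_lt hlt
  have hmem : ∀ z ∈ coradFil k C 2, rightHit a.ofConv z ∈ coradical k C := by
    intro z hz
    rw [← coradFil_one]
    exact mem_coradFil_succ.1 hz a ha
  have hK := isRightCoideal_comap a.ofConv (isRightCoideal_coradFil 2)
    (isRightCoideal_coradFil (k := k) (C := C) 0)
  -- The kernel of `rightHit a` on `C₁` is a right coideal not containing `y`, so the chain
  -- condition puts it inside the coideal generated by `y`.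
  have hKN : coradFil k C 2 ⊓ (coradFil k C 0).comap (rightHit a.ofConv) ≤ N := by
    rcases h _ _ hK (isRightCoideal_cyclicCoideal y) with h1 | h1
    · exact h1.trans (cyclicCoideal_le hN hy)
    · exact absurd (h1 (self_mem_cyclicCoideal y)).2 hne
  have hle : coradical k C ≤ cyclicCoideal (rightHit a.ofConv y) :=
    coradical_le h h0 (isRightCoideal_cyclicCoideal _) fun hb => hne (by
      have h2 := self_mem_cyclicCoideal (k := k) (rightHit a.ofConv y)
      rwa [hb] at h2)
  -- Both `c` and `y` are sent into `C₀`, which is contained in the coideal of `rightHit a y`. So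
  -- `c` has the same image as some `leftHit g y` in `N`, and the two differ by a kernel element,
  -- again in `N`.
  obtain ⟨g, hg⟩ := mem_cyclicCoideal.1 (hle (hmem c hc))
  have h3 : leftHit g y ∈ N := isRightCoideal_iff.1 hN y hy g
  have h4 : c - leftHit g y ∈ N := by
    refine hKN ⟨sub_mem hc (hlt.le h3), ?_⟩
    have := leftHit_rightHit (toConv g) a y
    change rightHit a.ofConv (c - leftHit g y) = 0
    rw [map_sub, sub_eq_zero, ← hg]
    exact this
  exact hcN (by simpa using add_mem h4 h3)

end ChainStructure

/-! ### Lifting algebra maps from a separable algebra along a complete filtration. -/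

section Lifting

variable {k D A : Type*} [Field k] [Ring D] [Algebra k D] [Ring A] [Algebra k A]
  {ι : Type*} [Fintype ι] (x y : ι → D) (s : D →ₗ[k] A)

/-- The failure of a linear map to be multiplicative. -/
def multDefect : D →ₗ[k] D →ₗ[k] A :=
  (LinearMap.mul k A).compl₁₂ s s - (LinearMap.mul k D).compr₂ s

@[simp] theorem multDefect_apply (a b : D) : multDefect s a b = s a * s b - s (a * b) := by
  simp [multDefect]

/-- The correction of a linear map by means of a separability system. -/
def multCorrection : D →ₗ[k] A :=
  ∑ i, LinearMap.mulLeft k (s (x i)) ∘ₗ multDefect s (y i)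

theorem multCorrection_apply (a : D) :
    multCorrection x y s a = ∑ i, s (x i) * multDefect s (y i) a := by
  simp [multCorrection, LinearMap.sum_apply]

variable {x y}

/-- The separability element commutes with `D`; this form of the hypothesis can be applied inside
any bilinear expression. -/
theorem sum_bilin (hxy : ∀ a : D, ∑ i, (a * x i) ⊗ₜ[k] y i = ∑ i, x i ⊗ₜ[k] (y i * a))
    {V : Type*} [AddCommGroup V] [Module k V] (B : D →ₗ[k] D →ₗ[k] V) (a : D) :
    ∑ i, B (a * x i) (y i) = ∑ i, B (x i) (y i * a) := by
  simpa using congrArg (TensorProduct.lift B) (hxy a)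

/-- The defect satisfies the Hochschild 2-cocycle identity and the separability system gives a
contracting homotopy. Thus the terms linear in the defect cancel, and every surviving term is a
product of two small factors. -/
theorem multDefect_sub_multCorrection
    (hxy : ∀ a : D, ∑ i, (a * x i) ⊗ₜ[k] y i = ∑ i, x i ⊗ₜ[k] (y i * a))
    (h1 : ∑ i, x i * y i = 1) (a b : D) :
    multDefect (s - multCorrection x y s) a b =
      multCorrection x y s a * multCorrection x y s b -
        ∑ i, multDefect s a (x i) * multDefect s (y i) b -
        (∑ i, multDefect s (x i) (y i)) * multDefect s a b - (s 1 - 1) * multDefect s a b := by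
  have e1 : ∑ i, s (x i) * multDefect s (y i * a) b =
      ∑ i, s (a * x i) * multDefect s (y i) b :=
    (sum_bilin hxy ((LinearMap.mul k A).compl₁₂ s ((multDefect s).flip b)) a).symm
  -- With `δ` the defect, this is the cocycle identity `δ(y, ab) + s(y) δ(a, b) = δ(y, a) s(b) +
  -- δ(ya, b)`, multiplied by `s(x)` and summed.
  have e2 : multCorrection x y s (a * b) = multCorrection x y s a * s b +
      ∑ i, s (x i) * multDefect s (y i * a) b -
      (∑ i, s (x i) * s (y i)) * multDefect s a b := by
    simp only [multCorrection_apply, Finset.sum_mul, ← Finset.sum_add_distrib,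
      ← Finset.sum_sub_distrib]
    refine Finset.sum_congr rfl fun i _ => ?_
    simp only [multDefect_apply, ← mul_assoc]
    noncomm_ring
  have e3 : ∑ i, s (a * x i) * multDefect s (y i) b = s a * multCorrection x y s b -
      ∑ i, multDefect s a (x i) * multDefect s (y i) b := by
    simp only [multCorrection_apply, Finset.mul_sum, ← Finset.sum_sub_distrib]
    refine Finset.sum_congr rfl fun i _ => ?_
    simp only [multDefect_apply]
    noncomm_ring
  have e4 : ∑ i, s (x i) * s (y i) = ∑ i, multDefect s (x i) (y i) + s 1 := by
    rw [← h1, map_sum, ← Finset.sum_add_distrib]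
    simp
  have e5 : multDefect (s - multCorrection x y s) a b = multDefect s a b -
      s a * multCorrection x y s b - multCorrection x y s a * s b +
      multCorrection x y s a * multCorrection x y s b + multCorrection x y s (a * b) := by
    simp only [multDefect_apply, LinearMap.sub_apply]
    noncomm_ring
  rw [e5, e2, e1, e3, e4]
  noncomm_ring

variable (I : ℕ → AddSubgroup A) (h0 : ∀ a, a ∈ I 0) (hanti : Antitone I)
  (hmul : ∀ {m n : ℕ} {a b : A}, a ∈ I m → b ∈ I n → a * b ∈ I (m + n))

include h0 hmul

theorem multCorrection_mem {n : ℕ} (hs : ∀ a b, multDefect s a b ∈ I n) (a : D) :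
    multCorrection x y s a ∈ I n := by
  rw [multCorrection_apply]
  refine sum_mem fun i _ => ?_
  have := hmul (h0 (s (x i))) (hs (y i) a)
  rwa [zero_add] at this

include hanti

/-- Terms quadratic in the defect gain a factor `I n`, but the term with `s 1 - 1` gains only `I 1`;
so each correction is guaranteed just one more step of precision. -/
theorem multDefect_sub_multCorrection_mem
    (hxy : ∀ a : D, ∑ i, (a * x i) ⊗ₜ[k] y i = ∑ i, x i ⊗ₜ[k] (y i * a))
    (h1 : ∑ i, x i * y i = 1) {n : ℕ} (hn : 1 ≤ n) (hs1 : s 1 - 1 ∈ I 1)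
    (hs : ∀ a b, multDefect s a b ∈ I n) (a b : D) :
    multDefect (s - multCorrection x y s) a b ∈ I (n + 1) := by
  have hc := multCorrection_mem (x := x) (y := y) s I h0 hmul hs
  have hle : I (n + n) ≤ I (n + 1) := hanti (by omega)
  rw [multDefect_sub_multCorrection s hxy h1]
  refine sub_mem (sub_mem (sub_mem (hle (hmul (hc a) (hc b))) ?_) ?_) ?_
  · exact sum_mem fun i _ => hle (hmul (hs _ _) (hs _ _))
  · exact hle (hmul (sum_mem fun i _ => hs _ _) (hs a b))
  · have := hmul hs1 (hs a b)
    rwa [add_comm] at this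

/-- Algebra maps out of a separable algebra lift along complete filtrations. -/
theorem exists_algHom_lift
    (hxy : ∀ a : D, ∑ i, (a * x i) ⊗ₜ[k] y i = ∑ i, x i ⊗ₜ[k] (y i * a))
    (h1 : ∑ i, x i * y i = 1)
    (hsep : ∀ a : A, (∀ n, a ∈ I (n + 1)) → a = 0)
    (hcomplete : ∀ u : ℕ → A, (∀ n, u (n + 1) - u n ∈ I (n + 1)) →
      ∃ a, ∀ n, a - u n ∈ I (n + 1))
    (hs1 : s 1 - 1 ∈ I 1) (hs : ∀ a b, multDefect s a b ∈ I 1) :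
    ∃ σ : D →ₐ[k] A, ∀ d, σ d - s d ∈ I 1 := by
  have hle : ∀ n, I (n + 1) ≤ I 1 := fun n => hanti (by omega)
  -- Successive approximation: each round subtracts the correction, and the unit stays correct
  -- modulo `I 1`.
  let S : ℕ → (D →ₗ[k] A) := fun n => (fun t => t - multCorrection x y t)^[n] s
  have hS : ∀ n, S (n + 1) = S n - multCorrection x y (S n) := fun n =>
    Function.iterate_succ_apply' (fun t => t - multCorrection x y t) n s
  have key : ∀ n, S n 1 - 1 ∈ I 1 ∧ ∀ a b, multDefect (S n) a b ∈ I (n + 1) := by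
    intro n
    induction n with
    | zero => exact ⟨hs1, hs⟩
    | succ n ih =>
      rw [hS]
      refine ⟨?_, multDefect_sub_multCorrection_mem (S n) I h0 hanti hmul hxy h1 (by omega)
        ih.1 ih.2⟩
      rw [LinearMap.sub_apply, sub_right_comm]
      exact sub_mem ih.1 (hle n (multCorrection_mem (S n) I h0 hmul ih.2 1))
  have hstep : ∀ d n, S (n + 1) d - S n d ∈ I (n + 1) := by
    intro d n
    rw [hS, LinearMap.sub_apply, sub_sub_cancel_left]
    exact neg_mem (multCorrection_mem (S n) I h0 hmul (key n).2 d)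
  choose σ hσ using fun d => hcomplete (fun n => S n d) (hstep d)
  have hz : ∀ n (a b : A), b ∈ I n → a * b ∈ I n := fun n a b hb => by
    have := hmul (h0 a) hb
    rwa [zero_add] at this
  have hz' : ∀ n (a b : A), a ∈ I n → a * b ∈ I n := fun n a b ha => by
    have := hmul ha (h0 b)
    rwa [add_zero] at this
  -- For this and the next identities, the failure of `σ` agrees with that of `S n` modulo `I (n +
  -- 1)` for every `n`, hence is zero by separatedness.
  have hadd : ∀ a b, σ (a + b) = σ a + σ b := fun a b => by
    rw [← sub_eq_zero]
    refine hsep _ fun n => ?_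
    have := sub_mem (sub_mem (hσ (a + b) n) (hσ a n)) (hσ b n)
    rw [map_add] at this
    convert this using 1
    abel
  have hsmul : ∀ (r : k) a, σ (r • a) = r • σ a := fun r a => by
    rw [← sub_eq_zero]
    refine hsep _ fun n => ?_
    have := sub_mem (hσ (r • a) n) (hz _ (algebraMap k A r) _ (hσ a n))
    rw [map_smul, ← Algebra.smul_def, smul_sub] at this
    convert this using 1
    abel
  have hmul' : ∀ a b, σ (a * b) = σ a * σ b := fun a b => by
    rw [← sub_eq_zero]
    refine hsep _ fun n => ?_
    have h2 := (key n).2 a b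
    rw [multDefect_apply] at h2
    have := sub_mem (sub_mem (sub_mem (hσ (a * b) n) h2) (hz' _ _ (σ b) (hσ a n)))
      (hz _ (S n a) _ (hσ b n))
    convert this using 1
    noncomm_ring
  -- The element `1 - σ 1` is an idempotent in `I 1`, so it equals all its powers and lies in every
  -- `I (n + 1)`.
  have hone : σ 1 = 1 := by
    have hmem : 1 - σ 1 ∈ I 1 := by
      have := neg_mem (add_mem (hσ 1 0) hs1)
      convert this using 1
      simp [S]
    have hpow : ∀ n, 1 - σ 1 ∈ I (n + 1) := by
      intro n
      induction n with
      | zero => exact hmem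
      | succ n ih =>
        have := hmul ih hmem
        have h2 : (1 - σ 1) * (1 - σ 1) = 1 - σ 1 := by
          have := hmul' 1 1
          rw [mul_one] at this
          rw [sub_mul, mul_sub, mul_sub, ← this]
          noncomm_ring
        rwa [h2] at this
    exact (sub_eq_zero.1 (hsep _ hpow)).symm
  refine ⟨AlgHom.ofLinearMap ⟨⟨σ, hadd⟩, hsmul⟩ hone hmul', fun d => ?_⟩
  exact hσ d 0

end Lifting

/-! ### Completeness of the dual algebra and the algebra section of its residue algebra. -/

section ChainSection

variable {k C : Type*} [Field k] [AddCommGroup C] [Module k C] [Coalgebra k C]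

theorem eq_zero_of_mem_perp_coradFil (hex : ∀ c : C, ∃ n, c ∈ coradFil k C n)
    {a : DualAlgebra k C} (ha : ∀ n, a ∈ perp (coradFil k C (n + 1))) : a = 0 := by
  apply WithConv.ext
  ext c
  obtain ⟨n, hn⟩ := hex c
  exact ha n c (coradFil_mono (Nat.le_succ n) hn)

/-- The algebra dual to a coalgebra with exhaustive coradical filtration is complete. -/
theorem exists_limit_perp_coradFil (hex : ∀ c : C, ∃ n, c ∈ coradFil k C n)
    (u : ℕ → DualAlgebra k C) (hu : ∀ n, u (n + 1) - u n ∈ perp (coradFil k C (n + 1))) :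
    ∃ a, ∀ n, a - u n ∈ perp (coradFil k C (n + 1)) := by
  have hex' : ∀ c : C, ∃ n, c ∈ coradFil k C (n + 1) := fun c =>
    (hex c).imp fun n hn => coradFil_mono (Nat.le_succ n) hn
  have hle : ∀ (c : C) (m n : ℕ), m ≤ n → c ∈ coradFil k C (m + 1) → u n c = u m c := by
    intro c m n hmn hc
    induction n, hmn using Nat.le_induction with
    | base => rfl
    | succ n hmn ih =>
      rw [← ih]
      exact sub_eq_zero.1 (hu n c (coradFil_mono (by omega) hc))
  choose N hN using hex'
  have heq : ∀ (c : C) (n : ℕ), c ∈ coradFil k C (n + 1) → u (N c) c = u n c := fun c n hc => by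
    rcases le_total (N c) n with h | h
    · exact (hle c _ _ h (hN c)).symm
    · exact hle c _ _ h hc
  -- The limit is taken pointwise: once `c` lies in `coradFil k C (N c + 1)`, the values `u n c` no
  -- longer change for `n ≥ N c`.
  refine ⟨toConv
    { toFun := fun c => u (N c) c
      map_add' := fun c c' => ?_
      map_smul' := fun r c => ?_ }, fun n c hc => ?_⟩
  · have h1 : c ∈ coradFil k C (max (N c) (N c') + 1) := coradFil_mono (by omega) (hN c)
    have h2 : c' ∈ coradFil k C (max (N c) (N c') + 1) := coradFil_mono (by omega) (hN c')
    rw [heq _ _ h1, heq _ _ h2, heq _ _ (add_mem h1 h2), map_add]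
  · rw [heq _ _ (Submodule.smul_mem _ r (hN c)), map_smul, RingHom.id_apply]
  · exact sub_eq_zero.2 (heq c n hc)

variable (k C) in
/-- The restriction of functionals to the coradical. -/
def restrictCoradical : DualAlgebra k C →ₐ[k] WithConv (coradical k C →ₗ[k] k) :=
  AlgHom.ofLinearMap
    { toFun := fun a => toConv (a.ofConv ∘ₗ (coradical k C).subtype)
      map_add' := fun _ _ => rfl
      map_smul' := fun _ _ => rfl } rfl fun a b => by
    apply WithConv.ext
    ext x
    change (a * b).ofConv x.1 = _
    rw [convMul_apply, convMul_apply, ← subComul_apply isSubcoalgebra_coradical]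
    change _ = mul' k k (TensorProduct.map (a.ofConv ∘ₗ (coradical k C).subtype)
      (b.ofConv ∘ₗ (coradical k C).subtype) (subComul isSubcoalgebra_coradical x))
    rw [TensorProduct.map_comp]
    rfl

theorem restrictCoradical_eq_zero_iff (a : DualAlgebra k C) :
    restrictCoradical k C a = 0 ↔ a ∈ perp (coradical k C) := by
  refine ⟨fun h c hc => ?_, fun h => WithConv.ext (LinearMap.ext fun x => h x.1 x.2)⟩
  exact LinearMap.congr_fun (congrArg ofConv h) ⟨c, hc⟩

theorem restrictCoradical_surjective : Function.Surjective (restrictCoradical k C) := by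
  intro f
  obtain ⟨g, hg⟩ := f.ofConv.exists_extend
  exact ⟨toConv g, WithConv.ext hg⟩

theorem IsSeparableAlgebra.exists_system {D : Type*} [Ring D] [Algebra k D]
    (h : IsSeparableAlgebra k D) : ∃ (n : ℕ) (x y : Fin n → D),
      (∀ a : D, ∑ i, (a * x i) ⊗ₜ[k] y i = ∑ i, x i ⊗ₜ[k] (y i * a)) ∧ ∑ i, x i * y i = 1 := by
  obtain ⟨e, h1, h2⟩ := h
  obtain ⟨n, x, y, rfl⟩ := TensorProduct.exists_sum_tmul_eq e
  refine ⟨n, x, y, fun a => ?_, ?_⟩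
  · simpa using h2 a
  · simpa using h1

variable {D : Type*} [DivisionRing D] [Algebra k D]

theorem coradical_ne_bot (e : WithConv (coradical k C →ₗ[k] k) ≃ₐ[k] D) :
    coradical k C ≠ ⊥ := by
  intro h
  have : (1 : WithConv (coradical k C →ₗ[k] k)) = 0 := by
    apply WithConv.ext
    ext x
    have hx : x = 0 := Subtype.ext ((Submodule.mem_bot k).1 (h ▸ x.2))
    rw [hx, map_zero, map_zero]
  have h1 := congrArg e this
  rw [map_one, map_zero] at h1
  exact one_ne_zero h1

/-- A chain coalgebra of separable type: `D` lifts to the dual algebra. -/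
theorem exists_algHom_section (hC : IsChainCoalgebra k C)
    (e : WithConv (coradical k C →ₗ[k] k) ≃ₐ[k] D) (hD : IsSeparableAlgebra k D) :
    ∃ (r : DualAlgebra k C →ₐ[k] D) (s : D →ₐ[k] DualAlgebra k C),
      (∀ a, r a = 0 ↔ a ∈ perp (coradical k C)) ∧ ∀ d, r (s d) = d := by
  obtain ⟨n, x, y, hxy, h1⟩ := hD.exists_system
  have hex := exists_mem_coradFil hC (coradical_ne_bot e)
  let r : DualAlgebra k C →ₐ[k] D := e.toAlgHom.comp (restrictCoradical k C)
  have hr : ∀ a, r a = 0 ↔ a ∈ perp (coradical k C) := fun a => by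
    rw [← restrictCoradical_eq_zero_iff]
    exact map_eq_zero_iff e e.injective
  have hsurj : Function.Surjective r := e.surjective.comp restrictCoradical_surjective
  -- Any linear section is unital and multiplicative modulo the kernel of `r`, which is level one of
  -- the filtration; that is all the lifting theorem requires.
  obtain ⟨s, hs⟩ := LinearMap.exists_rightInverse_of_surjective r.toLinearMap
    (LinearMap.range_eq_top.2 hsurj)
  have hs' : ∀ d, r (s d) = d := fun d => LinearMap.congr_fun hs d
  have hI : ∀ a, a ∈ perp (coradFil k C 1) ↔ r a = 0 := fun a => by rw [hr, coradFil_one]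
  obtain ⟨σ, hσ⟩ := exists_algHom_lift s (fun n => perp (coradFil k C n)) mem_perp_coradFil_zero
    (fun m n h => perp_anti (coradFil_mono h)) mul_mem_perp_coradFil hxy h1
    (fun a => eq_zero_of_mem_perp_coradFil hex) (exists_limit_perp_coradFil hex)
    (by rw [hI, map_sub, hs', map_one, sub_self])
    (fun a b => by rw [hI, multDefect_apply, map_sub, map_mul, hs', hs', hs', sub_self])
  refine ⟨r, σ, hr, fun d => ?_⟩
  have := (hI _).1 (hσ d)
  rwa [map_sub, hs', sub_eq_zero] at this

/-! ### A normalised generator of the radical. -/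

section Generator

variable (hC : IsChainCoalgebra k C) (h0 : coradical k C ≠ ⊥)
  {r : DualAlgebra k C →ₐ[k] D} {s : D →ₐ[k] DualAlgebra k C}
  (hr : ∀ a, r a = 0 ↔ a ∈ perp (coradical k C)) (hrs : ∀ d, r (s d) = d)

include hr hrs

theorem sub_section_mem (a : DualAlgebra k C) : a - s (r a) ∈ perp (coradFil k C 1) := by
  rw [coradFil_one, ← hr, map_sub, hrs, sub_self]

variable [FiniteDimensional k D]

include hC h0

/-- Modulo the square of the radical, the radical of the dual algebra is generated as a right
`D`-module by any of its elements outside the square. -/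
theorem exists_sub_mul_section_mem {j : DualAlgebra k C} (hj : j ∈ perp (coradical k C))
    (hj2 : j ∉ perp (coradFil k C 2)) {b : DualAlgebra k C} (hb : b ∈ perp (coradical k C)) :
    ∃ d, b - j * s d ∈ perp (coradFil k C 2) := by
  have hj1 : j ∈ perp (coradFil k C 1) := by rwa [coradFil_one]
  let Λ : D →ₗ[k] (coradFil k C 2 →ₗ[k] k) :=
    { toFun := fun d => (j * s d).ofConv ∘ₗ (coradFil k C 2).subtype
      map_add' := fun a b => by rw [map_add, mul_add]; rfl
      map_smul' := fun t a => by rw [map_smul, mul_smul_comm]; rfl }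
  -- The part of `C₁` annihilated by the right ideal generated by `j`. It is a right coideal, and it
  -- is proper since `j` does not vanish on `C₁`, so it lies in `C₀`, where `b` vanishes.
  let N : Submodule k C := coradFil k C 2 ⊓ ⨅ a : DualAlgebra k C, ker (j * a).ofConv
  have hN : IsRightCoideal N := by
    rw [isRightCoideal_iff]
    intro c hc g
    refine ⟨isRightCoideal_iff.1 (isRightCoideal_coradFil 2) c hc.1 g,
      (Submodule.mem_iInf _).2 fun a => ?_⟩
    have h1 := (Submodule.mem_iInf _).1 hc.2 (a * toConv g)
    rw [LinearMap.mem_ker, ← mul_assoc, mul_apply_leftHit] at h1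
    exact h1
  have hlt : N < coradFil k C 2 := by
    refine lt_of_le_of_ne inf_le_left fun hN2 => hj2 fun c hc => ?_
    rw [← hN2] at hc
    have h1 := (Submodule.mem_iInf _).1 hc.2 1
    rwa [LinearMap.mem_ker, mul_one] at h1
  have hNC := le_coradical_of_lt_coradFil_two hC h0 hN hlt
  let β := Module.finBasis k D
  -- Finite-dimensional duality: `b` on `C₁` is a combination of the functionals `j * s (β i)` as
  -- soon as it vanishes on their common kernel. That kernel lies in `N`, because `j * a` and `j * s
  -- (r a)` agree on `C₁`.
  have hmem : b.ofConv ∘ₗ (coradFil k C 2).subtype ∈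
      Submodule.span k (Set.range fun i => Λ (β i)) := by
    refine mem_span_of_iInf_ker_le_ker fun c hc => ?_
    have hc' : ∀ d, Λ d c = 0 := by
      intro d
      have : LinearMap.applyₗ c ∘ₗ Λ = 0 := β.ext fun i => (Submodule.mem_iInf _).1 hc i
      exact LinearMap.congr_fun this d
    refine hb _ (hNC ⟨c.2, (Submodule.mem_iInf _).2 fun a => ?_⟩)
    have h1 := mul_mem_perp_coradFil hj1 (sub_section_mem hr hrs a) c.1 c.2
    rw [mul_sub, ofConv_sub, LinearMap.sub_apply, sub_eq_zero] at h1
    exact h1.trans (hc' (r a))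
  have hle : Submodule.span k (Set.range fun i => Λ (β i)) ≤ range Λ :=
    Submodule.span_le.2 (by rintro _ ⟨i, rfl⟩; exact ⟨β i, rfl⟩)
  obtain ⟨d, hd⟩ := hle hmem
  refine ⟨d, fun c hc => ?_⟩
  have := LinearMap.congr_fun hd ⟨c, hc⟩
  exact sub_eq_zero.2 this.symm

/-- The bimodule of generators of the radical of the dual algebra. -/
theorem exists_generator (hD : IsSeparableAlgebra k D) :
    ∃ (m : DualAlgebra k C) (τ : D →ₐ[k] D), m ∈ perp (coradical k C) ∧
      (∀ a, s a * m = m * s (τ a)) ∧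
      ∀ b ∈ perp (coradical k C), ∃ d, b - m * s d ∈ perp (coradFil k C 2) := by
  by_cases hJ : ∀ j ∈ perp (coradical k C), j ∈ perp (coradFil k C 2)
  -- If the radical vanishes on `C₁`, there is nothing to generate: `m = 0` works with the untwisted
  -- bimodule.
  · refine ⟨0, AlgHom.id k D, zero_mem _, fun a => by rw [mul_zero, zero_mul], fun b hb => ⟨0, ?_⟩⟩
    rw [zero_mul, sub_zero]
    exact hJ b hb
  push Not at hJ
  obtain ⟨j, hj, hj2⟩ := hJ
  obtain ⟨n, x, y, hxy, h1⟩ := hD.exists_system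
  have hgen := fun b hb => exists_sub_mul_section_mem hC h0 hr hrs hj hj2 (b := b) hb
  -- A nonzero difference is invertible in `D`, and multiplying by its inverse would put `j` itself
  -- in the annihilator of `C₁`. This uniqueness makes `τ`, chosen below by `s d * j ≡ j * s (τ d)`,
  -- an algebra map.
  have huniq : ∀ {d d' : D}, j * s d - j * s d' ∈ perp (coradFil k C 2) → d = d' := by
    intro d d' h
    by_contra hne
    apply hj2
    have h2 := mul_mem_perp h (s (d - d')⁻¹)
    rwa [← mul_sub, ← map_sub, mul_assoc, ← map_mul, mul_inv_cancel₀ (sub_ne_zero.2 hne), map_one,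
      mul_one] at h2
  choose τ hτ using fun d => hgen (s d * j) (mul_mem_perp_coradical (s d) hj)
  have hτadd : ∀ a b, τ (a + b) = τ a + τ b := fun a b => huniq (by
    have := sub_mem (add_mem (hτ a) (hτ b)) (hτ (a + b))
    convert this using 1
    rw [map_add, map_add, mul_add, add_mul]
    abel)
  have hτsmul : ∀ (t : k) a, τ (t • a) = t • τ a := fun t a => huniq (by
    have := sub_mem (mul_mem_perp_left (algebraMap k _ t) (hτ a)) (hτ (t • a))
    convert this using 1
    rw [map_smul, map_smul, ← Algebra.smul_def, smul_sub, smul_mul_assoc, mul_smul_comm]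
    abel)
  have hτone : τ 1 = 1 := huniq (by
    have := neg_mem (hτ 1)
    convert this using 1
    rw [map_one, one_mul, mul_one, neg_sub])
  have hτmul : ∀ a b, τ (a * b) = τ a * τ b := fun a b => huniq (by
    have := sub_mem (add_mem (mul_mem_perp_left (s a) (hτ b)) (mul_mem_perp (hτ a) (s (τ b))))
      (hτ (a * b))
    convert this using 1
    rw [map_mul, map_mul]
    simp only [mul_sub, sub_mul, mul_assoc]
    abel)
  let T : D →ₐ[k] D := AlgHom.ofLinearMap ⟨⟨τ, hτadd⟩, hτsmul⟩ hτone hτmul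
  have hT : ∀ d, s d * j - j * s (T d) ∈ perp (coradFil k C 2) := hτ
  have hmj : ∑ i, s (x i) * j * s (T (y i)) - j ∈ perp (coradFil k C 2) := by
    have e1 : j = ∑ i, j * s (T (x i)) * s (T (y i)) := by
      simp only [mul_assoc, ← map_mul, ← Finset.mul_sum, ← map_sum]
      rw [h1, map_one, map_one, mul_one]
    conv =>
      enter [2, 2]
      rw [e1]
    rw [← Finset.sum_sub_distrib]
    refine sum_mem fun i _ => ?_
    rw [← sub_mul]
    exact mul_mem_perp (hT _) _
  -- Averaging over the separability system makes the commutation rule exact, while `hmj` shows that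
  -- the generator modulo the annihilator of `C₁` is unchanged.
  refine ⟨∑ i, s (x i) * j * s (T (y i)), T, ?_, fun a => ?_, fun b hb => ?_⟩
  · refine sum_mem fun i _ => ?_
    exact mul_mem_perp_right isRightCoideal_coradical (mul_mem_perp_coradical _ hj) _
  · have := sum_bilin hxy ((LinearMap.mul k (DualAlgebra k C)).compl₁₂
      (LinearMap.mulRight k j ∘ₗ s.toLinearMap) (s.toLinearMap ∘ₗ T.toLinearMap)) a
    simp only [LinearMap.compl₁₂_apply, LinearMap.comp_apply, AlgHom.toLinearMap_apply,
      LinearMap.mulRight_apply, LinearMap.mul_apply', map_mul] at this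
    rw [Finset.mul_sum, Finset.sum_mul]
    simpa only [mul_assoc] using this
  · obtain ⟨d, hd⟩ := hgen b hb
    refine ⟨d, ?_⟩
    have := sub_mem hd (mul_mem_perp hmj (s d))
    convert this using 1
    rw [sub_mul]
    abel

end Generator

end ChainSection

open Bicomodule

namespace CotensorCoalgebra

/-! ### Homogeneous projections of the cotensor coalgebra. -/

section Projections

variable {k C M : Type*} [Field k] [AddCommGroup C] [Module k C] [Coalgebra k C]
  [AddCommGroup M] [Module k M] [Bicomodule k C M]

variable (k C M) in
/-- The projection of the cotensor coalgebra onto `C`. -/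
def projC : CotensorCoalgebra k C M →ₗ[k] C := LinearMap.fst k C _

variable (k C M) in
/-- The projection of the cotensor coalgebra onto the cotensor power with `n + 1` factors. -/
def projPow (n : ℕ) : CotensorCoalgebra k C M →ₗ[k] (cotensorPow k C M n).carrier :=
  DirectSum.component k ℕ (fun n => (cotensorPow k C M n).carrier) n ∘ₗ LinearMap.snd k C _

theorem projC_ofC (c : C) : projC k C M (ofC k C M c) = c := rfl

theorem projC_ofPow (n : ℕ) (x : (cotensorPow k C M n).carrier) :
    projC k C M (ofPow k C M n x) = 0 := rfl

theorem projPow_ofC (n : ℕ) (c : C) : projPow k C M n (ofC k C M c) = 0 := rfl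

theorem projPow_ofPow_self (n : ℕ) (x : (cotensorPow k C M n).carrier) :
    projPow k C M n (ofPow k C M n x) = x :=
  DirectSum.component.lof_self (M := fun n => (cotensorPow k C M n).carrier) k n x

theorem projPow_ofPow_of_ne {m n : ℕ} (h : m ≠ n) (x : (cotensorPow k C M m).carrier) :
    projPow k C M n (ofPow k C M m x) = 0 := by
  have := DirectSum.component.of (M := fun n => (cotensorPow k C M n).carrier) k n m x
  rwa [dif_neg h] at this

theorem ofPow_injective (n : ℕ) : Function.Injective (ofPow k C M n) :=
  Function.LeftInverse.injective (projPow_ofPow_self n)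

theorem ofC_injective : Function.Injective (ofC k C M) :=
  Function.LeftInverse.injective (projC_ofC (M := M))

end Projections

/-! ### Coalgebra maps into the cotensor coalgebra from their components in degrees zero and one. -/

section Lift

variable {k : Type u} {E : Type v} {P : Type w} {C : Type*} [Field k] [AddCommGroup E]
  [Module k E] [Coalgebra k E] [AddCommGroup P] [Module k P] [Bicomodule k E P]
  [AddCommGroup C] [Module k C] [Coalgebra k C] (f₀ : C →ₗ[k] E) (f₁ : C →ₗ[k] P)

/-- Left colinearity of a map from `C` along a map `f₀ : C → E`. -/
def IsColinearAlong (X : LeftComod.{u, v, w} k E) (f : C →ₗ[k] X.carrier) : Prop :=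
  ∀ c, X.coact (f c) = TensorProduct.map f₀ f (Coalgebra.comul (R := k) c)

variable {f₀}

theorem map_map_comul {U V W : Type*} [AddCommGroup U] [Module k U] [AddCommGroup V] [Module k V]
    [AddCommGroup W] [Module k W] (f : C →ₗ[k] U) (g : C →ₗ[k] V) (h : C →ₗ[k] W) (c : C) :
    TensorProduct.assoc k U V W
      (TensorProduct.map (TensorProduct.map f g ∘ₗ Coalgebra.comul) h
        (Coalgebra.comul (R := k) c)) =
    TensorProduct.map f (TensorProduct.map g h ∘ₗ Coalgebra.comul)
      (Coalgebra.comul (R := k) c) := by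
  rw [map_comp_left, map_map_assoc, Coalgebra.coassoc_apply, map_comp_right]

section Step

variable {X : LeftComod.{u, v, w} k E} {f : C →ₗ[k] X.carrier}

/-- By coassociativity, both coactions on the middle produce `∑ f₁(c₁) ⊗ f₀(c₂) ⊗ f(c₃)`. -/
theorem map_comul_mem_cotensor
    (hR : ∀ c, (coactR : P →ₗ[k] P ⊗[k] E) (f₁ c) =
      TensorProduct.map f₁ f₀ (Coalgebra.comul (R := k) c))
    (hf : IsColinearAlong f₀ X f) (c : C) :
    TensorProduct.map f₁ f (Coalgebra.comul (R := k) c) ∈ cotensor P X := by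
  have h1 : X.coact ∘ₗ f = TensorProduct.map f₀ f ∘ₗ Coalgebra.comul := LinearMap.ext hf
  have h2 : (coactR : P →ₗ[k] P ⊗[k] E) ∘ₗ f₁ = TensorProduct.map f₁ f₀ ∘ₗ Coalgebra.comul :=
    LinearMap.ext hR
  change X.coact.lTensor P _ = TensorProduct.assoc k P E X.carrier
    ((coactR : P →ₗ[k] P ⊗[k] E).rTensor X.carrier _)
  rw [lTensor_map, rTensor_map, h1, h2, map_map_comul]

variable (hR : ∀ c, (coactR : P →ₗ[k] P ⊗[k] E) (f₁ c) =
    TensorProduct.map f₁ f₀ (Coalgebra.comul (R := k) c))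

/-- The map `c ↦ ∑ f₁(c₁) □ f(c₂)`. -/
def cotensorLift (hf : IsColinearAlong f₀ X f) : C →ₗ[k] cotensor P X :=
  (TensorProduct.map f₁ f ∘ₗ Coalgebra.comul).codRestrict (cotensor P X)
    (map_comul_mem_cotensor f₁ hR hf)

theorem subtype_comp_cotensorLift (hf : IsColinearAlong f₀ X f) :
    (cotensor P X).subtype ∘ₗ cotensorLift f₁ hR hf =
      TensorProduct.map f₁ f ∘ₗ Coalgebra.comul := rfl

theorem isColinearAlong_cotensorLift
    (hL : ∀ c, (coactL : P →ₗ[k] E ⊗[k] P) (f₁ c) =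
      TensorProduct.map f₀ f₁ (Coalgebra.comul (R := k) c))
    (hf : IsColinearAlong f₀ X f) :
    IsColinearAlong f₀ (cotensorComod P X) (cotensorLift f₁ hR hf) := by
  intro c
  have h2 : (coactL : P →ₗ[k] E ⊗[k] P) ∘ₗ f₁ = TensorProduct.map f₀ f₁ ∘ₗ Coalgebra.comul :=
    LinearMap.ext hL
  apply lTensor_subtype_injective E (cotensor P X)
  refine (cotensorCoact_apply P X _).trans ?_
  rw [lTensor_map, subtype_comp_cotensorLift]
  change TensorProduct.assoc k E P X.carrier ((coactL : P →ₗ[k] E ⊗[k] P).rTensor X.carrier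
    (TensorProduct.map f₁ f (Coalgebra.comul (R := k) c))) = _
  rw [rTensor_map, h2, map_map_comul]

end Step

variable (hL : ∀ c, (coactL : P →ₗ[k] E ⊗[k] P) (f₁ c) =
    TensorProduct.map f₀ f₁ (Coalgebra.comul (R := k) c))
  (hR : ∀ c, (coactR : P →ₗ[k] P ⊗[k] E) (f₁ c) =
    TensorProduct.map f₁ f₀ (Coalgebra.comul (R := k) c))

/-- The maps `c ↦ ∑ f₁(c₁) □ ⋯ □ f₁(cₙ₊₁)`. -/
def powLiftAux : (n : ℕ) →
    {f : C →ₗ[k] (cotensorPow k E P n).carrier // IsColinearAlong f₀ (cotensorPow k E P n) f}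
  | 0 => ⟨f₁, hL⟩
  | n + 1 => ⟨cotensorLift f₁ hR (powLiftAux n).2, isColinearAlong_cotensorLift f₁ hR hL _⟩

/-- The map `c ↦ ∑ f₁(c₁) □ ⋯ □ f₁(cₙ₊₁)`. -/
def powLift (n : ℕ) : C →ₗ[k] (cotensorPow k E P n).carrier := (powLiftAux f₁ hL hR n).1

theorem powLift_colinear (n : ℕ) :
    IsColinearAlong f₀ (cotensorPow k E P n) (powLift f₁ hL hR n) := (powLiftAux f₁ hL hR n).2

theorem subtype_powLift_succ (n : ℕ) (c : C) :
    (cotensor P (cotensorPow k E P n)).subtype (powLift f₁ hL hR (n + 1) c) =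
      TensorProduct.map f₁ (powLift f₁ hL hR n) (Coalgebra.comul (R := k) c) := rfl

/-- The homogeneous components of the map to the cotensor coalgebra. -/
def gradedLift : ℕ → (C →ₗ[k] CotensorCoalgebra k E P)
  | 0 => ofC k E P ∘ₗ f₀
  | n + 1 => ofPow k E P n ∘ₗ powLift f₁ hL hR n

/-- Cutting `∑ f₁(c₁) □ ⋯ □ f₁(cₙ₊₁)` after `i + 1` factors leaves `n - i` of them on the right; for
`i = n` that is degree zero, where right colinearity of `f₁` supplies `f₀`. -/
theorem split_powLift : ∀ (n i : ℕ) (_ : i ≤ n) (c : C),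
    split k E P n i (powLift f₁ hL hR n c) =
      TensorProduct.map (powLift f₁ hL hR i) (gradedLift f₁ hL hR (n - i))
        (Coalgebra.comul (R := k) c)
  | 0, 0, _, c => by
    have h := congrArg ((ofC k E P).lTensor P) (hR c)
    rw [lTensor_map] at h
    exact h
  | n + 1, 0, _, c => by
    have h := congrArg ((ofPow k E P n).lTensor P) (subtype_powLift_succ f₁ hL hR n c)
    rw [lTensor_map] at h
    exact h
  | n + 1, i + 1, hi, c => by
    rw [Nat.add_sub_add_right]
    apply split_aux_injective (cotensorPow k E P i)
    have h0 := cotensorMap_apply P (split k E P n i) (split_colinear n i)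
      (powLift f₁ hL hR (n + 1) c)
    refine h0.trans ?_
    have h1 : split k E P n i ∘ₗ powLift f₁ hL hR n =
        TensorProduct.map (powLift f₁ hL hR i) (gradedLift f₁ hL hR (n - i)) ∘ₗ
          Coalgebra.comul := LinearMap.ext (split_powLift n i (by omega))
    have h2 := congrArg ((split k E P n i).lTensor P) (subtype_powLift_succ f₁ hL hR n c)
    rw [lTensor_map, h1, ← map_map_comul] at h2
    exact h2.trans (congrArg (TensorProduct.assoc k P _ _)
      (rTensor_map (cotensor P (cotensorPow k E P i)).subtype
        (cotensorLift f₁ hR (powLift_colinear f₁ hL hR i)) _ _).symm)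

theorem comul_gradedLift_succ (n i : ℕ) (hi : i ≤ n) (c : C) :
    TensorProduct.map (gradedLift f₁ hL hR (i + 1)) (gradedLift f₁ hL hR (n - i))
      (Coalgebra.comul (R := k) c) =
    (ofPow k E P i).rTensor _ (split k E P n i (powLift f₁ hL hR n c)) := by
  rw [split_powLift _ _ _ _ _ hi, rTensor_map]
  rfl

theorem map_gradedLift_zero_succ (n : ℕ) (c : C) :
    TensorProduct.map (gradedLift f₁ hL hR 0) (gradedLift f₁ hL hR (n + 1))
      (Coalgebra.comul (R := k) c) =
    TensorProduct.map (ofC k E P) (ofPow k E P n)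
      ((cotensorPow k E P n).coact (powLift f₁ hL hR n c)) := by
  rw [powLift_colinear f₁ hL hR n c]
  exact LinearMap.congr_fun (TensorProduct.map_comp _ _ _ _) _

variable (hf₀ : ∀ c, Coalgebra.comul (R := k) (f₀ c) =
    TensorProduct.map f₀ f₀ (Coalgebra.comul (R := k) c))

include hf₀ in
theorem map_gradedLift_zero_zero (c : C) :
    TensorProduct.map (gradedLift f₁ hL hR 0) (gradedLift f₁ hL hR 0)
      (Coalgebra.comul (R := k) c) =
    TensorProduct.map (ofC k E P) (ofC k E P) (Coalgebra.comul (R := k) (f₀ c)) := by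
  rw [hf₀]
  exact LinearMap.congr_fun (TensorProduct.map_comp _ _ _ _) _

include hf₀ in
theorem comul_gradedLift (n : ℕ) (c : C) :
    Coalgebra.comul (R := k) (gradedLift f₁ hL hR n c) =
      ∑ i ∈ Finset.range (n + 1), TensorProduct.map (gradedLift f₁ hL hR i)
        (gradedLift f₁ hL hR (n - i)) (Coalgebra.comul (R := k) c) := by
  cases n with
  | zero =>
    rw [Finset.sum_range_one, map_gradedLift_zero_zero f₁ hL hR hf₀]
    exact comul_ofC (f₀ c)
  | succ n =>
    rw [Finset.sum_range_succ', Nat.sub_zero, map_gradedLift_zero_succ]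
    refine (comul_ofPow n (powLift f₁ hL hR n c)).trans ((add_comm _ _).trans ?_)
    refine congrArg (· + _) (Finset.sum_congr rfl fun i hi => ?_)
    rw [Nat.add_sub_add_right, comul_gradedLift_succ _ _ _ _ _
      (Nat.lt_succ_iff.1 (Finset.mem_range.1 hi))]

include hf₀ in
-- The mixed term in bidegree `(a, b)` is obtained from the component of degree `a + b` by a cut or
-- a coaction, so it vanishes with that component.
theorem map_gradedLift_eq_zero {a b : ℕ} {c : C} (h : gradedLift f₁ hL hR (a + b) c = 0) :
    TensorProduct.map (gradedLift f₁ hL hR a) (gradedLift f₁ hL hR b)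
      (Coalgebra.comul (R := k) c) = 0 := by
  rcases a with _ | a
  · rcases b with _ | b
    · have h1 : f₀ c = 0 := (map_eq_zero_iff _ ofC_injective).1 h
      rw [map_gradedLift_zero_zero f₁ hL hR hf₀, h1, map_zero, map_zero]
    · rw [zero_add] at h
      have h1 : powLift f₁ hL hR b c = 0 := (map_eq_zero_iff _ (ofPow_injective b)).1 h
      rw [map_gradedLift_zero_succ, h1, map_zero, map_zero]
  · rw [Nat.add_right_comm] at h
    have h1 : powLift f₁ hL hR (a + b) c = 0 := (map_eq_zero_iff _ (ofPow_injective _)).1 h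
    have := comul_gradedLift_succ f₁ hL hR (a + b) a (by omega) c
    rwa [Nat.add_sub_cancel_left, h1, map_zero, map_zero] at this

variable (hfin : ∀ c, ∃ N, ∀ n, N ≤ n → gradedLift f₁ hL hR n c = 0)

theorem exists_sum_gradedLift (hfin : ∀ c, ∃ N, ∀ n, N ≤ n → gradedLift f₁ hL hR n c = 0) :
    ∃ φ : C →ₗ[k] CotensorCoalgebra k E P, ∀ c N, (∀ n, N ≤ n → gradedLift f₁ hL hR n c = 0) →
      φ c = ∑ n ∈ Finset.range N, gradedLift f₁ hL hR n c := by
  choose N hN using hfin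
  have hsum : ∀ c m, (∀ n, m ≤ n → gradedLift f₁ hL hR n c = 0) →
      ∑ n ∈ Finset.range (N c), gradedLift f₁ hL hR n c =
        ∑ n ∈ Finset.range m, gradedLift f₁ hL hR n c := by
    intro c m hm
    rcases le_total m (N c) with h | h
    · refine (Finset.sum_subset (Finset.range_mono h) fun n _ hn => hm n ?_).symm
      simpa using hn
    · refine Finset.sum_subset (Finset.range_mono h) fun n _ hn => hN c n ?_
      simpa using hn
  refine ⟨{ toFun := fun c => ∑ n ∈ Finset.range (N c), gradedLift f₁ hL hR n c
            map_add' := fun c c' => ?_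
            map_smul' := fun r c => ?_ }, hsum⟩
  · have h1 : ∀ n, max (N c) (N c') ≤ n → gradedLift f₁ hL hR n c = 0 :=
      fun n hn => hN c n ((le_max_left _ _).trans hn)
    have h2 : ∀ n, max (N c) (N c') ≤ n → gradedLift f₁ hL hR n c' = 0 :=
      fun n hn => hN c' n ((le_max_right _ _).trans hn)
    rw [hsum c _ h1, hsum c' _ h2, hsum (c + c') _ fun n hn => by
      rw [map_add, h1 n hn, h2 n hn, add_zero], ← Finset.sum_add_distrib]
    simp only [map_add]
  · rw [hsum (r • c) (N c) fun n hn => by rw [map_smul, hN c n hn, smul_zero],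
      RingHom.id_apply, Finset.smul_sum]
    simp only [map_smul]

/-- The map to the cotensor coalgebra with given components. -/
def lift : C →ₗ[k] CotensorCoalgebra k E P := (exists_sum_gradedLift f₁ hL hR hfin).choose

theorem lift_apply {c : C} {N : ℕ} (h : ∀ n, N ≤ n → gradedLift f₁ hL hR n c = 0) :
    lift f₁ hL hR hfin c = ∑ n ∈ Finset.range N, gradedLift f₁ hL hR n c :=
  (exists_sum_gradedLift f₁ hL hR hfin).choose_spec c N h

theorem exists_map_lift (z : C ⊗[k] C) : ∃ N₀, ∀ N, N₀ ≤ N →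
    TensorProduct.map (lift f₁ hL hR hfin) (lift f₁ hL hR hfin) z =
      ∑ a ∈ Finset.range N, ∑ b ∈ Finset.range N,
        TensorProduct.map (gradedLift f₁ hL hR a) (gradedLift f₁ hL hR b) z := by
  induction z with
  | zero => exact ⟨0, fun N _ => by simp⟩
  | add x y hx hy =>
    obtain ⟨m, hm⟩ := hx
    obtain ⟨n, hn⟩ := hy
    refine ⟨max m n, fun N hN => ?_⟩
    simp only [map_add, Finset.sum_add_distrib]
    rw [hm N ((le_max_left _ _).trans hN), hn N ((le_max_right _ _).trans hN)]
  | tmul x y =>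
    obtain ⟨m, hm⟩ := hfin x
    obtain ⟨n, hn⟩ := hfin y
    refine ⟨max m n, fun N hN => ?_⟩
    simp only [TensorProduct.map_tmul]
    rw [lift_apply f₁ hL hR hfin fun i hi => hm i (((le_max_left _ _).trans hN).trans hi),
      lift_apply f₁ hL hR hfin fun i hi => hn i (((le_max_right _ _).trans hN).trans hi),
      TensorProduct.sum_tmul]
    simp only [TensorProduct.tmul_sum]

include hf₀ in
theorem comul_lift (c : C) : Coalgebra.comul (R := k) (lift f₁ hL hR hfin c) =
    TensorProduct.map (lift f₁ hL hR hfin) (lift f₁ hL hR hfin)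
      (Coalgebra.comul (R := k) c) := by
  obtain ⟨m, hm⟩ := hfin c
  obtain ⟨n, hn⟩ := exists_map_lift f₁ hL hR hfin (Coalgebra.comul (R := k) c)
  rw [hn _ (le_max_right m n), lift_apply f₁ hL hR hfin
    fun i hi => hm i ((le_max_left m n).trans hi), map_sum]
  simp only [comul_gradedLift f₁ hL hR hf₀]
  -- The left side runs over the triangle `a + b < max m n`, the right side over the full square.
  -- The terms outside the triangle vanish since the components of `c` of degree at least `m` do.
  rw [Finset.sum_range_diag_flip (max m n) fun a b =>
    TensorProduct.map (gradedLift f₁ hL hR a) (gradedLift f₁ hL hR b)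
      (Coalgebra.comul (R := k) c)]
  refine Finset.sum_congr rfl fun a _ => ?_
  refine Finset.sum_subset (Finset.range_mono (Nat.sub_le _ _)) fun b _ hb => ?_
  refine map_gradedLift_eq_zero f₁ hL hR hf₀ (hm _ ?_)
  simp only [Finset.mem_range, not_lt] at hb
  omega

theorem projC_gradedLift_succ (n : ℕ) (c : C) :
    projC k E P (gradedLift f₁ hL hR (n + 1) c) = 0 := projC_ofPow n _

theorem projC_lift (c : C) : projC k E P (lift f₁ hL hR hfin c) = f₀ c := by
  obtain ⟨N, hN⟩ := hfin c
  -- Truncating at `N + 1` instead of `N` ensures that the term of degree zero is present.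
  rw [lift_apply f₁ hL hR hfin fun i (hi : N + 1 ≤ i) => hN i (by omega), map_sum,
    Finset.sum_range_succ', Finset.sum_eq_zero fun i _ => projC_gradedLift_succ f₁ hL hR i c,
    zero_add]
  exact projC_ofC _

theorem projPow_lift (n : ℕ) (c : C) :
    projPow k E P n (lift f₁ hL hR hfin c) = powLift f₁ hL hR n c := by
  obtain ⟨N, hN⟩ := hfin c
  rw [lift_apply f₁ hL hR hfin fun i (hi : N + n + 2 ≤ i) => hN i (by omega), map_sum,
    Finset.sum_eq_single (n + 1)]
  · exact projPow_ofPow_self n _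
  · intro i _ hi
    rcases i with _ | i
    · exact projPow_ofC n _
    · exact projPow_ofPow_of_ne (fun h => hi (by rw [h])) _
  · intro h
    exact absurd (Finset.mem_range.2 (by omega)) h

theorem counit_eq_projC (x : CotensorCoalgebra k E P) :
    Coalgebra.counit (R := k) x = Coalgebra.counit (R := k) (projC k E P x) := by
  have : (Coalgebra.counit : CotensorCoalgebra k E P →ₗ[k] k) =
      Coalgebra.counit ∘ₗ projC k E P :=
    hom_ext (fun c => counit_ofC c) fun n x => by
      rw [LinearMap.comp_apply, projC_ofPow, map_zero, counit_ofPow]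
  exact LinearMap.congr_fun this x

/-- The coalgebra map to the cotensor coalgebra with given components. -/
def liftCoalgHom (hε : ∀ c, Coalgebra.counit (R := k) (f₀ c) = Coalgebra.counit (R := k) c) :
    C →ₗc[k] CotensorCoalgebra k E P where
  toLinearMap := lift f₁ hL hR hfin
  counit_comp := LinearMap.ext fun c => by
    rw [LinearMap.comp_apply, counit_eq_projC, projC_lift, hε]
  map_comp_comul := LinearMap.ext fun c => (comul_lift f₁ hL hR hf₀ hfin c).symm

theorem liftCoalgHom_apply
    (hε : ∀ c, Coalgebra.counit (R := k) (f₀ c) = Coalgebra.counit (R := k) c) (c : C) :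
    liftCoalgHom f₁ hL hR hf₀ hfin hε c = lift f₁ hL hR hfin c := rfl

end Lift

end CotensorCoalgebra

open Module

/-! ### Bimodules twisted by an endomorphism. -/

section Twist

variable {k D : Type*} [Field k] [Ring D] [Algebra k D]

/-- The regular right `D`-module, on which `D` acts from the left through an endomorphism. -/
def TwistedBimodule (_ : D →ₐ[k] D) : Type _ := D

variable (τ : D →ₐ[k] D)

namespace TwistedBimodule

instance : AddCommGroup (TwistedBimodule τ) := inferInstanceAs (AddCommGroup D)

instance : Module k (TwistedBimodule τ) := inferInstanceAs (Module k D)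

instance [FiniteDimensional k D] : FiniteDimensional k (TwistedBimodule τ) :=
  inferInstanceAs (FiniteDimensional k D)

/-- The identity of the underlying space. -/
def equiv : TwistedBimodule τ ≃ₗ[k] D := LinearEquiv.refl k D

instance : Module D (TwistedBimodule τ) where
  smul d x := (equiv τ).symm (τ d * equiv τ x)
  one_smul x := by
    change τ 1 * equiv τ x = equiv τ x
    rw [map_one, one_mul]
  mul_smul a b x := by
    change τ (a * b) * equiv τ x = τ a * (τ b * equiv τ x)
    rw [map_mul, mul_assoc]
  smul_zero a := mul_zero (τ a)
  smul_add a x y := mul_add (τ a) (equiv τ x) (equiv τ y)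
  add_smul a b x := by
    change τ (a + b) * equiv τ x = τ a * equiv τ x + τ b * equiv τ x
    rw [map_add, add_mul]
  zero_smul x := by
    change τ 0 * equiv τ x = 0
    rw [map_zero, zero_mul]

instance : Module Dᵐᵒᵖ (TwistedBimodule τ) := inferInstanceAs (Module Dᵐᵒᵖ D)

theorem equiv_smul (d : D) (x : TwistedBimodule τ) : equiv τ (d • x) = τ d * equiv τ x := rfl

theorem equiv_op_smul (d : D) (x : TwistedBimodule τ) :
    equiv τ (MulOpposite.op d • x) = equiv τ x * d := rfl

instance : IsScalarTower k D (TwistedBimodule τ) where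
  smul_assoc t d x := (equiv τ).injective (by
    rw [equiv_smul, map_smul, map_smul, equiv_smul, smul_mul_assoc])

instance : IsScalarTower k Dᵐᵒᵖ (TwistedBimodule τ) := inferInstanceAs (IsScalarTower k Dᵐᵒᵖ D)

instance : SMulCommClass D Dᵐᵒᵖ (TwistedBimodule τ) where
  smul_comm a b x := (equiv τ).injective (mul_assoc (τ a) (equiv τ x) b.unop).symm

end TwistedBimodule

end Twist

/-! ### Transposing the section and the generator, and injectivity of the resulting map. -/

section DualMaps

variable {k C : Type*} [Field k] [AddCommGroup C] [Module k C] [Coalgebra k C]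

theorem dualDistrib_map_flip {A B : Type*} [AddCommGroup A] [Module k A] [AddCommGroup B]
    [Module k B] (F : A →ₗ[k] C →ₗ[k] k) (G : B →ₗ[k] C →ₗ[k] k) (a : A) (b : B) (c : C) :
    dualDistrib k A B (TensorProduct.map F.flip G.flip (Coalgebra.comul (R := k) c)) (a ⊗ₜ b) =
      (toConv (F a) * toConv (G b) : DualAlgebra k C) c := by
  rw [convMul_apply]
  generalize Coalgebra.comul (R := k) c = z
  induction z with
  | zero => simp
  | add x y hx hy => simp only [map_add, LinearMap.add_apply, hx, hy]
  | tmul x y => simp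

/-- Transposition turns multiplicativity of maps into the dual algebra into comultiplicativity; this
one principle gives the coalgebra map to `D*` and both colinearity statements below. -/
theorem codual_flip {A B L : Type*} [AddCommGroup A] [Module k A] [FiniteDimensional k A]
    [AddCommGroup B] [Module k B] [FiniteDimensional k B] [AddCommGroup L] [Module k L]
    (μ : A ⊗[k] B →ₗ[k] L) (F : A →ₗ[k] C →ₗ[k] k) (G : B →ₗ[k] C →ₗ[k] k)
    (H : L →ₗ[k] C →ₗ[k] k)
    (h : ∀ a b, (toConv (H (μ (a ⊗ₜ b))) : DualAlgebra k C) = toConv (F a) * toConv (G b))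
    (c : C) :
    codual μ (H.flip c) = TensorProduct.map F.flip G.flip (Coalgebra.comul (R := k) c) := by
  apply dualDistrib_injective
  rw [dualDistrib_codual]
  apply TensorProduct.ext'
  intro a b
  rw [dualDistrib_map_flip, ← h]
  rfl

theorem eq_zero_of_forall_eval {M X : Type*} [AddCommGroup M] [Module k M]
    [FiniteDimensional k M] [AddCommGroup X] [Module k X] {z : Dual k M ⊗[k] X}
    (h : ∀ x, TensorProduct.lid k X ((Dual.eval k M x).rTensor X z) = 0) : z = 0 := by
  have : z ∈ range ((⊥ : Submodule k X).subtype.lTensor (Dual k M)) := by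
    apply mem_range_lTensor_of
    intro g
    obtain ⟨x, rfl⟩ := (Module.evalEquiv k M).surjective g
    exact h x
  obtain ⟨y, rfl⟩ := this
  have h0 : (⊥ : Submodule k X).subtype = 0 := by
    ext x
    exact (Submodule.mem_bot k).1 x.2
  rw [h0, LinearMap.lTensor_zero, LinearMap.zero_apply]

theorem lid_rTensor_map_comul {P X : Type*} [AddCommGroup P] [Module k P] [AddCommGroup X]
    [Module k X] (f : C →ₗ[k] P) (g : C →ₗ[k] X) (e : P →ₗ[k] k) (c : C) :
    TensorProduct.lid k X (e.rTensor X (TensorProduct.map f g (Coalgebra.comul (R := k) c))) =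
      g (rightHit (e ∘ₗ f) c) := by
  rw [rightHit, LinearMap.comp_apply, LinearMap.comp_apply]
  generalize Coalgebra.comul (R := k) c = z
  induction z with
  | zero => simp
  | add x y hx hy => simp only [map_add, hx, hy]
  | tmul x y => simp

variable {D : Type*} [DivisionRing D] [Algebra k D]

/-- A linear map into the dual algebra, as a bilinear map. -/
def toFunctional {V : Type*} [AddCommGroup V] [Module k V] (f : V →ₗ[k] DualAlgebra k C) :
    V →ₗ[k] C →ₗ[k] k where
  toFun v := (f v).ofConv
  map_add' a b := by rw [map_add]; rfl
  map_smul' t a := by rw [map_smul]; rfl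

theorem toFunctional_apply {V : Type*} [AddCommGroup V] [Module k V]
    (f : V →ₗ[k] DualAlgebra k C) (v : V) : toFunctional f v = (f v).ofConv := rfl

variable [FiniteDimensional k D] (s : D →ₐ[k] DualAlgebra k C) (m : DualAlgebra k C)
  (τ : D →ₐ[k] D)

/-- The map `C → D*` dual to an algebra map from `D` to the dual algebra of `C`. -/
def dualSection : C →ₗ[k] Dual k D := (toFunctional s.toLinearMap).flip

/-- The map from `C` to the dual of the bimodule generated by `m`. -/
def dualGenerator : C →ₗ[k] Dual k (TwistedBimodule τ) :=
  (toFunctional (LinearMap.mulLeft k m ∘ₗ s.toLinearMap ∘ₗ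
    (TwistedBimodule.equiv τ).toLinearMap)).flip

theorem comul_dualSection (c : C) : Coalgebra.comul (R := k) (dualSection s c) =
    TensorProduct.map (dualSection s) (dualSection s) (Coalgebra.comul (R := k) c) :=
  codual_flip (LinearMap.mul' k D) _ _ _ (fun a b => by
    simp only [toFunctional_apply, toConv_ofConv, AlgHom.toLinearMap_apply, LinearMap.mul'_apply,
      map_mul]) c

theorem counit_dualSection (c : C) :
    Coalgebra.counit (R := k) (dualSection s c) = Coalgebra.counit (R := k) c := by
  change (s 1).ofConv c = _
  rw [map_one]
  rfl

variable {s m τ} in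
theorem coactL_dualGenerator (hm : ∀ a, s a * m = m * s (τ a)) (c : C) :
    (coactL : Dual k (TwistedBimodule τ) →ₗ[k] Dual k D ⊗[k] Dual k (TwistedBimodule τ))
      (dualGenerator s m τ c) = TensorProduct.map (dualSection s) (dualGenerator s m τ)
        (Coalgebra.comul (R := k) c) :=
  codual_flip (leftAct k D (TwistedBimodule τ)) _ _ _ (fun a b => by
    simp only [toFunctional_apply, toConv_ofConv, AlgHom.toLinearMap_apply, LinearMap.comp_apply,
      leftAct_tmul, LinearEquiv.coe_coe, TwistedBimodule.equiv_smul, LinearMap.mulLeft_apply,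
      map_mul, ← mul_assoc, hm]) c

theorem coactR_dualGenerator (c : C) :
    (coactR : Dual k (TwistedBimodule τ) →ₗ[k] Dual k (TwistedBimodule τ) ⊗[k] Dual k D)
      (dualGenerator s m τ c) = TensorProduct.map (dualGenerator s m τ) (dualSection s)
        (Coalgebra.comul (R := k) c) :=
  codual_flip (rightAct k D (TwistedBimodule τ)) _ _ _ (fun a b => by
    simp only [toFunctional_apply, toConv_ofConv, AlgHom.toLinearMap_apply, LinearMap.comp_apply,
      rightAct_tmul, LinearEquiv.coe_coe, TwistedBimodule.equiv_op_smul, LinearMap.mulLeft_apply,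
      map_mul, ← mul_assoc]) c

section

variable {s m τ} (hm : ∀ a, s a * m = m * s (τ a))

/-- The components of the map from `C` to the cotensor coalgebra. -/
def generatorPow (n : ℕ) :
    C →ₗ[k] (cotensorPow k (Dual k D) (Dual k (TwistedBimodule τ)) n).carrier :=
  CotensorCoalgebra.powLift (dualGenerator s m τ) (coactL_dualGenerator hm)
    (coactR_dualGenerator s m τ) n

/-- A tensor in `M* ⊗ X` is zero exactly when all evaluations of its first factor vanish, and these
evaluations are right hits by `m * s d`. -/
theorem generatorPow_succ_eq_zero_iff (n : ℕ) (c : C) :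
    generatorPow hm (n + 1) c = 0 ↔
      ∀ d, generatorPow hm n (rightHit (m * s d).ofConv c) = 0 := by
  have key : ∀ x : TwistedBimodule τ, TensorProduct.lid k _ ((Dual.eval k _ x).rTensor _
      (TensorProduct.map (dualGenerator s m τ) (generatorPow hm n)
        (Coalgebra.comul (R := k) c))) =
      generatorPow hm n (rightHit (m * s (TwistedBimodule.equiv τ x)).ofConv c) :=
    fun x => lid_rTensor_map_comul _ _ _ c
  have h1 : generatorPow hm (n + 1) c = 0 ↔ TensorProduct.map (dualGenerator s m τ)
      (generatorPow hm n) (Coalgebra.comul (R := k) c) = 0 :=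
    (map_eq_zero_iff (cotensor _ (cotensorPow k (Dual k D) _ n)).subtype
      (Submodule.injective_subtype _)).symm
  rw [h1]
  refine ⟨fun h d => ?_, fun h => eq_zero_of_forall_eval fun x => ?_⟩
  · have := key ((TwistedBimodule.equiv τ).symm d)
    rw [h, map_zero, map_zero, LinearEquiv.apply_symm_apply] at this
    exact this.symm
  · rw [key]
    exact h _

theorem generatorPow_eq_zero (hmC : m ∈ perp (coradical k C)) (n : ℕ) {c : C}
    (hc : c ∈ coradFil k C (n + 1)) : generatorPow hm n c = 0 := by
  have hmul : ∀ d, m * s d ∈ perp (coradical k C) := fun d =>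
    mul_mem_perp_right isRightCoideal_coradical hmC (s d)
  induction n generalizing c with
  | zero =>
    rw [coradFil_one] at hc
    exact LinearMap.ext fun x => hmul (TwistedBimodule.equiv τ x) c hc
  | succ n ih =>
    rw [generatorPow_succ_eq_zero_iff]
    exact fun d => ih (mem_coradFil_succ.1 hc _ (hmul d))

variable {r : DualAlgebra k C →ₐ[k] D}

/-- The components separate the elements of a chain coalgebra. -/
theorem eq_zero_of_generatorPow (hr : ∀ a, r a = 0 ↔ a ∈ perp (coradical k C))
    (hrs : ∀ d, r (s d) = d)
    (hgen : ∀ b ∈ perp (coradical k C), ∃ d, b - m * s d ∈ perp (coradFil k C 2)) (n : ℕ) {c : C}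
    (hc : c ∈ coradFil k C n) (h0 : dualSection s c = 0) (h : ∀ n, generatorPow hm n c = 0) :
    c = 0 := by
  induction n generalizing c with
  | zero => exact mem_coradFil_zero.1 hc
  | succ n ih =>
    rcases n with _ | n
    -- On `C₀` every functional agrees with one from `s(D)`, so the degree-zero component already
    -- detects `c`.
    · have h1 : ∀ a : DualAlgebra k C, a c = 0 := fun a => by
        have h2 : (a - s (r a)) c = 0 := sub_section_mem hr hrs a c hc
        have h3 : s (r a) c = 0 := LinearMap.congr_fun h0 (r a)
        exact (sub_eq_zero.1 h2).trans h3
      exact eq_of_forall_functional fun f => (h1 (toConv f)).trans (map_zero f).symm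
    · refine ih ?_ h0 h
      rw [mem_coradFil_succ]
      intro a ha
      obtain ⟨d, hd⟩ := hgen a ha
      -- The hit element lies one step lower in the filtration and again has all components zero, so
      -- induction kills it.
      have hmsd : rightHit (m * s d).ofConv c = 0 := by
        refine ih ?_ ?_ fun i => (generatorPow_succ_eq_zero_iff hm i c).1 (h (i + 1)) d
        · have hms : m * s d ∈ perp (coradical k C) := by
            have h12 : perp (coradFil k C 2) ≤ perp (coradical k C) := by
              rw [← coradFil_one]
              exact perp_anti (coradFil_mono one_le_two)
            have := sub_mem ha (h12 hd)
            rwa [sub_sub_cancel] at this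
          exact mem_coradFil_succ.1 hc _ hms
        · refine LinearMap.ext fun d' => ?_
          change (s d').ofConv (rightHit (m * s d).ofConv c) = 0
          rw [← mul_apply_rightHit, mul_assoc, ← map_mul]
          exact LinearMap.congr_fun (h 0) ((TwistedBimodule.equiv τ).symm (d * d'))
      -- The remainder `a - m * s d` annihilates `C₁`, so it lowers the filtration by two steps;
      -- this puts `c` one step lower, where induction applies again.
      have h2 := rightHit_mem_coradFil (m := 2) (n := n) (by rwa [add_comm 2 n]) hd
      have h3 : rightHit a.ofConv c =
          rightHit (a - m * s d).ofConv c + rightHit (m * s d).ofConv c := by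
        rw [ofConv_sub, rightHit, rightHit, rightHit, rTensor_sub]
        simp
      rw [h3, hmsd, add_zero]
      exact h2

end

end DualMaps

/-- Chain coalgebras of separable type embed into cotensor coalgebras. -/
theorem exists_injective_coalgHom {k : Type*} {D : Type v} [Field k] [DivisionRing D]
    [Algebra k D] [FiniteDimensional k D] (hD : IsSeparableAlgebra k D)
    (C : Type t) [AddCommGroup C] [Module k C] [Coalgebra k C]
    (hC : IsChainCoalgebraOfType k C D) :
    ∃ (τ : D →ₐ[k] D)
      (φ : C →ₗc[k] CotensorCoalgebra k (Dual k D) (Dual k (TwistedBimodule τ))),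
      Function.Injective φ := by
  obtain ⟨hC, ⟨e⟩⟩ := hC
  have h0 := coradical_ne_bot e
  have hex := exists_mem_coradFil hC h0
  obtain ⟨r, s, hr, hrs⟩ := exists_algHom_section hC e hD
  obtain ⟨m, τ, hmC, hm, hgen⟩ := exists_generator hC h0 hr hrs hD
  have hfin : ∀ c, ∃ N, ∀ n, N ≤ n → CotensorCoalgebra.gradedLift (dualGenerator s m τ)
      (coactL_dualGenerator hm) (coactR_dualGenerator s m τ) n c = 0 := by
    intro c
    obtain ⟨N, hN⟩ := hex c
    refine ⟨N + 1, fun n hn => ?_⟩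
    obtain ⟨n, rfl⟩ : ∃ n', n = n' + 1 := ⟨n - 1, by omega⟩
    have := generatorPow_eq_zero hm hmC n (coradFil_mono (by omega) hN)
    exact (congrArg (CotensorCoalgebra.ofPow k (Dual k D) _ n) this).trans (map_zero _)
  refine ⟨τ, CotensorCoalgebra.liftCoalgHom (dualGenerator s m τ) (coactL_dualGenerator hm)
    (coactR_dualGenerator s m τ) (comul_dualSection s) hfin (counit_dualSection s), ?_⟩
  refine (injective_iff_map_eq_zero _).2 fun c hc => ?_
  rw [CotensorCoalgebra.liftCoalgHom_apply] at hc
  obtain ⟨N, hN⟩ := hex c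
  refine eq_zero_of_generatorPow hm hr hrs hgen N hN ?_ fun n => ?_
  · rw [← CotensorCoalgebra.projC_lift (dualGenerator s m τ) (coactL_dualGenerator hm)
      (coactR_dualGenerator s m τ) hfin, hc, map_zero]
  · rw [generatorPow, ← CotensorCoalgebra.projPow_lift (hfin := hfin), hc, map_zero]

namespace CotensorCoalgebra

/-! ### The degree filtration, and how functionals move degrees. -/

section Grading

variable {k C M : Type*} [Field k] [AddCommGroup C] [Module k C] [Coalgebra k C]
  [AddCommGroup M] [Module k M] [Bicomodule k C M]

theorem leftHit_ofC (f : CotensorCoalgebra k C M →ₗ[k] k) (c : C) :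
    leftHit f (ofC k C M c) = ofC k C M (leftHit (f ∘ₗ ofC k C M) c) := by
  rw [leftHit, LinearMap.comp_apply, LinearMap.comp_apply, comul_ofC, lTensor_map, leftHit,
    LinearMap.comp_apply, LinearMap.comp_apply]
  generalize Coalgebra.comul (R := k) c = z
  induction z with
  | zero => simp
  | add x y hx hy => simp only [map_add, hx, hy]
  | tmul x y => simp

theorem rid_lTensor_rTensor {U V W : Type*} [AddCommGroup U] [Module k U] [AddCommGroup V]
    [Module k V] [AddCommGroup W] [Module k W] (g : U →ₗ[k] W) (f : V →ₗ[k] k) (z : U ⊗[k] V) :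
    TensorProduct.rid k W (f.lTensor W (g.rTensor V z)) =
      g (TensorProduct.rid k U (f.lTensor U z)) := by
  induction z with
  | zero => simp
  | add x y hx hy => simp only [map_add, hx, hy]
  | tmul x y => simp

theorem leftHit_ofPow (f : CotensorCoalgebra k C M →ₗ[k] k) (n : ℕ)
    (x : (cotensorPow k C M n).carrier) :
    leftHit f (ofPow k C M n x) =
      ofC k C M (TensorProduct.rid k C
        ((f ∘ₗ ofPow k C M n).lTensor C ((cotensorPow k C M n).coact x))) +
      ∑ i ∈ Finset.range (n + 1), ofPow k C M i (TensorProduct.rid k _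
        (f.lTensor _ (split k C M n i x))) := by
  rw [leftHit, LinearMap.comp_apply, LinearMap.comp_apply, comul_ofPow, map_add, map_sum,
    LinearEquiv.coe_coe, map_add, map_sum]
  simp only [rid_lTensor_rTensor]
  rw [lTensor_map, map_eq_lTensor_rTensor, rid_lTensor_rTensor]

variable {V : Type*} [AddCommGroup V] [Module k V]

/-- The right tensor factor of this cut is of degree zero. -/
theorem lTensor_split_self {f : CotensorCoalgebra k C M →ₗ[k] V} (hf : f ∘ₗ ofC k C M = 0) :
    ∀ (n : ℕ) (x : (cotensorPow k C M n).carrier), f.lTensor _ (split k C M n n x) = 0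
  | 0, x => by
    have h1 : f.lTensor M ((ofC k C M).lTensor M (coactR (x : M))) = 0 := by
      rw [← lTensor_comp_apply, hf, lTensor_zero, LinearMap.zero_apply]
    exact h1
  | n + 1, x => by
    apply split_aux_injective (cotensorPow k C M n)
    have h0 := split_aux_map (split k C M n n) (split_colinear n n) f x
    have h2 : f.lTensor _ ∘ₗ split k C M n n = 0 := LinearMap.ext (lTensor_split_self hf n)
    rw [h2, lTensor_zero, LinearMap.zero_apply] at h0
    exact h0.trans (map_zero ((TensorProduct.assoc k M _ _).toLinearMap ∘ₗ
      (cotensor M (cotensorPow k C M n)).subtype.rTensor V)).symm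

/-- The right tensor factor of this cut has positive degree `n - i`. -/
theorem lTensor_split_of_lt {f : CotensorCoalgebra k C M →ₗ[k] V}
    (hf : ∀ n, f ∘ₗ ofPow k C M n = 0) :
    ∀ (n i : ℕ) (_ : i < n) (x : (cotensorPow k C M n).carrier),
      f.lTensor _ (split k C M n i x) = 0
  | n + 1, 0, _, x => by
    have h1 : f.lTensor M ((ofPow k C M n).lTensor M x.1) = 0 := by
      rw [← lTensor_comp_apply, hf, lTensor_zero, LinearMap.zero_apply]
    exact h1
  | n + 1, i + 1, h, x => by
    apply split_aux_injective (cotensorPow k C M i)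
    have h0 := split_aux_map (split k C M n i) (split_colinear n i) f x
    have h2 : f.lTensor _ ∘ₗ split k C M n i = 0 :=
      LinearMap.ext (lTensor_split_of_lt hf n i (by omega))
    rw [h2, lTensor_zero, LinearMap.zero_apply] at h0
    exact h0.trans (map_zero ((TensorProduct.assoc k M _ _).toLinearMap ∘ₗ
      (cotensor M (cotensorPow k C M i)).subtype.rTensor V)).symm

/-- Cutting off the last factor is in effect the inclusion of a cotensor product in a tensor
product; injectivity passes through `M ⊗ -` by flatness. -/
theorem lTensor_split_succ_injective {f : CotensorCoalgebra k C M →ₗ[k] V}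
    (hf : Function.Injective (f ∘ₗ ofPow k C M 0)) :
    ∀ n : ℕ, Function.Injective (f.lTensor _ ∘ₗ split k C M (n + 1) n)
  | 0 => by
    have h1 : Function.Injective ((f ∘ₗ ofPow k C M 0).lTensor M ∘ₗ
        (cotensor M (cotensorPow k C M 0)).subtype) := by
      rw [LinearMap.coe_comp]
      exact (Module.Flat.lTensor_preserves_injective_linearMap _ hf).comp
        (Submodule.injective_subtype _)
    rw [lTensor_comp] at h1
    exact h1
  | n + 1 => by
    intro x y hxy
    have h0 := split_aux_map (M := M) (split k C M (n + 1) n) (split_colinear (n + 1) n) f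
    have h1 : Function.Injective ((f.lTensor _ ∘ₗ split k C M (n + 1) n).lTensor M) :=
      Module.Flat.lTensor_preserves_injective_linearMap _ (lTensor_split_succ_injective hf n)
    refine Subtype.ext (h1 ?_)
    refine (h0 x).symm.trans (Eq.trans ?_ (h0 y))
    exact congrArg (fun z => TensorProduct.assoc k M _ _
      ((cotensor M (cotensorPow k C M n)).subtype.rTensor V z)) hxy

variable (k C M) in
/-- The homogeneous components of the cotensor coalgebra. -/
def piece : ℕ → Submodule k (CotensorCoalgebra k C M)
  | 0 => range (ofC k C M)
  | n + 1 => range (ofPow k C M n)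

variable (k C M) in
/-- The filtration of the cotensor coalgebra by degree: the sum of the first `n` components. -/
def degFil : ℕ → Submodule k (CotensorCoalgebra k C M)
  | 0 => ⊥
  | n + 1 => degFil n ⊔ piece k C M n

theorem degFil_mono : Monotone (degFil k C M) :=
  monotone_nat_of_le_succ fun _ => le_sup_left

theorem piece_le_degFil {m n : ℕ} (h : m < n) : piece k C M m ≤ degFil k C M n :=
  (le_sup_right : piece k C M m ≤ degFil k C M (m + 1)).trans (degFil_mono h)

theorem degFil_le {n : ℕ} {N : Submodule k (CotensorCoalgebra k C M)}
    (h : ∀ i < n, piece k C M i ≤ N) : degFil k C M n ≤ N := by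
  induction n with
  | zero => exact bot_le
  | succ n ih => exact sup_le (ih fun i hi => h i (by omega)) (h n (by omega))

theorem exists_mem_degFil (x : CotensorCoalgebra k C M) : ∃ n, x ∈ degFil k C M n := by
  -- The quotient by the union of the filtration is zero, because the quotient map vanishes on every
  -- summand.
  have h : (⨆ n, degFil k C M n).mkQ = 0 := hom_ext
    (fun c => (Submodule.Quotient.mk_eq_zero _).2 (Submodule.mem_iSup_of_mem 1
      (piece_le_degFil (m := 0) one_pos ⟨c, rfl⟩)))
    (fun n x => (Submodule.Quotient.mk_eq_zero _).2 (Submodule.mem_iSup_of_mem (n + 2)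
      (piece_le_degFil (m := n + 1) (by omega) ⟨x, rfl⟩)))
  have hx : x ∈ ⨆ n, degFil k C M n :=
    (Submodule.Quotient.mk_eq_zero _).1 (LinearMap.congr_fun h x)
  rwa [Submodule.mem_iSup_of_directed _ degFil_mono.directed_le] at hx

theorem exists_degree {x : CotensorCoalgebra k C M} (hx : x ≠ 0) :
    ∃ n, x ∈ degFil k C M (n + 1) ∧ x ∉ degFil k C M n := by
  classical
  have h := exists_mem_degFil x
  have h0 : Nat.find h ≠ 0 := fun h0 => hx (by
    have := Nat.find_spec h
    rw [h0] at this
    exact this)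
  refine ⟨Nat.find h - 1, ?_, Nat.find_min h (by omega)⟩
  rw [Nat.sub_add_cancel (by omega)]
  exact Nat.find_spec h

theorem projPow_eq_zero {n : ℕ} {x : CotensorCoalgebra k C M} (hx : x ∈ degFil k C M (n + 1)) :
    projPow k C M n x = 0 := by
  have : degFil k C M (n + 1) ≤ ker (projPow k C M n) := by
    apply degFil_le
    rintro (_ | i) hi
    · rintro _ ⟨c, rfl⟩
      exact projPow_ofC n c
    · rintro _ ⟨y, rfl⟩
      exact projPow_ofPow_of_ne (by omega) y
  exact this hx

theorem leftHit_mem_degFil {f : CotensorCoalgebra k C M →ₗ[k] k} (hf : f ∘ₗ ofC k C M = 0)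
    {n : ℕ} {x : CotensorCoalgebra k C M} (hx : x ∈ degFil k C M (n + 1)) :
    leftHit f x ∈ degFil k C M n := by
  have : degFil k C M (n + 1) ≤ (degFil k C M n).comap (leftHit f) := by
    apply degFil_le
    rintro (_ | i) hi
    · rintro _ ⟨c, rfl⟩
      change leftHit f (ofC k C M c) ∈ degFil k C M n
      rw [leftHit_ofC, hf, leftHit, lTensor_zero]
      simp
    · rintro _ ⟨y, rfl⟩
      change leftHit f (ofPow k C M i y) ∈ degFil k C M n
      rw [leftHit_ofPow, Finset.sum_range_succ, lTensor_split_self hf, map_zero, map_zero, add_zero]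
      refine add_mem (piece_le_degFil (m := 0) (by omega) ⟨_, rfl⟩) (sum_mem fun j hj => ?_)
      have := Finset.mem_range.1 hj
      exact piece_le_degFil (m := j + 1) (by omega) ⟨_, rfl⟩
  exact this hx

theorem exists_rid_lTensor_ne_zero {U : Type*} [AddCommGroup U] [Module k U] {z : U ⊗[k] V}
    (hz : z ≠ 0) : ∃ h : V →ₗ[k] k, TensorProduct.rid k U (h.lTensor U z) ≠ 0 := by
  by_contra! hn
  apply hz
  have : z ∈ range ((⊥ : Submodule k U).subtype.rTensor V) :=
    (mem_range_rTensor_iff _ _).2 hn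
  obtain ⟨y, rfl⟩ := this
  have h0 : (⊥ : Submodule k U).subtype = 0 := by
    ext x
    exact (Submodule.mem_bot k).1 x.2
  rw [h0, rTensor_zero, LinearMap.zero_apply]

theorem coact_injective (X : LeftComod k C) {x : X.carrier} (h : X.coact x = 0) : x = 0 := by
  have := X.counit x
  rw [h, map_zero] at this
  have h2 := congrArg (TensorProduct.lid k _) this
  simpa using h2.symm

/-- Functionals of degree one lower the degree of an element by exactly one. -/
theorem exists_leftHit_notMem {n : ℕ} {x : CotensorCoalgebra k C M}
    (hx : x ∈ degFil k C M (n + 2)) (hx' : x ∉ degFil k C M (n + 1)) :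
    ∃ f : CotensorCoalgebra k C M →ₗ[k] k,
      leftHit f x ∈ degFil k C M (n + 1) ∧ leftHit f x ∉ degFil k C M n := by
  obtain ⟨z, hz, _, ⟨y, rfl⟩, rfl⟩ := Submodule.mem_sup.1 hx
  have hy : y ≠ 0 := by
    rintro rfl
    rw [map_zero, add_zero] at hx'
    exact hx' hz
  have hpC : ∀ h : (cotensorPow k C M 0).carrier →ₗ[k] k,
      (h ∘ₗ projPow k C M 0) ∘ₗ ofC k C M = 0 := fun h => LinearMap.ext fun c => by
    rw [LinearMap.comp_apply, LinearMap.comp_apply, projPow_ofC, map_zero, LinearMap.zero_apply]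
  have hpP : projPow k C M 0 ∘ₗ ofPow k C M 0 = LinearMap.id :=
    LinearMap.ext (projPow_ofPow_self 0)
  suffices ∃ h : (cotensorPow k C M 0).carrier →ₗ[k] k,
      leftHit (h ∘ₗ projPow k C M 0) (ofPow k C M n y) ∉ degFil k C M n by
    obtain ⟨h, hh⟩ := this
    refine ⟨h ∘ₗ projPow k C M 0, leftHit_mem_degFil (hpC h) hx, fun hn => hh ?_⟩
    rw [map_add] at hn
    have := sub_mem hn (leftHit_mem_degFil (hpC h) hz)
    rwa [add_sub_cancel_left] at this
  -- Only the top component `y` matters. In degree one it is brought down to degree zero by the left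
  -- coaction, which is injective by counitality; in higher degrees by cutting off its last factor.
  rcases n with _ | n
  · have h1 : (cotensorPow k C M 0).coact y ≠ 0 := fun h => hy (coact_injective _ h)
    obtain ⟨h, hh⟩ := exists_rid_lTensor_ne_zero h1
    refine ⟨h, fun hmem => hh ?_⟩
    rw [leftHit_ofPow, Finset.sum_range_one, lTensor_split_self (hpC h), map_zero, map_zero,
      add_zero, LinearMap.comp_assoc, hpP, LinearMap.comp_id] at hmem
    exact (map_eq_zero_iff _ ofC_injective).1 ((Submodule.mem_bot k).1 hmem)
  · have hinj : Function.Injective (projPow k C M 0 ∘ₗ ofPow k C M 0) := by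
      rw [hpP]
      exact Function.injective_id
    have h1 : (projPow k C M 0).lTensor _ (split k C M (n + 1) n y) ≠ 0 := fun h =>
      hy ((map_eq_zero_iff _ (lTensor_split_succ_injective hinj n)).1 h)
    obtain ⟨h, hh⟩ := exists_rid_lTensor_ne_zero h1
    refine ⟨h, fun hmem => hh ?_⟩
    rw [leftHit_ofPow, Finset.sum_range_succ, lTensor_split_self (hpC h), map_zero, map_zero,
      add_zero, Finset.sum_range_succ] at hmem
    have h2 := projPow_eq_zero hmem
    rw [map_add, map_add, projPow_ofC, zero_add, map_sum, Finset.sum_eq_zero, zero_add,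
      projPow_ofPow_self, lTensor_comp_apply] at h2
    · exact h2
    · intro i hi
      have := Finset.mem_range.1 hi
      exact projPow_ofPow_of_ne (by omega) _

theorem map_projC_comul (x : CotensorCoalgebra k C M) :
    TensorProduct.map (projC k C M) (projC k C M) (Coalgebra.comul (R := k) x) =
      Coalgebra.comul (R := k) (projC k C M x) := by
  have hC : projC k C M ∘ₗ ofC k C M = LinearMap.id :=
    LinearMap.ext (projC_ofC (k := k) (M := M))
  have hP : ∀ n, projC k C M ∘ₗ ofPow k C M n = 0 := fun n => LinearMap.ext (projC_ofPow n)
  have : TensorProduct.map (projC k C M) (projC k C M) ∘ₗ Coalgebra.comul =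
      Coalgebra.comul ∘ₗ projC k C M := by
    apply hom_ext
    · intro c
      rw [LinearMap.comp_apply, LinearMap.comp_apply, comul_ofC, projC_ofC]
      have := LinearMap.congr_fun (TensorProduct.map_comp (projC k C M) (projC k C M)
        (ofC k C M) (ofC k C M)) (Coalgebra.comul (R := k) c)
      rw [hC, TensorProduct.map_id] at this
      exact this.symm
    · intro n x
      rw [LinearMap.comp_apply, LinearMap.comp_apply, comul_ofPow, projC_ofPow, map_zero, map_add,
        map_sum, Finset.sum_eq_zero, add_zero]
      · have := LinearMap.congr_fun (TensorProduct.map_comp (projC k C M) (projC k C M)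
          (ofC k C M) (ofPow k C M n)) ((cotensorPow k C M n).coact x)
        rw [hP, map_zero_right, LinearMap.zero_apply] at this
        exact this.symm
      · intro i _
        rw [← map_comp_left, hP, map_zero_left, LinearMap.zero_apply]
  exact LinearMap.congr_fun this x

end Grading

/-! ### Contracting the first factor of a cotensor product. -/

section Contraction

/-- The contraction of the left factor of a tensor product with a functional. -/
def contractLeft {k P : Type*} (X : Type*) [Field k] [AddCommMonoid P] [Module k P]
    [AddCommMonoid X] [Module k X] (g : P →ₗ[k] k) : P ⊗[k] X →ₗ[k] X :=
  (TensorProduct.lid k X).toLinearMap ∘ₗ g.rTensor X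

theorem contractLeft_tmul {k P X : Type*} [Field k] [AddCommMonoid P] [Module k P]
    [AddCommMonoid X] [Module k X] (g : P →ₗ[k] k) (p : P) (x : X) :
    contractLeft X g (p ⊗ₜ[k] x) = g p • x := by
  simp [contractLeft]

variable {k E P : Type*} [Field k] [AddCommGroup E] [Module k E] [Coalgebra k E]
  [AddCommGroup P] [Module k P] [Bicomodule k E P]

theorem contractLeft_lTensor {X Y : Type*} [AddCommGroup X] [Module k X] [AddCommGroup Y]
    [Module k Y] (g : P →ₗ[k] k) (f : X →ₗ[k] Y) (z : P ⊗[k] X) :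
    contractLeft Y g (f.lTensor P z) = f (contractLeft X g z) := by
  induction z with
  | zero => simp
  | add a b ha hb => simp only [map_add, ha, hb]
  | tmul a b => simp [contractLeft_tmul]

theorem contractLeft_coactR {X : Type*} [AddCommGroup X] [Module k X] {g g' : P →ₗ[k] k}
    {ε : E →ₗ[k] k} (h : ∀ p, g' p = LinearMap.mul' k k
      (TensorProduct.map g ε ((coactR : P →ₗ[k] P ⊗[k] E) p))) (z : P ⊗[k] X) :
    contractLeft X ε (contractLeft (E ⊗[k] X) g (TensorProduct.assoc k P E X
      ((coactR : P →ₗ[k] P ⊗[k] E).rTensor X z))) = contractLeft X g' z := by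
  have h1 : ∀ (q : P ⊗[k] E) (y : X),
      contractLeft X ε (contractLeft (E ⊗[k] X) g (TensorProduct.assoc k P E X (q ⊗ₜ[k] y))) =
        LinearMap.mul' k k (TensorProduct.map g ε q) • y := by
    intro q y
    induction q with
    | zero => simp
    | add a b ha hb => simp only [add_tmul, map_add, ha, hb, add_smul]
    | tmul a b => simp [contractLeft_tmul, mul_smul]
  induction z with
  | zero => simp
  | add a b ha hb => simp only [map_add, ha, hb]
  | tmul f y => rw [rTensor_tmul, h1, contractLeft_tmul, h]

/-- If a functional on `P` generates all functionals under the right coaction, then contracting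
the left factor with it is injective on cotensor products. -/
theorem contractLeft_cotensor_injective {g : P →ₗ[k] k}
    (hg : ∀ g' : P →ₗ[k] k, ∃ ε : E →ₗ[k] k, ∀ p, g' p = LinearMap.mul' k k
      (TensorProduct.map g ε ((coactR : P →ₗ[k] P ⊗[k] E) p))) (X : LeftComod k E) :
    Function.Injective (contractLeft X.carrier g ∘ₗ (cotensor P X).subtype) := by
  refine (injective_iff_map_eq_zero _).2 fun z hz => Subtype.ext ?_
  have h0 : contractLeft X.carrier g z.1 = 0 := hz
  have hz' : X.coact.lTensor P z.1 = TensorProduct.assoc k P E X.carrier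
    ((coactR : P →ₗ[k] P ⊗[k] E).rTensor X.carrier z.1) := z.2
  have hmem : z.1 ∈ range ((⊥ : Submodule k X.carrier).subtype.lTensor P) := by
    apply mem_range_lTensor_of
    intro g'
    obtain ⟨ε, hε⟩ := hg g'
    have h1 := contractLeft_coactR hε z.1
    rw [← hz', contractLeft_lTensor, h0, map_zero, map_zero] at h1
    exact h1.symm
  obtain ⟨y, hy⟩ := hmem
  have hb : (⊥ : Submodule k X.carrier).subtype = 0 := by
    ext x
    exact (Submodule.mem_bot k).1 x.2
  rw [hb, LinearMap.lTensor_zero, LinearMap.zero_apply] at hy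
  exact hy.symm

end Contraction

theorem mul'_map_eval {k A B : Type*} [Field k] [AddCommGroup A] [Module k A] [AddCommGroup B]
    [Module k B] (a : A) (b : B) (z : Dual k A ⊗[k] Dual k B) :
    LinearMap.mul' k k (TensorProduct.map (Dual.eval k A a) (Dual.eval k B b) z) =
      dualDistrib k A B z (a ⊗ₜ b) := by
  induction z with
  | zero => simp
  | add x y hx hy => simp only [map_add, LinearMap.add_apply, hx, hy]
  | tmul x y => simp

/-- Acting on a nonzero vector is injective over a division ring, hence bijective since both
dimensions are equal. -/
theorem exists_op_smul_eq {k D M : Type*} [Field k] [DivisionRing D] [Algebra k D]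
    [FiniteDimensional k D] [AddCommGroup M] [Module k M] [Module Dᵐᵒᵖ M] [IsScalarTower k Dᵐᵒᵖ M]
    [FiniteDimensional k M] (e : M ≃ₗ[k] D) {m : M} (hm : m ≠ 0) (x : M) : ∃ d : D, MulOpposite.op d • m = x := by
  let ψ : D →ₗ[k] M := rightAct k D M ∘ₗ TensorProduct.mk k M D m
  have hψ : Function.Injective ψ := by
    refine (injective_iff_map_eq_zero _).2 fun d hd => ?_
    have h1 : MulOpposite.op d • m = 0 := hd
    rcases smul_eq_zero.1 h1 with h2 | h2
    · exact (MulOpposite.op_eq_zero_iff d).1 h2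
    · exact absurd h2 hm
  exact (LinearMap.injective_iff_surjective_of_finrank_eq_finrank e.finrank_eq.symm).1 hψ x

/-! ### Right coideals of the cotensor coalgebra of a bimodule of the dimension of `D`. -/

section DualAction

variable (k D M : Type*) [Field k] [DivisionRing D] [Algebra k D] [FiniteDimensional k D]
  [AddCommGroup M] [Module k M] [Module D M] [Module Dᵐᵒᵖ M] [IsScalarTower k D M]
  [IsScalarTower k Dᵐᵒᵖ M] [SMulCommClass D Dᵐᵒᵖ M] [FiniteDimensional k M]

local notation "T" => CotensorCoalgebra k (Dual k D) (Dual k M)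

/-- The inclusion of `D` into the algebra dual to the cotensor coalgebra. -/
def evalDegZero : D →ₐ[k] DualAlgebra k T :=
  AlgHom.ofLinearMap
    { toFun := fun d => toConv (Dual.eval k D d ∘ₗ projC k (Dual k D) (Dual k M))
      map_add' := fun a b => by rw [map_add]; rfl
      map_smul' := fun t a => by rw [map_smul]; rfl }
    (WithConv.ext (LinearMap.ext fun x => (counit_eq_projC x).symm))
    (fun a b => WithConv.ext (LinearMap.ext fun x => by
      change projC k _ _ x (a * b) = LinearMap.mul' k k (TensorProduct.map
        (Dual.eval k D a ∘ₗ projC k _ _) (Dual.eval k D b ∘ₗ projC k _ _)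
        (Coalgebra.comul (R := k) x))
      rw [TensorProduct.map_comp, LinearMap.comp_apply, map_projC_comul]
      rw [mul'_map_eval]
      exact (LinearMap.congr_fun (dualDistrib_codual (LinearMap.mul' k D) _) (a ⊗ₜ b)).symm))

variable {k D M}

/-- Such functionals vanish in positive degree, so only the cut with right factor of degree zero
survives and the degree is preserved. -/
theorem leftHit_evalDegZero_mem_piece (d : D) {n : ℕ} {x : T} (hx : x ∈ piece k _ _ n) :
    leftHit (evalDegZero k D M d).ofConv x ∈ piece k (Dual k D) (Dual k M) n := by
  rcases n with _ | n
  · obtain ⟨c, rfl⟩ := hx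
    rw [leftHit_ofC]
    exact ⟨_, rfl⟩
  · obtain ⟨y, rfl⟩ := hx
    have hf : ∀ i, (evalDegZero k D M d).ofConv ∘ₗ ofPow k (Dual k D) (Dual k M) i = 0 :=
      fun i => LinearMap.ext fun z => rfl
    rw [leftHit_ofPow, hf, lTensor_zero, LinearMap.zero_apply, map_zero, map_zero, zero_add,
      Finset.sum_range_succ, Finset.sum_eq_zero, zero_add]
    · exact ⟨_, rfl⟩
    · intro i hi
      rw [lTensor_split_of_lt hf n i (Finset.mem_range.1 hi), map_zero, map_zero]

section Dimension

variable (e : M ≃ₗ[k] D)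

include e

theorem contractLeft_eval_injective {m : M} (hm : m ≠ 0) (X : LeftComod k (Dual k D)) :
    Function.Injective (contractLeft X.carrier (Dual.eval k M m) ∘ₗ
      (cotensor (Dual k M) X).subtype) := by
  refine contractLeft_cotensor_injective (fun g' => ?_) X
  obtain ⟨x, rfl⟩ := (Module.evalEquiv k M).surjective g'
  obtain ⟨d, rfl⟩ := exists_op_smul_eq e hm x
  refine ⟨Dual.eval k D d, fun p => ?_⟩
  rw [mul'_map_eval]
  exact (LinearMap.congr_fun (dualDistrib_codual (rightAct k D M) p) (m ⊗ₜ d)).symm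

/-- Contraction with a nonzero vector of `M` embeds each cotensor power in the preceding one, so
dimensions cannot grow. -/
theorem finrank_cotensorPow_le (n : ℕ) :
    FiniteDimensional k (cotensorPow k (Dual k D) (Dual k M) n).carrier ∧
      finrank k (cotensorPow k (Dual k D) (Dual k M) n).carrier ≤ finrank k D := by
  induction n with
  | zero =>
    refine ⟨inferInstanceAs (FiniteDimensional k (Dual k M)), ?_⟩
    exact (Subspace.dual_finrank_eq.trans e.finrank_eq).le
  | succ n ih =>
    obtain ⟨_, h⟩ := ih
    have hm : e.symm 1 ≠ 0 := fun h0 => one_ne_zero ((map_eq_zero_iff _ e.symm.injective).1 h0)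
    have hinj := contractLeft_eval_injective e hm (cotensorPow k (Dual k D) (Dual k M) n)
    exact ⟨FiniteDimensional.of_injective _ hinj,
      (LinearMap.finrank_le_finrank_of_injective hinj).trans h⟩

theorem finrank_piece_le (n : ℕ) :
    FiniteDimensional k (piece k (Dual k D) (Dual k M) n) ∧
      finrank k (piece k (Dual k D) (Dual k M) n) ≤ finrank k D := by
  rcases n with _ | n
  · exact ⟨LinearMap.finiteDimensional_range (ofC k (Dual k D) (Dual k M)),
      (LinearMap.finrank_range_le _).trans Subspace.dual_finrank_eq.le⟩
  · obtain ⟨_, h⟩ := finrank_cotensorPow_le (k := k) e n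
    exact ⟨LinearMap.finiteDimensional_range (ofPow k (Dual k D) (Dual k M) n),
      (LinearMap.finrank_range_le _).trans h⟩

/-- A right coideal which contains a nonzero homogeneous element contains its whole component. -/
theorem piece_le_of_mem {N : Submodule k T} (hN : IsRightCoideal N) {n : ℕ} {x : T}
    (hx : x ∈ piece k _ _ n) (hxN : x ∈ N) (hx0 : x ≠ 0) :
    piece k (Dual k D) (Dual k M) n ≤ N := by
  let Λ : D →ₗ[k] T :=
    { toFun := fun d => leftHit (evalDegZero k D M d).ofConv x
      map_add' := fun a b => by rw [map_add, ofConv_add, leftHit_add]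
      map_smul' := fun t a => by rw [map_smul, ofConv_smul, leftHit_smul, RingHom.id_apply] }
  -- The action of a nonzero `d` is undone by that of `d⁻¹`, so the orbit of `x` has dimension `dim
  -- D`, the upper bound for the component.
  have hΛ : Function.Injective Λ := by
    refine (injective_iff_map_eq_zero _).2 fun d hd => ?_
    by_contra hne
    apply hx0
    have h1 := leftHit_mul (evalDegZero k D M d⁻¹) (evalDegZero k D M d) x
    rw [← map_mul, inv_mul_cancel₀ hne, map_one, leftHit_one] at h1
    rw [h1]
    exact (congrArg _ hd).trans (map_zero _)
  obtain ⟨_, hle⟩ := finrank_piece_le (k := k) (M := M) e n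
  have h1 : range Λ ≤ piece k (Dual k D) (Dual k M) n := by
    rintro _ ⟨d, rfl⟩
    exact leftHit_evalDegZero_mem_piece d hx
  have h2 : range Λ = piece k (Dual k D) (Dual k M) n :=
    Submodule.eq_of_le_of_finrank_le h1 (by rwa [LinearMap.finrank_range_of_inj hΛ])
  rw [← h2]
  rintro _ ⟨d, rfl⟩
  exact isRightCoideal_iff.1 hN x hxN _

/-- A functional of degree one produces an element of `N` of the next lower degree. By induction `N`
contains all lower components, so the top component of `x` may be isolated in `N`. -/
theorem degFil_le_of_mem {N : Submodule k T} (hN : IsRightCoideal N) (n : ℕ) {x : T}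
    (hxN : x ∈ N) (hx : x ∈ degFil k _ _ (n + 1)) (hx' : x ∉ degFil k _ _ n) :
    degFil k (Dual k D) (Dual k M) (n + 1) ≤ N := by
  have hstep : degFil k (Dual k D) (Dual k M) n ≤ N →
      degFil k (Dual k D) (Dual k M) (n + 1) ≤ N := by
    intro hle
    refine sup_le hle ?_
    obtain ⟨z, hz, p, hp, rfl⟩ := Submodule.mem_sup.1 hx
    refine piece_le_of_mem e hN hp ?_ fun hp0 => ?_
    · have := sub_mem hxN (hle hz)
      rwa [add_sub_cancel_left] at this
    · rw [hp0, add_zero] at hx'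
      exact hx' hz
  induction n generalizing x with
  | zero => exact hstep bot_le
  | succ n ih =>
    obtain ⟨f, hf, hf'⟩ := exists_leftHit_notMem hx hx'
    have hfN := isRightCoideal_iff.1 hN x hxN f
    -- The induction has generalised `hstep` along with `n`, so its lower instance is proved anew,
    -- with `leftHit f x` in place of `x`.
    refine hstep (ih hfN hf hf' fun hle => ?_)
    refine sup_le hle ?_
    obtain ⟨z, hz, p, hp, hzp⟩ := Submodule.mem_sup.1 hf
    refine piece_le_of_mem e hN hp ?_ fun hp0 => ?_
    · have := sub_mem hfN (hle hz)
      rwa [← hzp, add_sub_cancel_left] at this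
    · rw [← hzp, hp0, add_zero] at hf'
      exact hf' hz

theorem isChainCoalgebra : IsChainCoalgebra k T := by
  intro N N' hN hN'
  rw [or_iff_not_imp_left]
  intro hle y hy
  obtain ⟨x, hx, hxN'⟩ := SetLike.not_le_iff_exists.1 hle
  by_cases hy0 : y = 0
  · rw [hy0]
    exact zero_mem _
  have hx0 : x ≠ 0 := by
    rintro rfl
    exact hxN' (zero_mem _)
  obtain ⟨n, hn, hn'⟩ := exists_degree hx0
  obtain ⟨m, hm, hm'⟩ := exists_degree hy0
  have h1 := degFil_le_of_mem e hN n hx hn hn'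
  have h2 := degFil_le_of_mem e hN' m hy hm hm'
  -- If `y` had the larger degree, `N'` would contain everything up to that degree, including `x`.
  have hmn : m ≤ n := by
    by_contra hlt
    exact hxN' (h2 (degFil_mono (by omega) hn))
  exact h1 (degFil_mono (by omega) hm)

/-- Every nonzero right coideal contains the component of degree zero, which is therefore the unique
simple right coideal. -/
theorem coradical_eq_range_ofC :
    coradical k T = range (ofC k (Dual k D) (Dual k M)) := by
  have hN : IsRightCoideal (range (ofC k (Dual k D) (Dual k M))) := by
    rw [isRightCoideal_iff]
    rintro _ ⟨c, rfl⟩ g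
    rw [leftHit_ofC]
    exact ⟨_, rfl⟩
  have hle : ∀ N : Submodule k T, IsRightCoideal N → N ≠ ⊥ →
      range (ofC k (Dual k D) (Dual k M)) ≤ N := by
    intro N hN h0
    obtain ⟨x, hx, hx0⟩ := Submodule.exists_mem_ne_zero_of_ne_bot h0
    obtain ⟨n, hn, hn'⟩ := exists_degree hx0
    exact (piece_le_degFil (m := 0) (Nat.succ_pos n)).trans (degFil_le_of_mem e hN n hx hn hn')
  have hne : range (ofC k (Dual k D) (Dual k M)) ≠ ⊥ := by
    rw [Ne, LinearMap.range_eq_bot]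
    intro h
    obtain ⟨f, hf⟩ := exists_ne (0 : Dual k D)
    exact hf (ofC_injective (LinearMap.congr_fun h f))
  apply le_antisymm
  · apply sSup_le
    intro N hs
    rcases hs.2.2 _ (hle N hs.1 hs.2.1) hN with h | h
    · exact absurd h hne
    · exact h.ge
  · apply le_sSup
    refine ⟨hN, hne, fun N' hle' hN' => ?_⟩
    by_cases h0 : N' = ⊥
    · exact Or.inl h0
    · exact Or.inr (le_antisymm hle' (hle N' hN' h0))

theorem isChainCoalgebraOfType : IsChainCoalgebraOfType k T D := by
  refine ⟨isChainCoalgebra e, ⟨(AlgEquiv.ofBijective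
    ((restrictCoradical k T).comp (evalDegZero k D M)) ⟨?_, ?_⟩).symm⟩⟩
  · refine (injective_iff_map_eq_zero _).2 fun d hd => ?_
    rw [← Module.forall_dual_apply_eq_zero_iff k]
    intro f
    have hf : ofC k (Dual k D) (Dual k M) f ∈ coradical k T := by
      rw [coradical_eq_range_ofC e]
      exact ⟨f, rfl⟩
    exact LinearMap.congr_fun (congrArg ofConv hd) ⟨_, hf⟩
  · intro g
    obtain ⟨g', hg'⟩ := g.ofConv.exists_extend
    -- A functional on the coradical `D*` is evaluation at an element of `D`, by reflexivity.
    obtain ⟨d, hd⟩ := (Module.evalEquiv k D).surjective (g' ∘ₗ ofC k (Dual k D) (Dual k M))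
    refine ⟨d, WithConv.ext (LinearMap.ext fun x => ?_)⟩
    obtain ⟨f, hf⟩ := (coradical_eq_range_ofC e).le x.2
    have h1 : g.ofConv x = g' x.1 := (LinearMap.congr_fun hg' x).symm
    rw [h1, ← hf]
    change (evalDegZero k D M d).ofConv x.1 = _
    rw [← hf]
    exact LinearMap.congr_fun hd f

end Dimension

end DualAction

end CotensorCoalgebra

end ChainCoalg

end

theorem mainTheorem5 {k : Type u} {D : Type v} [Field k] [DivisionRing D] [Algebra k D]
    [FiniteDimensional k D] :
    (∀ (M : Type w) [AddCommGroup M] [Module k M] [Module D M] [Module Dᵐᵒᵖ M]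
      [IsScalarTower k D M] [IsScalarTower k Dᵐᵒᵖ M] [SMulCommClass D Dᵐᵒᵖ M]
      [FiniteDimensional k M], Nonempty (M ≃ₗ[k] D) →
        ChainCoalg.IsChainCoalgebraOfType k
          (ChainCoalg.CotensorCoalgebra k (Module.Dual k D) (Module.Dual k M)) D) ∧
    (ChainCoalg.IsSeparableAlgebra k D →
      ∀ (C : Type t) [AddCommGroup C] [Module k C] [Coalgebra k C],
        ChainCoalg.IsChainCoalgebraOfType k C D →
        ∃ (M : Type v) (_ : AddCommGroup M) (_ : Module k M) (_ : Module D M) (_ : Module Dᵐᵒᵖ M)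
          (_ : IsScalarTower k D M) (_ : IsScalarTower k Dᵐᵒᵖ M) (_ : SMulCommClass D Dᵐᵒᵖ M)
          (_ : FiniteDimensional k M),
          Nonempty (M ≃ₗ[k] D) ∧
          ∃ φ : C →ₗc[k] ChainCoalg.CotensorCoalgebra k (Module.Dual k D) (Module.Dual k M),
            Function.Injective φ) := by
  refine ⟨fun M _ _ _ _ _ _ _ _ ⟨e⟩ => ChainCoalg.CotensorCoalgebra.isChainCoalgebraOfType e,
    fun hD C _ _ _ hC => ?_⟩
  obtain ⟨τ, φ, hφ⟩ := ChainCoalg.exists_injective_coalgHom hD C hC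
  exact ⟨ChainCoalg.TwistedBimodule τ, inferInstance, inferInstance, inferInstance, inferInstance,
    inferInstance, inferInstance, inferInstance, inferInstance,
    ⟨ChainCoalg.TwistedBimodule.equiv τ⟩, φ, hφ⟩
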